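/- Let $L^p=L^p(\mathbb{C})$ with Lebesgue measure $dm$, and write $p'$ for the exponent conjugate to $p$. For $p\in(1,\infty)$ the Mikhlin--Itskovich algebra $\mathcal{E}_p$ is the space of integral operators $(Af)(x)=\int_{\mathbb{C}}a(x,y)f(y)\,dm(y)$ on $L^p$ with measurable kernel $a$ such that $$\|A\|_{\mathcal{E}_p}=\max\left(\|a\|_{p,p'},\|a^*\|_{p',p}\right)<\infty,\quad a^*(x,y)=\overline{a(y,x)},\quad \|a\|_{r,s}=\left(\int\left(\int|a(x,y)|^{s}\,dm(y)\right)^{r/s}dm(x)\right)^{1/r}.$$ For $F\in\mathcal{E}_p$ of finite rank put $\mathrm{Det}(I+F)=\det(I+F)\,e^{-\mathrm{Tr}F}$, where $\det(I+F)=\prod_j(1+\lambda_j)$ and $\mathrm{Tr}F=\sum_j\lambda_j$ over the nonzero eigenvalues of $F$ with algebraic multiplicity; $\mathrm{Det}(I+\,\cdot\,)$ on $\mathcal{E}_p$ denotes the extension of this function that is continuous for $\|\cdot\|_{\mathcal{E}_p}$. For $k\in\mathbb{C}$ let $$e_k(z)=e^{i(kz+\overline{k}\,\overline{z})},\quad \mathcal{C}f(z)=\frac1\pi\int\frac{f(\zeta)}{z-\zeta}\,dm(\zeta),\quad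 \overline{\mathcal{C}}f(z)=\frac1\pi\int\frac{f(\zeta)}{\overline{z}-\overline{\zeta}}\,dm(\zeta),\quad S_{k,u}h=\tfrac14\,\mathcal{C}\left(u\,e_{-k}\,\overline{\mathcal{C}}\left(e_k\,\overline{u}\,h\right)\right).$$ Let $t\in(1,4/3)$, and norm $L^t\cap L^{t'}$ by $\|u\|_{L^t\cap L^{t'}}=\|u\|_{L^t}+\|u\|_{L^{t'}}$. Let $p>2$ satisfy $$\frac12+\frac1p<\frac1t\quad\text{and}\quad\frac1p+\frac1t>1.$$ Then: 1. For all $k\in\mathbb{C}$ and $u\in L^t\cap L^{t'}$, the formula for $S_{k,u}$ defines a bounded operator on $L^p$ (both integrals converge absolutely almost everywhere), and $S_{k,u}\in\mathcal{E}_p$. 2. The determinant is well defined: the finite-rank operators are dense in $\mathcal{E}_p$, and $\mathrm{Det}(I+\,\cdot\,)$ extends continuously from them to $\mathcal{E}_p$. Put $D(k,u)=\mathrm{Det}(I-S_{k,u})$. 3. $D$ is bounded on $\mathbb{C}\times B$ for every bounded set $B\subset L^t\cap L^{t'}$, and $D$ is continuous on $\mathbb{C}\times(L^t\cap L^{t'})$.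 4. For every $u\in L^t\cap L^{t'}$, $D(k,u)\to1$ as $|k|\to\infty$. 5. For every $R$ there is a constant $C=C(p,t,R)$ such that, whenever $\|u\|_{L^t\cap L^{t'}}\le R$ and $\|v\|_{L^t\cap L^{t'}}\le R$, $$\sup_{k\in\mathbb{C}}|D(k,u)-D(k,v)|\le C\,\|u-v\|_{L^t\cap L^{t'}}.$$ -/

import Mathlib

open MeasureTheory Filter Topology
open scoped ENNReal ComplexConjugate

noncomputable section

namespace DSII

/-- The space `L^p(ℂ)` of complex-valued functions, for Lebesgue measure on `ℂ`. -/
abbrev LpC (p : ℝ) := Lp ℂ (ENNReal.ofReal p) (volume : Measure ℂ)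

/-! ### The Mikhlin–Itskovich algebra `E_p` on `L^p(ℂ)` -/

/-- The mixed norm `(∫ (∫ |a(x,y)|^q dy)^{p/q} dx)^{1/p}`. -/
def mixedNorm (p q : ℝ) (a : ℂ → ℂ → ℂ) : ℝ≥0∞ :=
  (∫⁻ x, (∫⁻ y, ‖a x y‖ₑ ^ q) ^ (p / q)) ^ (1 / p)

/-- `a^*(x,y) = conj (a(y,x))`. -/
def adjKernel (a : ℂ → ℂ → ℂ) : ℂ → ℂ → ℂ := fun x y => conj (a y x)

/-- The norm `max (‖a‖_{p,q}, ‖a^*‖_{q,p})` of a kernel, `q` being the exponent conjugate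
to `p`. -/
def kernelNorm (p : ℝ) (a : ℂ → ℂ → ℂ) : ℝ≥0∞ :=
  max (mixedNorm p p.conjExponent a) (mixedNorm p.conjExponent p (adjKernel a))

variable (p : ℝ) [Fact (1 ≤ ENNReal.ofReal p)]

/-- `A` is the integral operator with the measurable kernel `a`. -/
def IsIntegralKernel (A : LpC p →L[ℂ] LpC p) (a : ℂ → ℂ → ℂ) : Prop :=
  AEStronglyMeasurable (Function.uncurry a) (volume : Measure (ℂ × ℂ)) ∧
    ∀ f : LpC p, (A f : ℂ → ℂ) =ᵐ[volume] fun x => ∫ y, a x y * f y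

/-- Membership in `E_p`: `A` is an integral operator whose kernel has finite norm. -/
def MemEp (A : LpC p →L[ℂ] LpC p) : Prop :=
  ∃ a : ℂ → ℂ → ℂ, IsIntegralKernel p A a ∧ kernelNorm p a < ∞

/-- The norm of `E_p`, with the value `∞` outside of `E_p`. A kernel of finite norm is
determined by its operator up to null sets, so the infimum is over a single finite value
whenever `A` is in `E_p`. -/
def epNorm (A : LpC p →L[ℂ] LpC p) : ℝ≥0∞ :=
  ⨅ (a : ℂ → ℂ → ℂ) (_ : IsIntegralKernel p A a), kernelNorm p a

/-- The neighbourhoods of `A` for the norm of `E_p`; for `A` in `E_p`, all operators at a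
finite `E_p`-distance of `A` are in `E_p`. -/
def epNhds (A : LpC p →L[ℂ] LpC p) : Filter (LpC p →L[ℂ] LpC p) :=
  comap (fun B => epNorm p (B - A)) (𝓝 0)

/-! ### The renormalized determinant -/

/-- The finite-rank operators that belong to `E_p`. -/
def finiteRankEp : Set (LpC p →L[ℂ] LpC p) :=
  {F | MemEp p F ∧ FiniteDimensional ℂ (LinearMap.range F.toLinearMap)}

/-- The restriction of `F` to its own range. -/
def onRange (F : LpC p →L[ℂ] LpC p) : Module.End ℂ (LinearMap.range F.toLinearMap) :=
  F.toLinearMap.rangeRestrict ∘ₗ (LinearMap.range F.toLinearMap).subtype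

/-- `det (I + F) * exp (- Tr F)` for `F` of finite rank. The nonzero eigenvalues of `F`, with
algebraic multiplicities, are those of the restriction of `F` to its range, so that
`det (I + F) = ∏ (1 + λ_j)` and `Tr F = ∑ λ_j` may be computed there. -/
def finiteRankDet (F : LpC p →L[ℂ] LpC p) : ℂ :=
  LinearMap.det (1 + onRange p F) * Complex.exp (-LinearMap.trace ℂ _ (onRange p F))

/-- `Det (I + A)` for `A` in `E_p`: the extension by continuity, for the norm of `E_p`, of
`finiteRankDet` from the finite-rank operators in `E_p`. -/
def renormDet (A : LpC p →L[ℂ] LpC p) : ℂ :=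
  limUnder (epNhds p A ⊓ 𝓟 (finiteRankEp p)) (finiteRankDet p)

/-! ### The operator `S_{k,u}` -/

/-- `e_k(z) = exp (i (k z + conj k conj z))`. -/
def ek (k z : ℂ) : ℂ := Complex.exp (Complex.I * (k * z + conj k * conj z))

/-- The solid Cauchy transform `(1/π) ∫ f(ζ) / (z - ζ) dm(ζ)`. -/
def cauchy (f : ℂ → ℂ) (z : ℂ) : ℂ :=
  (1 / (Real.pi : ℂ)) * ∫ ζ, (z - ζ)⁻¹ * f ζ

/-- The conjugate transform `(1/π) ∫ f(ζ) / (conj z - conj ζ) dm(ζ)`. -/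
def cauchyBar (f : ℂ → ℂ) (z : ℂ) : ℂ :=
  (1 / (Real.pi : ℂ)) * ∫ ζ, (conj z - conj ζ)⁻¹ * f ζ

/-- The argument `e_k ū h` of the inner transform. -/
def innerArg (k : ℂ) (u h : ℂ → ℂ) (w : ℂ) : ℂ := ek k w * conj (u w) * h w

/-- The argument `u e_{-k} cauchyBar (e_k ū h)` of the outer transform. -/
def outerArg (k : ℂ) (u h : ℂ → ℂ) (ζ : ℂ) : ℂ :=
  u ζ * ek (-k) ζ * cauchyBar (innerArg k u h) ζ

/-- `T` is the operator `h ↦ (1/4) cauchy (u e_{-k} cauchyBar (e_k ū h))` on `L^p`, where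
both integrals converge absolutely at almost every point. -/
def IsScatteringOp (k : ℂ) (u : ℂ → ℂ) (T : LpC p →L[ℂ] LpC p) : Prop :=
  ∀ h : LpC p,
    (∀ᵐ ζ : ℂ, Integrable fun w => (conj ζ - conj w)⁻¹ * innerArg k u h w) ∧
    (∀ᵐ z : ℂ, Integrable fun ζ => (z - ζ)⁻¹ * outerArg k u h ζ) ∧
    (T h : ℂ → ℂ) =ᵐ[volume] fun z => (1 / 4) * cauchy (outerArg k u h) z

open Classical in
/-- The bounded operator `S_{k,u}` on `L^p` (and `0` if there is no such operator). -/
def scatteringOp (k : ℂ) (u : ℂ → ℂ) : LpC p →L[ℂ] LpC p :=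
  if h : ∃ T, IsScatteringOp p k u T then h.choose else 0

/-- `D(k,u) = Det (I - S_{k,u})`. -/
def scatteringDet (k : ℂ) (u : ℂ → ℂ) : ℂ := renormDet p (-scatteringOp p k u)

/-! ### The space of potentials `L^t ∩ L^{t'}` -/

/-- Membership in `L^t(ℂ) ∩ L^{t'}(ℂ)`, `t'` being the exponent conjugate to `t`. -/
def MemPot (t : ℝ) (u : ℂ → ℂ) : Prop :=
  MemLp u (ENNReal.ofReal t) volume ∧ MemLp u (ENNReal.ofReal t.conjExponent) volume

/-- The norm `‖u‖_{L^t} + ‖u‖_{L^{t'}}`. -/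
def potNorm (t : ℝ) (u : ℂ → ℂ) : ℝ :=
  (eLpNorm u (ENNReal.ofReal t) volume).toReal +
    (eLpNorm u (ENNReal.ofReal t.conjExponent) volume).toReal

end DSII

end

/-! The core is a bound for `det (I + F) * exp (- Tr F)` at finite rank that depends only on the
norm of `F` in `E_p`. In a Hilbert space it is classical: |det(1+N)|² = det((1+N)*(1+N)) is at most
exp(tr((1+N)*(1+N)) - n), because λ ≤ exp(λ - 1) for every eigenvalue, and the factor exp(-tr N)
removes the linear term, leaving only the Hilbert–Schmidt norm.

For p > 2 an operator of `E_p` becomes Hilbert–Schmidt after conjugation by a weight. Let B(y) be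
‖a(·,y)‖_p^{p'} plus a small positive integrable function, and w = B^{1/2-1/p}. By Hölder,
multiplication by w maps L^p into L², and the kernel w(x) a(x,y) / w(y) has squared Hilbert–Schmidt
norm at most (∫B)^{2-2/p}. Conjugation changes neither determinant nor trace, which gives
`norm_finiteRankDet_sq_le`.

The regularized determinant is entire along complex lines, so Cauchy's estimate turns boundedness on
balls into a Lipschitz bound (`exists_lipschitz_finiteRankDet`). Finite-rank operators are dense, by
dominated convergence in the mixed norms (`approximable_of_kernelNorm_ne_top`). Hence the
determinant extends to `E_p` and stays bounded and Lipschitz on balls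
(`exists_lipschitz_renormDet`).

By Fubini, `S_{k,u}` has an explicit kernel whose modulus is dominated by a kernel free of k.
Splitting 1/|z| at |z| = 1 gives pieces in L^r with r slightly below and slightly above 2; Young and
Hölder then bound the norm by a product of two potential norms (`exists_kernelE_iterKernel_kap_le`).
Bilinearity of the kernel in u and ū gives the Lipschitz dependence on u, uniformly in k. The
majorant free of k allows dominated convergence: pointwise continuity of the kernel gives continuity
in k, and the Riemann–Lebesgue lemma gives S → 0 in `E_p`, hence D → 1, as |k| → ∞. -/

noncomputable section

namespace DSII

/-! ### Independence of the regularized determinant from the ambient subspace -/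

section LinearAlgebra

/-- The determinant of `1 + e` may be computed on any submodule containing the range of `e`. -/
theorem det_one_add_restrict {V : Type*} [AddCommGroup V] [Module ℂ V] [FiniteDimensional ℂ V]
    (R : Submodule ℂ V) (e : V →ₗ[ℂ] V) (h : ∀ v, e v ∈ R) (h' : ∀ v ∈ R, e v ∈ R) :
    LinearMap.det (1 + e) = LinearMap.det (1 + e.restrict h') := by
  have he : R ≤ R.comap (1 + e) := fun v hv => R.add_mem hv (h v)
  rw [LinearMap.det_eq_det_mul_det R (1 + e) he]
  -- Modulo `R` the map `e` vanishes, so the factor of the determinant on the quotient is 1.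
  have h1 : R.mapQ R (1 + e) he = LinearMap.id := by
    ext v
    simp only [LinearMap.comp_apply, Submodule.mkQ_apply, Submodule.mapQ_apply,
      LinearMap.add_apply, Module.End.one_apply, LinearMap.id_apply]
    rw [Submodule.Quotient.eq]
    simpa using h v
  rw [h1, LinearMap.det_id, mul_one]
  rfl

variable {V : Type*} [AddCommGroup V] [Module ℂ V]

/-- The restriction of `F` to a submodule containing its range. -/
def restrictTo (F : V →ₗ[ℂ] V) (W : Submodule ℂ V) (h : ∀ v, F v ∈ W) : Module.End ℂ W :=
  F.codRestrict W h ∘ₗ W.subtype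

/-- `det (1 + e) * exp (- tr e)` for an endomorphism `e`. -/
def expDet {W : Type*} [AddCommGroup W] [Module ℂ W] (e : Module.End ℂ W) : ℂ :=
  LinearMap.det (1 + e) * Complex.exp (-LinearMap.trace ℂ W e)

theorem expDet_conj {W W' : Type*} [AddCommGroup W] [Module ℂ W] [AddCommGroup W'] [Module ℂ W']
    (e : Module.End ℂ W) (φ : W ≃ₗ[ℂ] W') : expDet (φ.conj e) = expDet e := by
  unfold expDet
  rw [LinearMap.trace_conj']
  have : (1 : Module.End ℂ W') + φ.conj e = φ.conj (1 + e) := by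
    rw [map_add]; congr 1; ext; simp
  rw [this, LinearEquiv.conj_apply, LinearMap.comp_assoc, LinearMap.det_conj]

/-- Only the range contributes to determinant and trace. This allows several finite-rank operators
to be compared on one common finite-dimensional space. -/
theorem expDet_restrictTo_of_le (F : V →ₗ[ℂ] V) (R W : Submodule ℂ V) [FiniteDimensional ℂ W]
    (hRW : R ≤ W) (hR : ∀ v, F v ∈ R) :
    expDet (restrictTo F W fun v => hRW (hR v)) = expDet (restrictTo F R hR) := by
  set e := restrictTo F W fun v => hRW (hR v) with he
  have h : ∀ v, e v ∈ R.comap W.subtype := fun v => hR _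
  have h' : ∀ v ∈ R.comap W.subtype, e v ∈ R.comap W.subtype := fun v _ => h v
  have key : restrictTo F R hR
      = (Submodule.comapSubtypeEquivOfLe hRW).conj (e.restrict h') := by
    ext v
    rfl
  rw [key, expDet_conj, expDet, expDet, det_one_add_restrict _ e h h',
    LinearMap.trace_restrict_eq_of_forall_mem _ e h]

end LinearAlgebra

/-! ### The Hilbert–Schmidt bound for matrices -/

section Hilbert

-- The inequality λ ≤ exp(λ - 1) is multiplied over the nonnegative eigenvalues.
open scoped ComplexOrder in
theorem _root_.Matrix.PosSemidef.det_re_le_exp {n : Type*} [Fintype n] [DecidableEq n]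
    {A : Matrix n n ℂ} (hA : A.PosSemidef) :
    A.det.re ≤ Real.exp (A.trace.re - Fintype.card n) := by
  have h1 : A.det = ((∏ i, hA.isHermitian.eigenvalues i : ℝ) : ℂ) := by
    rw [hA.isHermitian.det_eq_prod_eigenvalues]; push_cast; rfl
  have h2 : A.trace = ((∑ i, hA.isHermitian.eigenvalues i : ℝ) : ℂ) := by
    rw [hA.isHermitian.trace_eq_sum_eigenvalues]; push_cast; rfl
  rw [h1, h2, Complex.ofReal_re, Complex.ofReal_re]
  have h3 : (∑ i, hA.isHermitian.eigenvalues i) - Fintype.card n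
      = ∑ i, (hA.isHermitian.eigenvalues i - 1) := by
    simp [Finset.sum_sub_distrib]
  rw [h3, Real.exp_sum]
  refine Finset.prod_le_prod (fun i _ => hA.eigenvalues_nonneg i) fun i _ => ?_
  have := Real.add_one_le_exp (hA.isHermitian.eigenvalues i - 1)
  linarith

-- The preceding bound is applied to (1+N)*(1+N), whose trace is n + 2 Re tr N + ‖N‖² in the
-- Hilbert–Schmidt norm.
open scoped ComplexOrder in
theorem _root_.Matrix.norm_det_one_add_sq_le {n : Type*} [Fintype n] [DecidableEq n]
    (N : Matrix n n ℂ) :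
    ‖(1 + N).det‖ ^ 2 ≤ Real.exp (2 * N.trace.re + ∑ j, ∑ i, ‖N i j‖ ^ 2) := by
  have h := (Matrix.posSemidef_conjTranspose_mul_self (1 + N)).det_re_le_exp
  have h1 : ((1 + N).conjTranspose * (1 + N)).det.re = ‖(1 + N).det‖ ^ 2 := by
    rw [Matrix.det_mul, Matrix.det_conjTranspose, Complex.star_def,
      ← Complex.normSq_eq_conj_mul_self, Complex.ofReal_re, Complex.normSq_eq_norm_sq]
  have h2 : (N.conjTranspose * N).trace.re = ∑ j, ∑ i, ‖N i j‖ ^ 2 := by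
    simp only [Matrix.trace, Matrix.diag_apply, Matrix.mul_apply, Matrix.conjTranspose_apply,
      Complex.re_sum, Complex.star_def, ← Complex.normSq_eq_conj_mul_self, Complex.ofReal_re,
      Complex.normSq_eq_norm_sq]
  have h3 : ((1 + N).conjTranspose * (1 + N)).trace.re - Fintype.card n
      = 2 * N.trace.re + ∑ j, ∑ i, ‖N i j‖ ^ 2 := by
    rw [← h2, Matrix.conjTranspose_add, Matrix.conjTranspose_one, add_mul, mul_add, mul_add]
    simp only [Matrix.trace_add, Matrix.trace_one, one_mul, mul_one, Matrix.trace_conjTranspose,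
      Complex.add_re, Complex.star_def, Complex.conj_re, Complex.natCast_re]
    ring
  rw [h1, h3] at h
  exact h

/-- The exponential of minus the trace cancels exactly the term 2 Re tr N. The remaining exponent
does not see the dimension, which is what survives in the infinite-dimensional limit. -/
theorem norm_expDet_sq_le {U : Type*} [NormedAddCommGroup U] [InnerProductSpace ℂ U]
    {n : Type*} [Fintype n] (e : OrthonormalBasis n ℂ U)
    (T : Module.End ℂ U) :
    ‖expDet T‖ ^ 2 ≤ Real.exp (∑ j, ‖T (e j)‖ ^ 2) := by
  classical
  set N := LinearMap.toMatrix e.toBasis e.toBasis T with hN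
  have hdet : LinearMap.det (1 + T) = (1 + N).det := by
    rw [← LinearMap.det_toMatrix e.toBasis, map_add, hN, LinearMap.toMatrix_one]
  have htr : LinearMap.trace ℂ U T = N.trace := LinearMap.trace_eq_matrix_trace ℂ e.toBasis T
  have hs : ∀ j, ‖T (e j)‖ ^ 2 = ∑ i, ‖N i j‖ ^ 2 := by
    intro j
    rw [← e.sum_sq_norm_inner_right (T (e j))]
    refine Finset.sum_congr rfl fun i _ => ?_
    rw [hN, LinearMap.toMatrix_apply, OrthonormalBasis.coe_toBasis,
      OrthonormalBasis.coe_toBasis_repr_apply, e.repr_apply_apply]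
  rw [expDet, norm_mul, mul_pow, Complex.norm_exp, hdet, htr]
  simp_rw [hs]
  calc ‖(1 + N).det‖ ^ 2 * Real.exp ((-N.trace).re) ^ 2
      ≤ Real.exp (2 * N.trace.re + ∑ j, ∑ i, ‖N i j‖ ^ 2) * Real.exp ((-N.trace).re) ^ 2 := by
        gcongr; exact N.norm_det_one_add_sq_le
    _ = _ := by
        rw [← Real.exp_nat_mul, ← Real.exp_add]
        congr 1
        simp only [Complex.neg_re]
        push_cast
        ring

/-- `z ↦ det (1 + A + z B) exp (- tr (A + z B))` is entire. -/
theorem differentiable_expDet {W : Type*} [AddCommGroup W] [Module ℂ W] [FiniteDimensional ℂ W]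
    (A B : Module.End ℂ W) : Differentiable ℂ fun z : ℂ => expDet (A + z • B) := by
  classical
  unfold expDet
  refine Differentiable.mul ?_ (Differentiable.cexp ?_)
  · let b := Module.finBasis ℂ W
    have : (fun z : ℂ => LinearMap.det (1 + (A + z • B))) = fun z =>
        (1 + (LinearMap.toMatrix b b A + z • LinearMap.toMatrix b b B)).det := by
      ext z
      rw [← LinearMap.det_toMatrix b, map_add, map_add, map_smul, LinearMap.toMatrix_one]
    rw [this]
    simp only [Matrix.det_apply]
    refine Differentiable.fun_sum fun σ _ => Differentiable.const_smul ?_ _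
    refine Differentiable.fun_finsetProd fun i _ => ?_
    simp only [Matrix.add_apply, Matrix.smul_apply, smul_eq_mul]
    fun_prop
  · simp only [map_add, map_smul, smul_eq_mul]
    fun_prop

end Hilbert

/-! ### The determinant of finite-rank operators as an analytic function -/

section FiniteRank

variable (p : ℝ) [Fact (1 ≤ ENNReal.ofReal p)]

theorem finiteRankDet_eq_expDet (F : LpC p →L[ℂ] LpC p) (W : Submodule ℂ (LpC p))
    [FiniteDimensional ℂ W] (h : ∀ f, F f ∈ W) :
    finiteRankDet p F = expDet (restrictTo F.toLinearMap W h) := by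
  have hR : LinearMap.range F.toLinearMap ≤ W := by
    rintro _ ⟨f, rfl⟩; exact h f
  exact (expDet_restrictTo_of_le F.toLinearMap (LinearMap.range F.toLinearMap) W hR
    fun v => ⟨v, rfl⟩).symm

/-- The range of `F + z • G` varies with z but stays in the sum of the two ranges, where the
determinant is that of a fixed pencil of endomorphisms. -/
theorem differentiable_finiteRankDet (F G : LpC p →L[ℂ] LpC p)
    (hF : FiniteDimensional ℂ (LinearMap.range F.toLinearMap))
    (hG : FiniteDimensional ℂ (LinearMap.range G.toLinearMap)) :
    Differentiable ℂ fun z : ℂ => finiteRankDet p (F + z • G) := by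
  set W := LinearMap.range F.toLinearMap ⊔ LinearMap.range G.toLinearMap with hW
  have h1 : ∀ f, F f ∈ W := fun f => Submodule.mem_sup_left ⟨f, rfl⟩
  have h2 : ∀ f, G f ∈ W := fun f => Submodule.mem_sup_right ⟨f, rfl⟩
  have h3 : ∀ (z : ℂ) f, (F + z • G) f ∈ W := fun z f => W.add_mem (h1 f) (W.smul_mem z (h2 f))
  have : (fun z : ℂ => finiteRankDet p (F + z • G)) = fun z : ℂ =>
      expDet (restrictTo F.toLinearMap W h1 + z • restrictTo G.toLinearMap W h2) := by
    ext z
    rw [finiteRankDet_eq_expDet p _ W (h3 z)]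
    rfl
  rw [this]
  exact differentiable_expDet _ _

end FiniteRank

/-! ### `L^s` seminorms of nonnegative functions -/

section LpSeminorm

/-- The `L^s` seminorm of a function `ℂ → ℝ≥0∞`. -/
def lpE (s : ℝ) (f : ℂ → ℝ≥0∞) : ℝ≥0∞ := (∫⁻ x, f x ^ s) ^ (1 / s)

theorem lpE_mono_ae {s : ℝ} (hs : 0 < s) {f g : ℂ → ℝ≥0∞} (h : ∀ᵐ x, f x ≤ g x) :
    lpE s f ≤ lpE s g := by
  unfold lpE
  gcongr ?_ ^ _
  refine lintegral_mono_ae ?_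
  filter_upwards [h] with x hx
  gcongr

theorem lpE_mono {s : ℝ} (hs : 0 < s) {f g : ℂ → ℝ≥0∞} (h : ∀ x, f x ≤ g x) :
    lpE s f ≤ lpE s g := lpE_mono_ae hs (ae_of_all _ h)

theorem lpE_add_le {s : ℝ} (hs : 1 ≤ s) {f g : ℂ → ℝ≥0∞} (hf : AEMeasurable f)
    (hg : AEMeasurable g) : lpE s (fun x => f x + g x) ≤ lpE s f + lpE s g :=
  ENNReal.lintegral_Lp_add_le hf hg hs

theorem lpE_rpow {s : ℝ} (hs : 0 < s) (f : ℂ → ℝ≥0∞) : lpE s f ^ s = ∫⁻ x, f x ^ s := by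
  rw [lpE, ← ENNReal.rpow_mul, one_div_mul_cancel hs.ne', ENNReal.rpow_one]

theorem lpE_const_mul {s : ℝ} (hs : 0 < s) {c : ℝ≥0∞} (hc : c ≠ ∞) (f : ℂ → ℝ≥0∞) :
    lpE s (fun x => c * f x) = c * lpE s f := by
  unfold lpE
  simp_rw [ENNReal.mul_rpow_of_nonneg _ _ hs.le]
  rw [lintegral_const_mul' _ _ (ENNReal.rpow_ne_top_of_nonneg hs.le hc),
    ENNReal.mul_rpow_of_nonneg _ _ (by positivity), ← ENNReal.rpow_mul,
    mul_one_div_cancel hs.ne', ENNReal.rpow_one]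

theorem lpE_ne_top_iff {s : ℝ} (hs : 0 < s) {f : ℂ → ℝ≥0∞} :
    lpE s f ≠ ∞ ↔ ∫⁻ x, f x ^ s ≠ ∞ := by
  rw [lpE, ne_eq, ne_eq, ENNReal.rpow_eq_top_iff_of_pos (by positivity)]

theorem lpE_tendsto_zero {s : ℝ} (hs : 0 < s) {F : ℕ → ℂ → ℝ≥0∞} {B : ℂ → ℝ≥0∞}
    (hF : ∀ n, AEMeasurable (F n)) (hB : lpE s B ≠ ∞) (hFB : ∀ n, ∀ᵐ x, F n x ≤ B x)
    (hlim : ∀ᵐ x, Tendsto (fun n => F n x) atTop (𝓝 0)) :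
    Tendsto (fun n => lpE s (F n)) atTop (𝓝 0) := by
  unfold lpE
  have h : Tendsto (fun n => ∫⁻ x, F n x ^ s) atTop (𝓝 (∫⁻ _ : ℂ, 0)) := by
    refine tendsto_lintegral_of_dominated_convergence' (fun x => B x ^ s)
      (fun n => (hF n).pow_const _) (fun n => ?_) ((lpE_ne_top_iff hs).1 hB) ?_
    · filter_upwards [hFB n] with x hx
      gcongr
    · filter_upwards [hlim] with x hx
      have := hx.ennrpow_const s
      rwa [ENNReal.zero_rpow_of_pos hs] at this
  have := h.ennrpow_const (1 / s)
  rwa [lintegral_zero, ENNReal.zero_rpow_of_pos (by positivity)] at this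

theorem lintegral_mul_le_lpE {p q : ℝ} (hpq : p.HolderConjugate q) {f g : ℂ → ℝ≥0∞}
    (hf : AEMeasurable f) (hg : AEMeasurable g) :
    ∫⁻ x, f x * g x ≤ lpE p f * lpE q g :=
  ENNReal.lintegral_mul_le_Lp_mul_Lq volume hpq hf hg

theorem eLpNorm_ofReal {E : Type*} [NormedAddCommGroup E] {p : ℝ} (hp : 0 < p) (f : ℂ → E) :
    eLpNorm f (ENNReal.ofReal p) volume = lpE p fun x => ‖f x‖ₑ := by
  rw [eLpNorm_eq_lintegral_rpow_enorm_toReal (by simpa using hp) ENNReal.ofReal_ne_top,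
    ENNReal.toReal_ofReal hp.le, lpE]

end LpSeminorm

/-! ### Mixed norms of nonnegative kernels -/

section Mixed

/-- The mixed seminorm of a kernel with values in `ℝ≥0∞`. -/
def mixedE (r s : ℝ) (b : ℂ → ℂ → ℝ≥0∞) : ℝ≥0∞ := lpE r fun x => lpE s (b x)

theorem mixedNorm_eq_mixedE (r s : ℝ) (a : ℂ → ℂ → ℂ) :
    mixedNorm r s a = mixedE r s fun x y => ‖a x y‖ₑ := by
  unfold mixedNorm mixedE lpE
  simp_rw [← ENNReal.rpow_mul, one_div_mul_eq_div]

theorem ae_section {f : ℂ × ℂ → ℝ≥0∞} (hf : AEMeasurable f) :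
    ∀ᵐ x, AEMeasurable fun y => f (x, y) := by
  filter_upwards [AEStronglyMeasurable.prodMk_left (μ := volume) (ν := volume)
    (f := f) hf.aestronglyMeasurable] with x hx
  exact hx.aemeasurable

theorem aemeasurable_lpE {b : ℂ → ℂ → ℝ≥0∞} (s : ℝ)
    (hb : AEMeasurable (Function.uncurry b)) : AEMeasurable fun x => lpE s (b x) := by
  unfold lpE
  refine AEMeasurable.pow_const ?_ _
  exact AEMeasurable.lintegral_prod_right' (f := fun z : ℂ × ℂ => b z.1 z.2 ^ s)
    (hb.pow_const s)

theorem aemeasurable_swap {b : ℂ → ℂ → ℝ≥0∞} (hb : AEMeasurable (Function.uncurry b)) :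
    AEMeasurable (Function.uncurry fun x y => b y x) :=
  AEMeasurable.prod_swap (f := Function.uncurry b) hb

theorem ae_swap {P : ℂ → ℂ → Prop} (h : ∀ᵐ z : ℂ × ℂ, P z.1 z.2) :
    ∀ᵐ z : ℂ × ℂ, P z.2 z.1 :=
  (Measure.measurePreserving_swap (μ := (volume : Measure ℂ))
    (ν := (volume : Measure ℂ))).quasiMeasurePreserving.ae h

theorem mixedE_mono_ae {r s : ℝ} (hr : 0 < r) (hs : 0 < s) {b c : ℂ → ℂ → ℝ≥0∞}
    (h : ∀ᵐ z : ℂ × ℂ, b z.1 z.2 ≤ c z.1 z.2) : mixedE r s b ≤ mixedE r s c := by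
  refine lpE_mono_ae hr ?_
  filter_upwards [Measure.ae_ae_of_ae_prod h] with x hx
  exact lpE_mono_ae hs hx

theorem mixedE_add_le {r s : ℝ} (hr : 1 ≤ r) (hs : 1 ≤ s) {b c : ℂ → ℂ → ℝ≥0∞}
    (hb : AEMeasurable (Function.uncurry b)) (hc : AEMeasurable (Function.uncurry c)) :
    mixedE r s (fun x y => b x y + c x y) ≤ mixedE r s b + mixedE r s c := by
  refine le_trans (lpE_mono_ae (by linarith) ?_)
    (lpE_add_le hr (aemeasurable_lpE s hb) (aemeasurable_lpE s hc))
  filter_upwards [ae_section hb, ae_section hc] with x hx hx'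
  exact lpE_add_le hs hx hx'

theorem mixedE_const_mul {r s : ℝ} (hr : 0 < r) (hs : 0 < s) {c : ℝ≥0∞} (hc : c ≠ ∞)
    (b : ℂ → ℂ → ℝ≥0∞) : mixedE r s (fun x y => c * b x y) = c * mixedE r s b := by
  unfold mixedE
  simp_rw [lpE_const_mul hs hc]
  rw [lpE_const_mul hr hc]

/-- Countable generation reduces the limit to sequences, along which countably many null sets may be
discarded. Dominated convergence is then used twice: in y for almost every x, and in x for the
resulting norms. -/
theorem mixedE_tendsto_zero {ι : Type*} {l : Filter ι} [l.IsCountablyGenerated]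
    {r s : ℝ} (hr : 0 < r) (hs : 0 < s)
    {F : ι → ℂ → ℂ → ℝ≥0∞} {B : ℂ → ℂ → ℝ≥0∞}
    (hF : ∀ n, AEMeasurable (Function.uncurry (F n))) (hBm : AEMeasurable (Function.uncurry B))
    (hB : mixedE r s B ≠ ∞) (hFB : ∀ n, ∀ᵐ z : ℂ × ℂ, F n z.1 z.2 ≤ B z.1 z.2)
    (hlim : ∀ᵐ z : ℂ × ℂ, Tendsto (fun n => F n z.1 z.2) l (𝓝 0)) :
    Tendsto (fun n => mixedE r s (F n)) l (𝓝 0) := by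
  refine tendsto_of_seq_tendsto fun u hu => ?_
  have hB' : ∀ᵐ x, lpE s (B x) ≠ ∞ := by
    have := ae_lt_top' ((aemeasurable_lpE s hBm).pow_const r) ((lpE_ne_top_iff hr).1 hB)
    filter_upwards [this] with x hx hx'
    rw [hx', ENNReal.top_rpow_of_pos hr] at hx
    exact lt_irrefl _ hx
  have h1 : ∀ᵐ x, ∀ n, AEMeasurable fun y => F (u n) x y :=
    ae_all_iff.2 fun n => ae_section (hF (u n))
  have h2 : ∀ᵐ x, ∀ n, ∀ᵐ y, F (u n) x y ≤ B x y :=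
    ae_all_iff.2 fun n => Measure.ae_ae_of_ae_prod (hFB (u n))
  refine lpE_tendsto_zero hr (fun n => aemeasurable_lpE s (hF (u n))) hB (fun n => ?_) ?_
  · filter_upwards [h2] with x hx
    exact lpE_mono_ae hs (hx n)
  · filter_upwards [h1, h2, hB', Measure.ae_ae_of_ae_prod hlim] with x hx1 hx2 hx3 hx4
    refine lpE_tendsto_zero hs hx1 hx3 hx2 ?_
    filter_upwards [hx4] with y hy
    exact hy.comp hu

/-- The norm of a kernel with values in `ℝ≥0∞`. -/
def kernelE (p : ℝ) (b : ℂ → ℂ → ℝ≥0∞) : ℝ≥0∞ :=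
  max (mixedE p p.conjExponent b) (mixedE p.conjExponent p fun x y => b y x)

theorem kernelNorm_eq_kernelE (p : ℝ) (a : ℂ → ℂ → ℂ) :
    kernelNorm p a = kernelE p fun x y => ‖a x y‖ₑ := by
  unfold kernelNorm kernelE
  rw [mixedNorm_eq_mixedE, mixedNorm_eq_mixedE]
  congr 2
  ext x y
  simp only [adjKernel]
  rw [← ofReal_norm, RCLike.norm_conj, ofReal_norm]

variable {p : ℝ}

theorem conjExponent_pos (hp : 1 < p) : 0 < p.conjExponent :=
  (Real.HolderConjugate.conjExponent hp).symm.pos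

theorem one_lt_conjExponent (hp : 1 < p) : 1 < p.conjExponent :=
  (Real.HolderConjugate.conjExponent hp).symm.lt

theorem kernelE_mono_ae (hp : 1 < p) {b c : ℂ → ℂ → ℝ≥0∞}
    (h : ∀ᵐ z : ℂ × ℂ, b z.1 z.2 ≤ c z.1 z.2) : kernelE p b ≤ kernelE p c :=
  max_le_max (mixedE_mono_ae (by linarith) (conjExponent_pos hp) h)
    (mixedE_mono_ae (conjExponent_pos hp) (by linarith)
      (ae_swap (P := fun x y => b x y ≤ c x y) h))

theorem kernelE_add_le (hp : 1 < p) {b c : ℂ → ℂ → ℝ≥0∞}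
    (hb : AEMeasurable (Function.uncurry b)) (hc : AEMeasurable (Function.uncurry c)) :
    kernelE p (fun x y => b x y + c x y) ≤ kernelE p b + kernelE p c := by
  have hq := one_lt_conjExponent hp
  refine max_le ?_ ?_
  · exact (mixedE_add_le hp.le hq.le hb hc).trans
      (add_le_add (le_max_left _ _) (le_max_left _ _))
  · exact (mixedE_add_le hq.le hp.le (aemeasurable_swap hb) (aemeasurable_swap hc)).trans
      (add_le_add (le_max_right _ _) (le_max_right _ _))

theorem kernelE_const_mul (hp : 1 < p) {c : ℝ≥0∞} (hc : c ≠ ∞) (b : ℂ → ℂ → ℝ≥0∞) :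
    kernelE p (fun x y => c * b x y) = c * kernelE p b := by
  have hq := conjExponent_pos hp
  unfold kernelE
  rw [mixedE_const_mul (by linarith) hq hc, mixedE_const_mul hq (by linarith) hc,
    mul_max]

theorem kernelE_tendsto_zero {ι : Type*} {l : Filter ι} [l.IsCountablyGenerated] (hp : 1 < p)
    {F : ι → ℂ → ℂ → ℝ≥0∞} {B : ℂ → ℂ → ℝ≥0∞}
    (hF : ∀ n, AEMeasurable (Function.uncurry (F n))) (hBm : AEMeasurable (Function.uncurry B))
    (hB : kernelE p B ≠ ∞) (hFB : ∀ n, ∀ᵐ z : ℂ × ℂ, F n z.1 z.2 ≤ B z.1 z.2)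
    (hlim : ∀ᵐ z : ℂ × ℂ, Tendsto (fun n => F n z.1 z.2) l (𝓝 0)) :
    Tendsto (fun n => kernelE p (F n)) l (𝓝 0) := by
  have hq := conjExponent_pos hp
  have h0 : 0 < p := by linarith
  have h1 := mixedE_tendsto_zero h0 hq hF hBm (ne_top_of_le_ne_top hB (le_max_left _ _)) hFB hlim
  have h2 := mixedE_tendsto_zero hq h0 (fun n => aemeasurable_swap (hF n)) (aemeasurable_swap hBm)
    (ne_top_of_le_ne_top hB (le_max_right _ _))
    (fun n => ae_swap (P := fun x y => F n x y ≤ B x y) (hFB n))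
    (ae_swap (P := fun x y => Tendsto (fun n => F n x y) l (𝓝 0)) hlim)
  have h3 := h1.max h2
  rw [max_self] at h3
  exact h3

end Mixed

/-! ### Integral operators and the norm of `E_p` -/

section Operator

variable {p : ℝ}

theorem lintegral_kernel_mul_le (hp : 1 < p) {b : ℂ → ℂ → ℝ≥0∞}
    (hb : AEMeasurable (Function.uncurry b)) {f : ℂ → ℝ≥0∞} (hf : AEMeasurable f) :
    ∀ᵐ x, ∫⁻ y, b x y * f y ≤ lpE p.conjExponent (b x) * lpE p f := by
  filter_upwards [ae_section hb] with x hx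
  exact lintegral_mul_le_lpE (Real.HolderConjugate.conjExponent hp).symm hx hf

theorem lpE_lt_top_ae {r s : ℝ} (hr : 0 < r) {b : ℂ → ℂ → ℝ≥0∞}
    (hb : AEMeasurable (Function.uncurry b)) (hB : mixedE r s b ≠ ∞) :
    ∀ᵐ x, lpE s (b x) < ∞ := by
  have := ae_lt_top' ((aemeasurable_lpE s hb).pow_const r) ((lpE_ne_top_iff hr).1 hB)
  filter_upwards [this] with x hx
  refine lt_top_iff_ne_top.2 fun hx' => ?_
  rw [hx', ENNReal.top_rpow_of_pos hr] at hx
  exact lt_irrefl _ hx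

theorem lintegral_kernel_mul_lt_top (hp : 1 < p) {b : ℂ → ℂ → ℝ≥0∞}
    (hb : AEMeasurable (Function.uncurry b)) (hB : kernelE p b ≠ ∞)
    {f : ℂ → ℝ≥0∞} (hf : AEMeasurable f) (hf' : lpE p f ≠ ∞) :
    ∀ᵐ x, ∫⁻ y, b x y * f y < ∞ := by
  filter_upwards [lintegral_kernel_mul_le hp hb hf,
    lpE_lt_top_ae (by linarith) hb (ne_top_of_le_ne_top hB (le_max_left _ _))] with x hx hx'
  exact hx.trans_lt (ENNReal.mul_lt_top hx' hf'.lt_top)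

theorem lpE_kernel_mul_le (hp : 1 < p) {b : ℂ → ℂ → ℝ≥0∞}
    (hb : AEMeasurable (Function.uncurry b)) {f : ℂ → ℝ≥0∞} (hf : AEMeasurable f)
    (hf' : lpE p f ≠ ∞) :
    lpE p (fun x => ∫⁻ y, b x y * f y) ≤ lpE p f * kernelE p b := by
  refine (lpE_mono_ae (by linarith) (lintegral_kernel_mul_le hp hb hf)).trans ?_
  simp_rw [mul_comm _ (lpE p f)]
  rw [lpE_const_mul (by linarith) hf']
  gcongr
  exact le_max_left _ _

theorem lpE_coeFn_ne_top (hp : 1 < p) (f : LpC p) : lpE p (fun x => ‖f x‖ₑ) ≠ ∞ := by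
  rw [← eLpNorm_ofReal (by linarith)]
  exact (Lp.memLp f).2.ne

theorem aemeasurable_enorm_kernel {a : ℂ → ℂ → ℂ}
    (ha : AEStronglyMeasurable (Function.uncurry a) (volume : Measure (ℂ × ℂ))) :
    AEMeasurable (Function.uncurry fun x y => ‖a x y‖ₑ) :=
  ha.enorm

theorem aestronglyMeasurable_kernel {a : ℂ → ℂ → ℂ}
    (ha : AEStronglyMeasurable (Function.uncurry a) (volume : Measure (ℂ × ℂ))) (f : LpC p) :
    AEStronglyMeasurable (fun x => ∫ y, a x y * f y) volume := by
  have hf := (Lp.aestronglyMeasurable f)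
  exact AEStronglyMeasurable.integral_prod_right' (μ := volume) (ν := volume)
    (f := fun z : ℂ × ℂ => a z.1 z.2 * f z.2) (ha.mul hf.comp_snd)

theorem kernelNorm_add_le (hp : 1 < p) {a b : ℂ → ℂ → ℂ}
    (ha : AEStronglyMeasurable (Function.uncurry a) (volume : Measure (ℂ × ℂ)))
    (hb : AEStronglyMeasurable (Function.uncurry b) (volume : Measure (ℂ × ℂ))) :
    kernelNorm p (fun x y => a x y + b x y) ≤ kernelNorm p a + kernelNorm p b := by
  simp only [kernelNorm_eq_kernelE]
  exact (kernelE_mono_ae hp (ae_of_all _ fun z => enorm_add_le _ _)).trans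
    (kernelE_add_le hp (aemeasurable_enorm_kernel ha) (aemeasurable_enorm_kernel hb))

theorem kernelNorm_const_mul (hp : 1 < p) (c : ℂ) (a : ℂ → ℂ → ℂ) :
    kernelNorm p (fun x y => c * a x y) = ‖c‖ₑ * kernelNorm p a := by
  simp only [kernelNorm_eq_kernelE, enorm_mul]
  exact kernelE_const_mul hp enorm_ne_top _

theorem kernelNorm_zero (hp : 1 < p) : kernelNorm p (fun _ _ => 0) = 0 := by
  simpa using kernelNorm_const_mul hp 0 (fun _ _ => 0)

theorem integrable_kernel_mul (hp : 1 < p) {a : ℂ → ℂ → ℂ}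
    (ha : AEStronglyMeasurable (Function.uncurry a) (volume : Measure (ℂ × ℂ)))
    (hA : kernelNorm p a ≠ ∞) (f : LpC p) : ∀ᵐ x, Integrable fun y => a x y * f y := by
  have hf := (Lp.aestronglyMeasurable f)
  rw [kernelNorm_eq_kernelE] at hA
  filter_upwards [lintegral_kernel_mul_lt_top hp (aemeasurable_enorm_kernel ha) hA hf.enorm
    (lpE_coeFn_ne_top hp f), AEStronglyMeasurable.prodMk_left (μ := volume) (ν := volume) ha]
    with x hx hx'
  refine ⟨hx'.mul hf, ?_⟩
  simpa [HasFiniteIntegral, enorm_mul] using hx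

variable [Fact (1 ≤ ENNReal.ofReal p)]

theorem enorm_eq_lpE (hp : 1 < p) (f : LpC p) : ‖f‖ₑ = lpE p fun x => ‖f x‖ₑ := by
  rw [← eLpNorm_ofReal (by linarith), Lp.enorm_def]

theorem eLpNorm_kernel_le (hp : 1 < p) {a : ℂ → ℂ → ℂ}
    (ha : AEStronglyMeasurable (Function.uncurry a) (volume : Measure (ℂ × ℂ))) (f : LpC p) :
    eLpNorm (fun x => ∫ y, a x y * f y) (ENNReal.ofReal p) volume ≤ ‖f‖ₑ * kernelNorm p a := by
  have hf := (Lp.aestronglyMeasurable f)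
  rw [eLpNorm_ofReal (by linarith), enorm_eq_lpE hp, kernelNorm_eq_kernelE]
  refine le_trans (lpE_mono (by linarith) fun x => ?_)
    (lpE_kernel_mul_le hp (aemeasurable_enorm_kernel ha) hf.enorm (lpE_coeFn_ne_top hp f))
  refine (enorm_integral_le_lintegral_enorm _).trans_eq ?_
  simp [enorm_mul]

theorem memLp_kernel (hp : 1 < p) {a : ℂ → ℂ → ℂ}
    (ha : AEStronglyMeasurable (Function.uncurry a) (volume : Measure (ℂ × ℂ)))
    (hA : kernelNorm p a ≠ ∞) (f : LpC p) :
    MemLp (fun x => ∫ y, a x y * f y) (ENNReal.ofReal p) volume :=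
  ⟨aestronglyMeasurable_kernel ha f,
    (eLpNorm_kernel_le hp ha f).trans_lt (ENNReal.mul_lt_top enorm_lt_top hA.lt_top)⟩

/-- A kernel of finite norm defines a bounded operator. -/
theorem exists_isIntegralKernel (hp : 1 < p) {a : ℂ → ℂ → ℂ}
    (ha : AEStronglyMeasurable (Function.uncurry a) (volume : Measure (ℂ × ℂ)))
    (hA : kernelNorm p a ≠ ∞) : ∃ T : LpC p →L[ℂ] LpC p, IsIntegralKernel p T a := by
  let L : LpC p →ₗ[ℂ] LpC p :=
    { toFun := fun f => (memLp_kernel hp ha hA f).toLp _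
      map_add' := fun f g => by
        rw [← MemLp.toLp_add, MemLp.toLp_eq_toLp_iff]
        filter_upwards [integrable_kernel_mul hp ha hA f, integrable_kernel_mul hp ha hA g]
          with x hf hg
        rw [Pi.add_apply, ← integral_add hf hg]
        refine integral_congr_ae ?_
        filter_upwards [Lp.coeFn_add f g] with y hy
        rw [hy, Pi.add_apply, mul_add]
      map_smul' := fun c f => by
        rw [RingHom.id_apply, ← MemLp.toLp_const_smul, MemLp.toLp_eq_toLp_iff]
        refine ae_of_all _ fun x => ?_
        simp only [Pi.smul_apply, smul_eq_mul]
        rw [← integral_const_mul]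
        refine integral_congr_ae ?_
        filter_upwards [Lp.coeFn_smul c f] with y hy
        rw [hy, Pi.smul_apply, smul_eq_mul]
        ring }
  refine ⟨L.mkContinuous (kernelNorm p a).toReal fun f => ?_, ha, fun f => ?_⟩
  · change ‖(memLp_kernel hp ha hA f).toLp _‖ ≤ _
    rw [Lp.norm_toLp]
    have := ENNReal.toReal_mono (ENNReal.mul_ne_top enorm_ne_top hA) (eLpNorm_kernel_le hp ha f)
    rwa [ENNReal.toReal_mul, toReal_enorm, mul_comm] at this
  · exact MemLp.coeFn_toLp (memLp_kernel hp ha hA f)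

theorem IsIntegralKernel.add (hp : 1 < p) {A B : LpC p →L[ℂ] LpC p} {a b : ℂ → ℂ → ℂ}
    (hA : IsIntegralKernel p A a) (hB : IsIntegralKernel p B b) (ha : kernelNorm p a ≠ ∞)
    (hb : kernelNorm p b ≠ ∞) : IsIntegralKernel p (A + B) fun x y => a x y + b x y := by
  refine ⟨hA.1.add hB.1, fun f => ?_⟩
  filter_upwards [hA.2 f, hB.2 f, integrable_kernel_mul hp hA.1 ha f,
    integrable_kernel_mul hp hB.1 hb f, Lp.coeFn_add (A f) (B f)] with x h1 h2 h3 h4 h5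
  rw [add_apply, h5, Pi.add_apply, h1, h2, ← integral_add h3 h4]
  simp only [add_mul]

theorem IsIntegralKernel.smul (c : ℂ) {A : LpC p →L[ℂ] LpC p} {a : ℂ → ℂ → ℂ}
    (hA : IsIntegralKernel p A a) : IsIntegralKernel p (c • A) fun x y => c * a x y := by
  refine ⟨hA.1.const_mul c, fun f => ?_⟩
  filter_upwards [hA.2 f, Lp.coeFn_smul c (A f)] with x h1 h2
  rw [smul_apply, h2, Pi.smul_apply, h1, smul_eq_mul, ← integral_const_mul]
  simp only [mul_assoc]

theorem epNorm_lt_iff {A : LpC p →L[ℂ] LpC p} {r : ℝ≥0∞} :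
    epNorm p A < r ↔ ∃ a, IsIntegralKernel p A a ∧ kernelNorm p a < r := by
  simp only [epNorm, iInf_lt_iff, exists_prop]

theorem memEp_iff {A : LpC p →L[ℂ] LpC p} : MemEp p A ↔ epNorm p A < ∞ :=
  epNorm_lt_iff.symm

theorem epNorm_le {A : LpC p →L[ℂ] LpC p} {a : ℂ → ℂ → ℂ} (h : IsIntegralKernel p A a) :
    epNorm p A ≤ kernelNorm p a := iInf₂_le a h

/-- Uniqueness of the kernel is not needed: kernels that nearly attain the two infima are added. -/
theorem epNorm_add_le (hp : 1 < p) (A B : LpC p →L[ℂ] LpC p) :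
    epNorm p (A + B) ≤ epNorm p A + epNorm p B := by
  refine ENNReal.le_of_forall_pos_le_add fun ε hε hfin => ?_
  have hA : epNorm p A < ∞ := lt_of_le_of_lt le_self_add hfin
  have hB : epNorm p B < ∞ := lt_of_le_of_lt le_add_self hfin
  have hε' : (ε / 2 : ℝ≥0∞) ≠ 0 := by simpa using hε.ne'
  obtain ⟨a, ha, ha'⟩ := epNorm_lt_iff.1 (ENNReal.lt_add_right hA.ne hε')
  obtain ⟨b, hb, hb'⟩ := epNorm_lt_iff.1 (ENNReal.lt_add_right hB.ne hε')
  refine (epNorm_le (ha.add hp hb ha'.ne_top hb'.ne_top)).trans ?_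
  refine (kernelNorm_add_le hp ha.1 hb.1).trans ?_
  refine (add_le_add ha'.le hb'.le).trans_eq ?_
  rw [add_add_add_comm, ENNReal.add_halves]

theorem epNorm_smul_le (hp : 1 < p) (c : ℂ) {A : LpC p →L[ℂ] LpC p} (hA : MemEp p A) :
    epNorm p (c • A) ≤ ‖c‖ₑ * epNorm p A := by
  obtain ⟨b, hb, hb'⟩ := hA
  refine ENNReal.le_of_forall_pos_le_add fun ε hε _ => ?_
  -- The added 1 covers the case c = 0.
  have hε' : (ε / (‖c‖ₑ + 1) : ℝ≥0∞) ≠ 0 := by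
    refine (ENNReal.div_pos (by simpa using hε.ne') ?_).ne'
    simp
  obtain ⟨a, ha, ha'⟩ := epNorm_lt_iff.1
    (ENNReal.lt_add_right ((epNorm_le hb).trans_lt hb').ne hε')
  refine (epNorm_le (ha.smul c)).trans ?_
  rw [kernelNorm_const_mul hp]
  refine (mul_le_mul_right ha'.le _).trans ?_
  rw [mul_add]
  gcongr
  rw [← mul_div_assoc]
  refine ENNReal.div_le_of_le_mul ?_
  rw [mul_comm]
  gcongr
  exact le_self_add

theorem isIntegralKernel_zero : IsIntegralKernel p 0 fun _ _ => 0 := by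
  refine ⟨aestronglyMeasurable_const, fun f => ?_⟩
  exact ae_of_all _ fun x => by simp

theorem epNorm_zero (hp : 1 < p) : epNorm p (0 : LpC p →L[ℂ] LpC p) = 0 :=
  nonpos_iff_eq_zero.1 ((epNorm_le isIntegralKernel_zero).trans_eq (kernelNorm_zero hp))

end Operator

/-! ### Weights that turn an operator on `L^p` into a Hilbert–Schmidt operator -/

section HilbertSchmidt

theorem enorm_sq_eq_lintegral (f : Lp ℂ 2 (volume : Measure ℂ)) :
    ‖f‖ₑ ^ 2 = ∫⁻ x, ‖f x‖ₑ ^ 2 := by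
  have h := eLpNorm_nnreal_pow_eq_lintegral (μ := (volume : Measure ℂ)) (f := f)
    (p := 2) two_ne_zero
  simpa [Lp.enorm_def] using h

theorem memLp_two_of_lintegral {k : ℂ → ℂ} (hk : AEStronglyMeasurable k volume)
    (h : ∫⁻ y, ‖k y‖ₑ ^ 2 ≠ ∞) : MemLp k 2 volume := by
  refine ⟨hk, ?_⟩
  have h' := eLpNorm_nnreal_pow_eq_lintegral (μ := (volume : Measure ℂ)) (f := k)
    (p := 2) two_ne_zero
  simp only [NNReal.coe_ofNat, ENNReal.rpow_ofNat, ENNReal.coe_ofNat] at h'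
  rw [← h'] at h
  exact lt_top_iff_ne_top.2 fun h2 => h (by simp [h2])

/-- Bessel's inequality for integrals against an orthonormal family. -/
theorem sum_enorm_integral_sq_le {n : Type*} [Fintype n] {E : n → Lp ℂ 2 (volume : Measure ℂ)}
    (hE : Orthonormal ℂ E) {k : ℂ → ℂ} (hk : AEStronglyMeasurable k volume) :
    ∑ j, ‖∫ y, k y * E j y‖ₑ ^ 2 ≤ ∫⁻ y, ‖k y‖ₑ ^ 2 := by
  by_cases h : ∫⁻ y, ‖k y‖ₑ ^ 2 = ∞
  · rw [h]; exact le_top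
  have hk' : MemLp (fun y => conj (k y)) 2 volume := by
    refine memLp_two_of_lintegral (Complex.continuous_conj.comp_aestronglyMeasurable hk) ?_
    simpa [← ofReal_norm] using h
  set G := hk'.toLp _ with hG
  have h1 : ∀ j, ‖inner ℂ (E j) G‖ = ‖∫ y, k y * E j y‖ := by
    intro j
    rw [L2.inner_def, ← RCLike.norm_conj, ← integral_conj]
    congr 1
    refine integral_congr_ae ?_
    filter_upwards [hk'.coeFn_toLp] with y hy
    rw [hG, hy]
    simp
  have h2 : ‖G‖ₑ ^ 2 = ∫⁻ y, ‖k y‖ₑ ^ 2 := by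
    rw [enorm_sq_eq_lintegral]
    refine lintegral_congr_ae ?_
    filter_upwards [hk'.coeFn_toLp] with y hy
    rw [hG, hy, ← ofReal_norm, RCLike.norm_conj, ofReal_norm]
  have h3 := hE.sum_inner_products_le G (s := Finset.univ)
  rw [← h2]
  simp_rw [← ofReal_norm, ← ENNReal.ofReal_pow (norm_nonneg _), ← h1]
  rw [← ENNReal.ofReal_sum_of_nonneg fun _ _ => by positivity]
  exact ENNReal.ofReal_le_ofReal h3

variable {p : ℝ}

/-- Multiplication by a weight, as a map from `L^p` to `L^2`. -/
def weightMap {w : ℂ → ℝ} (hw : ∀ f : LpC p, MemLp (fun x => (w x : ℂ) * f x) 2 volume) :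
    LpC p →ₗ[ℂ] Lp ℂ 2 (volume : Measure ℂ) where
  toFun f := (hw f).toLp _
  map_add' f g := by
    rw [← MemLp.toLp_add, MemLp.toLp_eq_toLp_iff]
    filter_upwards [Lp.coeFn_add f g] with y hy
    rw [hy, Pi.add_apply, Pi.add_apply, mul_add]
  map_smul' c f := by
    rw [RingHom.id_apply, ← MemLp.toLp_const_smul, MemLp.toLp_eq_toLp_iff]
    filter_upwards [Lp.coeFn_smul c f] with y hy
    simp only [hy, Pi.smul_apply, smul_eq_mul]
    ring

theorem coeFn_weightMap {w : ℂ → ℝ}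
    (hw : ∀ f : LpC p, MemLp (fun x => (w x : ℂ) * f x) 2 volume) (f : LpC p) :
    ∀ᵐ x, weightMap hw f x = w x * f x :=
  (hw f).coeFn_toLp

theorem weightMap_injective {w : ℂ → ℝ} (hw0 : ∀ᵐ x, 0 < w x)
    (hw : ∀ f : LpC p, MemLp (fun x => (w x : ℂ) * f x) 2 volume) :
    Function.Injective (weightMap hw) := by
  rw [injective_iff_map_eq_zero]
  intro f hf
  rw [Lp.eq_zero_iff_ae_eq_zero] at hf ⊢
  filter_upwards [hf, coeFn_weightMap hw f, hw0] with x h1 h2 h3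
  rw [h1] at h2
  have h4 : (w x : ℂ) ≠ 0 := by exact_mod_cast h3.ne'
  simpa [h4] using h2.symm

variable [Fact (1 ≤ ENNReal.ofReal p)]

/-- If a weight makes the conjugated kernel Hilbert–Schmidt, then the regularized determinant is
bounded in terms of the Hilbert–Schmidt norm. -/
theorem norm_finiteRankDet_sq_le_of_weight {F : LpC p →L[ℂ] LpC p} {a : ℂ → ℂ → ℂ}
    (hF : IsIntegralKernel p F a) (hfin : FiniteDimensional ℂ (LinearMap.range F.toLinearMap))
    {w : ℂ → ℝ} (hw0 : ∀ᵐ x, 0 < w x)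
    (hwm : AEStronglyMeasurable w volume)
    (hw : ∀ f : LpC p, MemLp (fun x => (w x : ℂ) * f x) 2 volume) {M : ℝ} (hM : 0 ≤ M)
    (hK : ∫⁻ x, ∫⁻ y, ‖(w x : ℂ) * a x y / w y‖ₑ ^ 2 ≤ ENNReal.ofReal M) :
    ‖finiteRankDet p F‖ ^ 2 ≤ Real.exp M := by
  set Φ := weightMap hw with hΦ
  set V := LinearMap.range F.toLinearMap
  set φ := Submodule.equivMapOfInjective Φ (weightMap_injective hw0 hw) V with hφ
  have : FiniteDimensional ℂ (V.map Φ) := φ.finiteDimensional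
  -- Multiplication by `w` carries the range of `F` to a finite-dimensional subspace of L². There
  -- the conjugate of `F` is integration against w(x) a(x,y) / w(y), and its regularized determinant
  -- is that of `F`.
  set T := φ.conj (onRange p F) with hT
  have h1 : finiteRankDet p F = expDet T := (expDet_conj _ φ).symm
  set e := stdOrthonormalBasis ℂ (V.map Φ)
  rw [h1]
  refine (norm_expDet_sq_le e T).trans (Real.exp_le_exp.2 ?_)
  set E : Fin (Module.finrank ℂ (V.map Φ)) → Lp ℂ 2 (volume : Measure ℂ) := fun j => (e j)
  have hE : Orthonormal ℂ E := e.orthonormal.comp_linearIsometry (V.map Φ).subtypeₗᵢ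
  have hTe : ∀ j, ∀ᵐ x, (T (e j) : Lp ℂ 2 (volume : Measure ℂ)) x
      = ∫ y, ((w x : ℂ) * a x y / w y) * E j y := by
    intro j
    set v := φ.symm (e j) with hv
    have hv' : Φ (v : LpC p) = E j := by
      have := φ.apply_symm_apply (e j)
      rw [← hv] at this
      rw [← Submodule.coe_equivMapOfInjective_apply Φ (weightMap_injective hw0 hw) V v, ← hφ, this]
    have hTv : (T (e j) : Lp ℂ 2 (volume : Measure ℂ)) = Φ (F (v : LpC p)) := by
      rw [hT, LinearEquiv.conj_apply_apply, hφ, Submodule.coe_equivMapOfInjective_apply]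
      rfl
    rw [hTv, ← hv']
    filter_upwards [coeFn_weightMap hw (F (v : LpC p)), hF.2 (v : LpC p)] with x hx1 hx2
    rw [hΦ, hx1, hx2, ← integral_const_mul]
    refine integral_congr_ae ?_
    filter_upwards [coeFn_weightMap hw (v : LpC p), hw0] with y hy1 hy2
    have h4 : (w y : ℂ) ≠ 0 := by exact_mod_cast hy2.ne'
    rw [hy1]
    field_simp
  have hKm : ∀ᵐ x, AEStronglyMeasurable (fun y => (w x : ℂ) * a x y / w y) volume := by
    filter_upwards [AEStronglyMeasurable.prodMk_left (μ := volume) (ν := volume) hF.1] with x hx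
    have hwc : AEStronglyMeasurable (fun y => (w y : ℂ)) volume :=
      Complex.continuous_ofReal.comp_aestronglyMeasurable hwm
    exact (hx.const_mul (w x : ℂ)).mul (hwc.aemeasurable.inv.aestronglyMeasurable)
  -- Bessel's inequality in y at almost every x, integrated in x, bounds the sum over the basis by
  -- the Hilbert–Schmidt integral of the kernel.
  have key : ∑ j, ‖T (e j)‖ₑ ^ 2 ≤ ENNReal.ofReal M := by
    refine le_trans ?_ hK
    have h5 : ∀ j, ‖T (e j)‖ₑ ^ 2
        = ∫⁻ x, ‖(T (e j) : Lp ℂ 2 (volume : Measure ℂ)) x‖ₑ ^ 2 := fun j =>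
      enorm_sq_eq_lintegral _
    simp_rw [h5]
    rw [← lintegral_finsetSum' _ fun j _ => ((Lp.aestronglyMeasurable _).enorm.pow_const 2)]
    refine lintegral_mono_ae ?_
    filter_upwards [ae_all_iff.2 hTe, hKm] with x hx hx'
    simp_rw [hx]
    exact sum_enorm_integral_sq_le hE hx'
  simp_rw [← ofReal_norm, ← ENNReal.ofReal_pow (norm_nonneg _)] at key
  rw [← ENNReal.ofReal_sum_of_nonneg fun _ _ => by positivity] at key
  exact (ENNReal.ofReal_le_ofReal_iff hM).1 key


end HilbertSchmidt

/-! ### Boundedness and Lipschitz continuity of the determinant at finite rank -/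

section Bound

variable {p : ℝ}

/-- A weight adapted to a kernel: an almost everywhere positive and finite function `B`, with
controlled integral, that dominates the powers of the `L^p` norms of the columns. -/
theorem exists_column_majorant (hp : 1 < p) {b : ℂ → ℂ → ℝ≥0∞}
    (hb : AEMeasurable (Function.uncurry b)) (hB : kernelE p b ≠ ∞) :
    ∃ B : ℂ → ℝ≥0∞, AEMeasurable B ∧ (∀ x, B x ≠ 0) ∧ (∀ᵐ x, B x ≠ ∞) ∧
      (∀ y, lpE p (fun x => b x y) ^ p.conjExponent ≤ B y) ∧
      ∫⁻ y, B y ≤ kernelE p b ^ p.conjExponent + 1 := by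
  have hq := conjExponent_pos hp
  -- Columns of the kernel may vanish, whereas the weight has to be invertible. Adding `g` makes the
  -- majorant positive everywhere and costs less than 1 in the integral.
  obtain ⟨g, hg0, hgm, hg⟩ := exists_pos_lintegral_lt_of_sigmaFinite (volume : Measure ℂ)
    (ε := 1) one_ne_zero
  have hm : AEMeasurable fun y => lpE p (fun x => b x y) ^ p.conjExponent :=
    (aemeasurable_lpE p (aemeasurable_swap hb)).pow_const _
  have hInt : ∫⁻ y, (lpE p (fun x => b x y) ^ p.conjExponent + g y)
      ≤ kernelE p b ^ p.conjExponent + 1 := by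
    rw [lintegral_add_left' hm]
    refine add_le_add ?_ hg.le
    rw [← lpE_rpow hq]
    gcongr
    exact le_max_right _ _
  have hmB := hm.add hgm.coe_nnreal_ennreal.aemeasurable
  refine ⟨fun y => lpE p (fun x => b x y) ^ p.conjExponent + g y, hmB, fun x => ?_, ?_,
    fun y => le_self_add, hInt⟩
  · simpa using fun _ => (hg0 x).ne'
  · have := ae_lt_top' hmB (ne_top_of_le_ne_top
      (ENNReal.add_ne_top.2 ⟨ENNReal.rpow_ne_top_of_nonneg hq.le hB, ENNReal.one_ne_top⟩) hInt)
    filter_upwards [this] with x hx using hx.ne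

/-- Hölder with weights 1 - 2/p and 2/p. It serves twice: to send L^p into L² by the weight, and to
estimate the columns of the conjugated kernel. -/
theorem lintegral_weight_sq_le (hp : 2 < p) {B f : ℂ → ℝ≥0∞} (hB : AEMeasurable B)
    (hf : AEMeasurable f) :
    ∫⁻ x, B x ^ (1 - 2 / p) * f x ^ (2 : ℕ) ≤ (∫⁻ x, B x) ^ (1 - 2 / p) * lpE p f ^ (2 : ℕ) := by
  have hp0 : 0 < p := by linarith
  have h1 : 2 / p ≤ 1 := by rw [div_le_one hp0]; linarith
  have := ENNReal.lintegral_mul_norm_pow_le hB (hf.pow_const p) (p := 1 - 2 / p) (q := 2 / p)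
    (by linarith) (by positivity) (by ring)
  refine le_trans (le_of_eq ?_) (this.trans (le_of_eq ?_))
  · refine lintegral_congr fun x => ?_
    rw [← ENNReal.rpow_mul, mul_div_cancel₀ _ hp0.ne', ENNReal.rpow_two]
  · rw [lpE, ← ENNReal.rpow_two, ← ENNReal.rpow_mul]
    congr 2
    ring

variable [Fact (1 ≤ ENNReal.ofReal p)]

/-- With w² = B^{1-2/p}, the column at y contributes at most w(y)⁻² (∫B)^{1-2/p} ‖a(·,y)‖_p². Since
‖a(·,y)‖_p² ≤ B(y)^{2-2/p}, this is at most (∫B)^{1-2/p} B(y), which is integrable in y. -/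
theorem norm_finiteRankDet_sq_le (hp : 2 < p) {F : LpC p →L[ℂ] LpC p} {a : ℂ → ℂ → ℂ}
    (hF : IsIntegralKernel p F a) (hfin : FiniteDimensional ℂ (LinearMap.range F.toLinearMap))
    (ha : kernelNorm p a ≠ ∞) :
    ‖finiteRankDet p F‖ ^ 2
      ≤ Real.exp (((kernelNorm p a ^ p.conjExponent + 1) ^ (2 - 2 / p)).toReal) := by
  have hp0 : 0 < p := by linarith
  have hp1 : 1 < p := by linarith
  have hq := conjExponent_pos hp1
  have h2p : 2 / p < 1 := by rw [div_lt_one hp0]; linarith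
  have hbm := aemeasurable_enorm_kernel hF.1
  rw [kernelNorm_eq_kernelE] at ha ⊢
  obtain ⟨B, hBm, hB0, hBtop, hBcol, hBint⟩ := exists_column_majorant hp1 hbm ha
  have hfinite : kernelE p (fun x y => ‖a x y‖ₑ) ^ p.conjExponent + 1 ≠ ∞ :=
    ENNReal.add_ne_top.2 ⟨ENNReal.rpow_ne_top_of_nonneg hq.le ha, ENNReal.one_ne_top⟩
  have hIfin : ∫⁻ x, B x ≠ ∞ := ne_top_of_le_ne_top hfinite hBint
  set σ : ℝ := 1 / 2 - 1 / p with hσ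
  set w : ℂ → ℝ := fun x => (B x ^ σ).toReal with hw
  have hσ0 : 0 ≤ σ := by
    rw [hσ, sub_nonneg]
    exact one_div_le_one_div_of_le (by norm_num) hp.le
  have hwtop : ∀ᵐ x, B x ^ σ ≠ ∞ := by
    filter_upwards [hBtop] with x hx
    exact ENNReal.rpow_ne_top_of_nonneg hσ0 hx
  have hwe : ∀ᵐ x, ‖(w x : ℂ)‖ₑ ^ 2 = B x ^ (1 - 2 / p) := by
    filter_upwards [hwtop] with x hx
    rw [← ofReal_norm, Complex.norm_real, Real.norm_of_nonneg ENNReal.toReal_nonneg,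
      ENNReal.ofReal_toReal hx, ← ENNReal.rpow_two, ← ENNReal.rpow_mul]
    congr 1
    rw [hσ]; ring
  have hw0 : ∀ᵐ x, 0 < w x := by
    filter_upwards [hwtop, hBtop] with x hx hx'
    refine ENNReal.toReal_pos ?_ hx
    exact (ENNReal.rpow_pos (pos_iff_ne_zero.2 (hB0 x)) hx').ne'
  have hwm : AEMeasurable w := (hBm.pow_const σ).ennreal_toReal
  have hwcm : AEMeasurable fun x => (w x : ℂ) := Complex.measurable_ofReal.comp_aemeasurable hwm
  refine norm_finiteRankDet_sq_le_of_weight hF hfin hw0 hwm.aestronglyMeasurable (fun f => ?_)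
    ENNReal.toReal_nonneg ?_
  · have hf := Lp.aestronglyMeasurable f
    refine memLp_two_of_lintegral (hwcm.aestronglyMeasurable.mul hf) ?_
    have h1 : ∫⁻ x, ‖(w x : ℂ) * f x‖ₑ ^ 2 = ∫⁻ x, B x ^ (1 - 2 / p) * ‖f x‖ₑ ^ 2 := by
      refine lintegral_congr_ae ?_
      filter_upwards [hwe] with x hx
      rw [enorm_mul, mul_pow, hx]
    rw [h1]
    refine ne_top_of_le_ne_top ?_ (lintegral_weight_sq_le hp hBm hf.enorm)
    exact ENNReal.mul_ne_top (ENNReal.rpow_ne_top_of_nonneg (by linarith) hIfin)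
      (ENNReal.pow_ne_top (lpE_coeFn_ne_top hp1 f))
  · rw [ENNReal.ofReal_toReal (ENNReal.rpow_ne_top_of_nonneg (by linarith) hfinite)]
    have hKm : AEMeasurable (Function.uncurry fun x y => ‖(w x : ℂ) * a x y / w y‖ₑ ^ 2) := by
      refine AEMeasurable.pow_const (AEMeasurable.enorm ?_) 2
      have hx : AEMeasurable fun z : ℂ × ℂ => (w z.1 : ℂ) :=
        hwcm.comp_quasiMeasurePreserving Measure.quasiMeasurePreserving_fst
      have hy : AEMeasurable fun z : ℂ × ℂ => (w z.2 : ℂ) :=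
        hwcm.comp_quasiMeasurePreserving Measure.quasiMeasurePreserving_snd
      exact (hx.mul hF.1.aemeasurable).div hy
    -- Integrating first in x brings in the column norms, which B controls.
    rw [lintegral_lintegral_swap hKm]
    calc ∫⁻ y, ∫⁻ x, ‖(w x : ℂ) * a x y / w y‖ₑ ^ 2
        ≤ ∫⁻ y, (∫⁻ x, B x) ^ (1 - 2 / p) * B y := by
          refine lintegral_mono_ae ?_
          filter_upwards [hwe, hw0, hBtop, ae_section (aemeasurable_swap hbm)] with y h1 h2 h3 h4
          have h5 : ∫⁻ x, ‖(w x : ℂ) * a x y / w y‖ₑ ^ 2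
              = ∫⁻ x, (‖(w y : ℂ)‖ₑ ^ 2)⁻¹ * (B x ^ (1 - 2 / p) * ‖a x y‖ₑ ^ 2) := by
            refine lintegral_congr_ae ?_
            filter_upwards [hwe] with x hx
            have h6 : (w y : ℂ) ≠ 0 := by exact_mod_cast h2.ne'
            rw [div_eq_mul_inv, enorm_mul, enorm_mul, mul_pow, mul_pow, hx, enorm_inv h6,
              ← ENNReal.inv_pow, mul_comm]
          have hy0 : ‖(w y : ℂ)‖ₑ ^ 2 ≠ 0 := by
            simpa using h2.ne'
          rw [h5, lintegral_const_mul' _ _ (ENNReal.inv_ne_top.2 hy0), h1]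
          have h7 := lintegral_weight_sq_le hp hBm h4
          -- The exponents match because p' (2 - 2/p) = 2.
          have h8 : lpE p (fun x => ‖a x y‖ₑ) ^ (2 : ℕ) ≤ B y ^ (2 - 2 / p) := by
            calc lpE p (fun x => ‖a x y‖ₑ) ^ (2 : ℕ)
                = (lpE p (fun x => ‖a x y‖ₑ) ^ p.conjExponent) ^ (2 - 2 / p) := by
                  rw [← ENNReal.rpow_two, ← ENNReal.rpow_mul]
                  congr 1
                  rw [Real.conjExponent]
                  have : p - 1 ≠ 0 := by linarith
                  field_simp
              _ ≤ B y ^ (2 - 2 / p) := by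
                  gcongr
                  · linarith
                  · exact hBcol y
          calc (B y ^ (1 - 2 / p))⁻¹ * ∫⁻ x, B x ^ (1 - 2 / p) * ‖a x y‖ₑ ^ 2
              ≤ (B y ^ (1 - 2 / p))⁻¹ * ((∫⁻ x, B x) ^ (1 - 2 / p) * B y ^ (2 - 2 / p)) := by
                gcongr
                exact h7.trans (mul_le_mul_right h8 _)
            _ = (∫⁻ x, B x) ^ (1 - 2 / p) * B y := by
                rw [← ENNReal.rpow_neg, mul_left_comm, ← ENNReal.rpow_add _ _ (hB0 y) h3]
                congr 1
                rw [show -(1 - 2 / p) + (2 - 2 / p) = 1 by ring, ENNReal.rpow_one]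
      _ = (∫⁻ x, B x) ^ (2 - 2 / p) := by
          rw [lintegral_const_mul' _ _ (ENNReal.rpow_ne_top_of_nonneg (by linarith) hIfin)]
          conv_lhs => rw [← ENNReal.rpow_one (∫⁻ x, B x), ← ENNReal.rpow_mul]
          rw [one_mul, ← ENNReal.rpow_add_of_nonneg _ _ (by linarith) zero_le_one]
          congr 1
          ring
      _ ≤ _ := by
          gcongr
          linarith

theorem exists_norm_finiteRankDet_le (hp : 2 < p) (r : ℝ) :
    ∃ C : ℝ, 0 ≤ C ∧ ∀ F ∈ finiteRankEp p, epNorm p F < ENNReal.ofReal r →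
      ‖finiteRankDet p F‖ ≤ C := by
  have hq := conjExponent_pos (show 1 < p by linarith)
  have h2p : 2 / p < 1 := by rw [div_lt_one (by linarith)]; linarith
  set M : ℝ := ((ENNReal.ofReal r ^ p.conjExponent + 1) ^ (2 - 2 / p)).toReal with hM
  refine ⟨Real.exp M, (Real.exp_pos _).le, fun F hF hFr => ?_⟩
  obtain ⟨a, ha, har⟩ := epNorm_lt_iff.1 hFr
  have h1 := norm_finiteRankDet_sq_le hp ha hF.2 har.ne_top
  have h2 : ((kernelNorm p a ^ p.conjExponent + 1) ^ (2 - 2 / p)).toReal ≤ M := by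
    refine ENNReal.toReal_mono ?_ ?_
    · refine ENNReal.rpow_ne_top_of_nonneg (by linarith) (ENNReal.add_ne_top.2 ⟨?_, by simp⟩)
      exact ENNReal.rpow_ne_top_of_nonneg hq.le ENNReal.ofReal_ne_top
    · gcongr
      linarith
  have h3 : ‖finiteRankDet p F‖ ^ 2 ≤ Real.exp M ^ 2 := by
    refine h1.trans ((Real.exp_le_exp.2 h2).trans ?_)
    have : 1 ≤ Real.exp M := Real.one_le_exp ENNReal.toReal_nonneg
    nlinarith
  exact (pow_le_pow_iff_left₀ (norm_nonneg _) (Real.exp_pos _).le two_ne_zero).1 h3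

theorem add_smul_mem_finiteRankEp (hp : 1 < p) {F G : LpC p →L[ℂ] LpC p}
    (hF : F ∈ finiteRankEp p) (hG : G ∈ finiteRankEp p) (z : ℂ) :
    F + z • G ∈ finiteRankEp p := by
  obtain ⟨⟨a, ha, ha'⟩, hF'⟩ := hF
  obtain ⟨⟨b, hb, hb'⟩, hG'⟩ := hG
  have hzb : kernelNorm p (fun x y => z * b x y) < ∞ := by
    rw [kernelNorm_const_mul hp]
    exact ENNReal.mul_lt_top enorm_lt_top hb'
  refine ⟨⟨_, ha.add hp (hb.smul z) ha'.ne hzb.ne, ?_⟩, ?_⟩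
  · exact (kernelNorm_add_le hp ha.1 (hb.smul z).1).trans_lt (ENNReal.add_lt_top.2 ⟨ha', hzb⟩)
  · have hle : LinearMap.range (F + z • G).toLinearMap
        ≤ LinearMap.range F.toLinearMap ⊔ LinearMap.range G.toLinearMap := by
      rintro _ ⟨f, rfl⟩
      exact Submodule.add_mem_sup ⟨f, rfl⟩ (Submodule.smul_mem _ z ⟨f, rfl⟩)
    exact Submodule.finiteDimensional_of_le hle

/-- The regularized determinant is Lipschitz on the finite-rank operators of bounded norm. -/
theorem exists_lipschitz_finiteRankDet (hp : 2 < p) (r : ℝ) :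
    ∃ C : ℝ, 0 ≤ C ∧ ∀ F ∈ finiteRankEp p, ∀ G ∈ finiteRankEp p,
      epNorm p F < ENNReal.ofReal r → epNorm p G < ENNReal.ofReal r →
      ∀ δ : ℝ, 0 < δ → epNorm p (F - G) < ENNReal.ofReal δ →
      ‖finiteRankDet p F - finiteRankDet p G‖ ≤ C * δ := by
  have hp1 : 1 < p := by linarith
  -- For δ < 1 and |z| ≤ 1 + 1/δ, the norm of G + z(F - G) is below r + (1 + 1/δ) δ ≤ r + 2. The
  -- absolute value disappears once r is seen to be positive.
  obtain ⟨C, hC0, hC⟩ := exists_norm_finiteRankDet_le (p := p) hp (|r| + 2)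
  refine ⟨2 * C, by positivity, fun F hF G hG hFr hGr δ hδ hFG => ?_⟩
  have hr : 0 < r := by
    by_contra hr
    rw [ENNReal.ofReal_of_nonpos (not_lt.1 hr)] at hFr
    exact not_lt_bot hFr
  rw [abs_of_pos hr] at hC
  -- When δ ≥ 1, the sum of the two individual bounds is already at most 2Cδ.
  by_cases hδ1 : 1 ≤ δ
  · have h1 : ENNReal.ofReal r ≤ ENNReal.ofReal (r + 2) := ENNReal.ofReal_le_ofReal (by linarith)
    have h2 := hC F hF (hFr.trans_le h1)
    have h3 := hC G hG (hGr.trans_le h1)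
    calc _ ≤ C + C := (norm_sub_le _ _).trans (add_le_add h2 h3)
      _ ≤ 2 * C * δ := by nlinarith
  push Not at hδ1
  have hd : F - G ∈ finiteRankEp p := by
    have := add_smul_mem_finiteRankEp hp1 hF hG (-1)
    rwa [neg_one_smul, ← sub_eq_add_neg] at this
  set f : ℂ → ℂ := fun z => finiteRankDet p (G + z • (F - G)) with hf
  have hdiff : Differentiable ℂ f := differentiable_finiteRankDet p G (F - G) hG.2 hd.2
  have hbound : ∀ z : ℂ, ‖z‖ ≤ 1 + 1 / δ → ‖f z‖ ≤ C := by
    intro z hz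
    refine hC _ (add_smul_mem_finiteRankEp hp1 hG hd z) ?_
    have hzδ : ‖z‖ * δ ≤ 2 := by
      calc ‖z‖ * δ ≤ (1 + 1 / δ) * δ := by gcongr
        _ = δ + 1 := by field_simp
        _ ≤ 2 := by linarith
    calc epNorm p (G + z • (F - G))
        ≤ epNorm p G + ‖z‖ₑ * epNorm p (F - G) :=
          (epNorm_add_le hp1 _ _).trans (by gcongr; exact epNorm_smul_le hp1 z hd.1)
      _ ≤ epNorm p G + ENNReal.ofReal 2 := by
          gcongr
          refine (mul_le_mul_right hFG.le _).trans ?_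
          rw [← ofReal_norm, ← ENNReal.ofReal_mul (norm_nonneg _)]
          exact ENNReal.ofReal_le_ofReal hzδ
      _ < ENNReal.ofReal r + ENNReal.ofReal 2 :=
          ENNReal.add_lt_add_right ENNReal.ofReal_ne_top hGr
      _ = ENNReal.ofReal (r + 2) := (ENNReal.ofReal_add hr.le (by norm_num)).symm
  -- Cauchy's estimate on circles of radius 1/δ produces the factor δ; the mean value inequality
  -- between 0 and 1 then concludes.
  have hderiv : ∀ z ∈ Metric.closedBall (0 : ℂ) 1, ‖deriv f z‖ ≤ C * δ := by
    intro z hz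
    have hz1 : ‖z‖ ≤ 1 := by simpa using hz
    have := Complex.norm_deriv_le_of_forall_mem_sphere_norm_le (c := z) (R := 1 / δ) (C := C)
      (by positivity) hdiff.diffContOnCl fun y hy => ?_
    · rwa [div_div_eq_mul_div, div_one] at this
    · refine hbound y ?_
      have hy1 : ‖y - z‖ = 1 / δ := by simpa using hy
      calc ‖y‖ = ‖z + (y - z)‖ := by rw [add_sub_cancel]
        _ ≤ 1 + 1 / δ := (norm_add_le _ _).trans (by rw [hy1]; gcongr)
  have hmv := (convex_closedBall (0 : ℂ) 1).norm_image_sub_le_of_norm_deriv_le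
    (fun z _ => hdiff z) hderiv (x := 0) (y := 1) (by simp) (by simp)
  have h1 : f 1 = finiteRankDet p F := by simp [hf]
  have h0 : f 0 = finiteRankDet p G := by simp [hf]
  rw [h1, h0, sub_zero, norm_one, mul_one] at hmv
  calc _ ≤ C * δ := hmv
    _ ≤ 2 * C * δ := by nlinarith [mul_nonneg hC0 hδ.le]

end Bound

/-! ### Density of the finite-rank operators -/

section Density

theorem lpE_mul_const {s : ℝ} (hs : 0 < s) {c : ℝ≥0∞} (hc : c ≠ ∞) (f : ℂ → ℝ≥0∞) :
    lpE s (fun x => f x * c) = lpE s f * c := by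
  simp_rw [mul_comm _ c]
  exact lpE_const_mul hs hc f

theorem mixedE_mul {r s : ℝ} (hr : 0 < r) (hs : 0 < s) {f g : ℂ → ℝ≥0∞} (hf : ∀ x, f x ≠ ∞)
    (hg : lpE s g ≠ ∞) : mixedE r s (fun x y => f x * g y) = lpE r f * lpE s g := by
  unfold mixedE
  simp_rw [fun x => lpE_const_mul hs (hf x) g]
  exact lpE_mul_const hr hg f

variable {p : ℝ}

theorem kernelE_mul_ne_top (hp : 1 < p) {f g : ℂ → ℝ≥0∞} (hf : ∀ x, f x ≠ ∞) (hg : ∀ x, g x ≠ ∞)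
    (hfp : lpE p f ≠ ∞) (hgq : lpE p.conjExponent g ≠ ∞) :
    kernelE p (fun x y => f x * g y) ≠ ∞ := by
  have hq := conjExponent_pos hp
  have hp0 : 0 < p := by linarith
  rw [kernelE, mixedE_mul hp0 hq hf hgq]
  simp_rw [mul_comm (f _) (g _)]
  rw [mixedE_mul hq hp0 hg hfp]
  exact (max_lt (ENNReal.mul_lt_top hfp.lt_top hgq.lt_top)
    (ENNReal.mul_lt_top hgq.lt_top hfp.lt_top)).ne

/-- A kernel is separated if it is a finite sum of products of functions in `L^p` and `L^{p'}`. -/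
def IsSeparated (p : ℝ) (c : ℂ → ℂ → ℂ) : Prop :=
  ∃ (s : Finset ℂ) (f g : ℂ → ℂ → ℂ), (∀ i, MemLp (f i) (ENNReal.ofReal p) volume) ∧
    (∀ i, MemLp (g i) (ENNReal.ofReal p.conjExponent) volume) ∧
    ∀ x y, c x y = ∑ i ∈ s, f i x * g i y

theorem IsSeparated.aestronglyMeasurable {c : ℂ → ℂ → ℂ} (hc : IsSeparated p c) :
    AEStronglyMeasurable (Function.uncurry c) (volume : Measure (ℂ × ℂ)) := by
  obtain ⟨s, f, g, hf, hg, h⟩ := hc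
  have : Function.uncurry c = fun z => ∑ i ∈ s, f i z.1 * g i z.2 := by
    ext z; exact h z.1 z.2
  rw [this]
  exact Finset.aestronglyMeasurable_fun_sum s fun i _ => (hf i).1.comp_fst.mul (hg i).1.comp_snd

/-- A kernel is approximable if separated kernels are arbitrarily close to it. -/
def Approximable (p : ℝ) (a : ℂ → ℂ → ℂ) : Prop :=
  ∀ ε : ℝ≥0∞, 0 < ε → ∃ c, IsSeparated p c ∧ kernelE p (fun x y => ‖a x y - c x y‖ₑ) < ε

theorem Approximable.of_tendsto (hp : 1 < p) {a : ℂ → ℂ → ℂ} {F : ℕ → ℂ → ℂ → ℂ}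
    (ha : AEStronglyMeasurable (Function.uncurry a) (volume : Measure (ℂ × ℂ)))
    (hFm : ∀ n, AEStronglyMeasurable (Function.uncurry (F n)) (volume : Measure (ℂ × ℂ)))
    (hF : ∀ n, Approximable p (F n))
    (hlim : Tendsto (fun n => kernelE p fun x y => ‖a x y - F n x y‖ₑ) atTop (𝓝 0)) :
    Approximable p a := by
  intro ε hε
  have hε2 : 0 < ε / 2 := ENNReal.half_pos hε.ne'
  obtain ⟨n, hn⟩ := (hlim.eventually (gt_mem_nhds hε2)).exists
  obtain ⟨c, hc, hc'⟩ := hF n (ε / 2) hε2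
  refine ⟨c, hc, ?_⟩
  have hcm := hc.aestronglyMeasurable
  calc kernelE p (fun x y => ‖a x y - c x y‖ₑ)
      ≤ kernelE p (fun x y => ‖a x y - F n x y‖ₑ + ‖F n x y - c x y‖ₑ) := by
        refine kernelE_mono_ae hp (ae_of_all _ fun z => ?_)
        rw [← sub_add_sub_cancel (a z.1 z.2) (F n z.1 z.2)]
        exact enorm_add_le _ _
    _ ≤ _ := kernelE_add_le hp (ha.sub (hFm n)).enorm ((hFm n).sub hcm).enorm
    _ < ε / 2 + ε / 2 := ENNReal.add_lt_add hn hc'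
    _ = ε := ENNReal.add_halves ε

/-- The common tool of the reductions below: almost everywhere convergence under one majorant of
finite norm is convergence in norm, with 2B dominating the differences. -/
theorem Approximable.of_dominated (hp : 1 < p) {a : ℂ → ℂ → ℂ} {F : ℕ → ℂ → ℂ → ℂ}
    (ha : AEStronglyMeasurable (Function.uncurry a) (volume : Measure (ℂ × ℂ)))
    (hFm : ∀ n, AEStronglyMeasurable (Function.uncurry (F n)) (volume : Measure (ℂ × ℂ)))
    (hF : ∀ n, Approximable p (F n)) {B : ℂ → ℂ → ℝ≥0∞}
    (hBm : AEMeasurable (Function.uncurry B)) (hB : kernelE p B ≠ ∞)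
    (hFB : ∀ n, ∀ᵐ z : ℂ × ℂ, ‖F n z.1 z.2‖ₑ ≤ B z.1 z.2)
    (haB : ∀ᵐ z : ℂ × ℂ, ‖a z.1 z.2‖ₑ ≤ B z.1 z.2)
    (hlim : ∀ᵐ z : ℂ × ℂ, Tendsto (fun n => F n z.1 z.2) atTop (𝓝 (a z.1 z.2))) :
    Approximable p a := by
  refine Approximable.of_tendsto hp ha hFm hF ?_
  refine kernelE_tendsto_zero hp (B := fun x y => 2 * B x y) (fun n => (ha.sub (hFm n)).enorm)
    (hBm.const_mul 2) ?_ (fun n => ?_) ?_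
  · rw [kernelE_const_mul hp ENNReal.ofNat_ne_top]
    exact ENNReal.mul_ne_top ENNReal.ofNat_ne_top hB
  · filter_upwards [hFB n, haB] with z h1 h2
    rw [two_mul]
    exact (enorm_sub_le).trans (add_le_add h2 h1)
  · filter_upwards [hlim] with z hz
    have := (tendsto_const_nhds (x := a z.1 z.2)).sub hz
    rw [sub_self] at this
    simpa using this.enorm

/-- The indicator of the ball of radius `R`. -/
def cutoff (R : ℝ) (x : ℂ) : ℂ := (Metric.closedBall (0 : ℂ) R).indicator (fun _ => 1) x

theorem measurable_cutoff (R : ℝ) : Measurable (cutoff R) :=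
  measurable_const.indicator measurableSet_closedBall

theorem enorm_cutoff_le_one (R : ℝ) (x : ℂ) : ‖cutoff R x‖ₑ ≤ 1 := by
  unfold cutoff
  by_cases h : x ∈ Metric.closedBall (0 : ℂ) R <;> simp [h]

theorem memLp_cutoff_mul {f : ℂ → ℂ} (hf : AEStronglyMeasurable f volume) {M : ℝ}
    (hM : ∀ x, ‖f x‖ ≤ M) (R : ℝ) (s : ℝ≥0∞) : MemLp (fun x => cutoff R x * f x) s volume := by
  have h : (fun x => cutoff R x * f x) = (Metric.closedBall (0 : ℂ) R).indicator f := by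
    ext x
    unfold cutoff
    by_cases h : x ∈ Metric.closedBall (0 : ℂ) R <;> simp [h]
  rw [h, memLp_indicator_iff_restrict measurableSet_closedBall]
  have : IsFiniteMeasure ((volume : Measure ℂ).restrict (Metric.closedBall (0 : ℂ) R)) :=
    isFiniteMeasure_restrict.2 measure_closedBall_lt_top.ne
  exact MemLp.of_bound hf.restrict M (ae_of_all _ hM)

theorem memLp_cutoff (R : ℝ) (s : ℝ≥0∞) : MemLp (cutoff R) s volume := by
  simpa using memLp_cutoff_mul (f := fun _ => 1) aestronglyMeasurable_const (M := 1)
    (fun _ => by simp) R s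

theorem lpE_cutoff_ne_top (R : ℝ) {s : ℝ} (hs : 0 < s) : lpE s (fun x => ‖cutoff R x‖ₑ) ≠ ∞ := by
  rw [← eLpNorm_ofReal hs]
  exact (memLp_cutoff R _).2.ne

theorem kernelE_cutoff_ne_top (hp : 1 < p) (R : ℝ) {M : ℝ≥0∞} (hM : M ≠ ∞) :
    kernelE p (fun x y => M * (‖cutoff R x‖ₑ * ‖cutoff R y‖ₑ)) ≠ ∞ := by
  rw [kernelE_const_mul hp hM]
  exact ENNReal.mul_ne_top hM (kernelE_mul_ne_top hp (fun _ => enorm_ne_top)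
    (fun _ => enorm_ne_top) (lpE_cutoff_ne_top R (by linarith))
    (lpE_cutoff_ne_top R (conjExponent_pos hp)))

theorem measurable_cutoff_prod (R : ℝ) :
    Measurable fun z : ℂ × ℂ => cutoff R z.1 * cutoff R z.2 :=
  ((measurable_cutoff R).comp measurable_fst).mul ((measurable_cutoff R).comp measurable_snd)

theorem aemeasurable_cutoff_bound (R : ℝ) (M : ℝ≥0∞) :
    AEMeasurable (Function.uncurry fun x y => M * (‖cutoff R x‖ₑ * ‖cutoff R y‖ₑ))
      (volume : Measure (ℂ × ℂ)) := by
  refine Measurable.aemeasurable (Measurable.const_mul ?_ M)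
  exact ((measurable_cutoff R).comp measurable_fst).enorm.mul
    ((measurable_cutoff R).comp measurable_snd).enorm

theorem enorm_cutoff_mul_le (R : ℝ) {M : ℝ} {h : ℂ} (hh : ‖h‖ ≤ M) (x y : ℂ) :
    ‖cutoff R x * cutoff R y * h‖ₑ ≤ ENNReal.ofReal M * (‖cutoff R x‖ₑ * ‖cutoff R y‖ₑ) := by
  rw [enorm_mul, enorm_mul, mul_comm]
  gcongr
  rw [← ofReal_norm]
  exact ENNReal.ofReal_le_ofReal hh

/-- Replacing x by a simple function of x makes the kernel exactly separated: the sum runs over the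
finitely many values v, with terms 1_{s(x)=v} h(v,y). Continuity of h gives pointwise convergence as
the simple functions tend to the identity. -/
theorem approximable_continuous (hp : 1 < p) {h : ℂ × ℂ → ℂ} (hc : Continuous h) {M : ℝ}
    (hM : ∀ z, ‖h z‖ ≤ M) (R : ℝ) :
    Approximable p fun x y => cutoff R x * cutoff R y * h (x, y) := by
  set s : ℕ → SimpleFunc ℂ ℂ := fun n =>
    SimpleFunc.approxOn id measurable_id Set.univ 0 (Set.mem_univ _) n with hs
  have hm1 : ∀ n, Measurable fun z : ℂ × ℂ => h (s n z.1, z.2) := fun n =>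
    hc.measurable.comp (((s n).measurable.comp measurable_fst).prodMk measurable_snd)
  refine Approximable.of_dominated hp
    (F := fun n x y => cutoff R x * cutoff R y * h (s n x, y))
    (B := fun x y => ENNReal.ofReal M * (‖cutoff R x‖ₑ * ‖cutoff R y‖ₑ)) ?_ (fun n => ?_)
    (fun n => ?_) (aemeasurable_cutoff_bound R _) (kernelE_cutoff_ne_top hp R ENNReal.ofReal_ne_top)
    (fun n => ae_of_all _ fun z => ?_) (ae_of_all _ fun z => ?_) (ae_of_all _ fun z => ?_)
  · exact ((measurable_cutoff_prod R).mul hc.measurable).aestronglyMeasurable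
  · exact ((measurable_cutoff_prod R).mul (hm1 n)).aestronglyMeasurable
  · intro ε hε
    refine ⟨_, ⟨(s n).range,
      fun v x => cutoff R x * ((s n) ⁻¹' {v}).indicator (fun _ => 1) x,
      fun v y => cutoff R y * h (v, y), fun v => ?_, fun v => ?_, fun x y => rfl⟩, ?_⟩
    · refine memLp_cutoff_mul (M := 1) ?_ (fun x => ?_) R _
      · exact (measurable_const.indicator ((s n).measurableSet_fiber v)).aestronglyMeasurable
      · by_cases hx : x ∈ (s n) ⁻¹' {v} <;> simp [hx]
    · exact memLp_cutoff_mul (hc.comp (by fun_prop)).aestronglyMeasurable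
        (fun y => hM (v, y)) R _
    · have h0 : (fun x y => ‖cutoff R x * cutoff R y * h (s n x, y) - ∑ v ∈ (s n).range,
          cutoff R x * ((s n) ⁻¹' {v}).indicator (fun _ => 1) x * (cutoff R y * h (v, y))‖ₑ)
          = fun _ _ => 0 := by
        ext x y
        rw [Finset.sum_eq_single (s n x)]
        · have : x ∈ (s n) ⁻¹' {s n x} := rfl
          rw [Set.indicator_of_mem this, mul_one]
          rw [show cutoff R x * cutoff R y * h (s n x, y) - cutoff R x * (cutoff R y * h (s n x, y))
            = 0 by ring, enorm_zero]
        · intro v _ hv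
          have : x ∉ (s n) ⁻¹' {v} := fun hx => hv (Eq.symm hx)
          rw [Set.indicator_of_notMem this]
          ring
        · intro hx
          exact absurd (SimpleFunc.mem_range_self _ x) hx
      rw [h0]
      have := kernelE_const_mul hp (c := 0) ENNReal.zero_ne_top fun _ _ => 0
      simp only [zero_mul] at this
      rwa [this]
  · exact enorm_cutoff_mul_le R (hM _) _ _
  · exact enorm_cutoff_mul_le R (hM _) _ _
  · refine Tendsto.mul tendsto_const_nhds ?_
    refine (hc.tendsto _).comp (Tendsto.prodMk_nhds ?_ tendsto_const_nhds)
    exact SimpleFunc.tendsto_approxOn measurable_id (Set.mem_univ _) (by simp)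

/-- The radial retraction onto the ball of radius `M`. -/
def clamp (M : ℝ) (z : ℂ) : ℂ := z / ((max 1 (‖z‖ / M) : ℝ) : ℂ)

theorem continuous_clamp (M : ℝ) : Continuous (clamp M) := by
  unfold clamp
  refine continuous_id.div ?_ fun z => ?_
  · fun_prop
  · exact_mod_cast (lt_of_lt_of_le one_pos (le_max_left _ _)).ne'

theorem norm_clamp_le {M : ℝ} (hM : 0 < M) (z : ℂ) : ‖clamp M z‖ ≤ M := by
  have h1 : 0 < max 1 (‖z‖ / M) := lt_of_lt_of_le one_pos (le_max_left _ _)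
  rw [clamp, norm_div, Complex.norm_real, Real.norm_of_nonneg h1.le, div_le_iff₀ h1]
  calc ‖z‖ = M * (‖z‖ / M) := by field_simp
    _ ≤ _ := by gcongr; exact le_max_right _ _

theorem clamp_of_norm_le {M : ℝ} (hM : 0 < M) {z : ℂ} (hz : ‖z‖ ≤ M) : clamp M z = z := by
  rw [clamp, max_eq_left ((div_le_one hM).2 hz)]
  simp

/-- Continuous functions are dense in L¹, and a subsequence converges almost everywhere. The clamp
restores a uniform bound without moving the limit, and it keeps the approximants continuous. -/
theorem approximable_bounded (hp : 1 < p) {g : ℂ × ℂ → ℂ} (hg : Measurable g) {M : ℝ} (hM0 : 0 < M)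
    (hM : ∀ z, ‖g z‖ ≤ M) (R : ℝ) :
    Approximable p fun x y => cutoff R x * cutoff R y * g (x, y) := by
  set G : ℂ × ℂ → ℂ := fun z => cutoff R z.1 * cutoff R z.2 * g z with hG
  have hGm : Measurable G := (measurable_cutoff_prod R).mul hg
  have hcut : ∀ x : ℂ, ‖cutoff R x‖ ≤ 1 := fun x => by
    unfold cutoff
    by_cases h : x ∈ Metric.closedBall (0 : ℂ) R <;> simp [h]
  have hcut2 : ∀ x : ℂ, cutoff R x * cutoff R x = cutoff R x := fun x => by
    unfold cutoff
    by_cases h : x ∈ Metric.closedBall (0 : ℂ) R <;> simp [h]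
  have hGM : ∀ z, ‖G z‖ ≤ M := fun z => by
    rw [hG, norm_mul, norm_mul]
    calc _ ≤ 1 * 1 * M := by gcongr; exacts [hcut _, hcut _, hM _]
      _ = M := by ring
  have hGint : MemLp G 1 (volume : Measure (ℂ × ℂ)) := by
    rw [memLp_one_iff_integrable]
    have h1 : Integrable fun z : ℂ × ℂ => cutoff R z.1 * cutoff R z.2 :=
      (memLp_one_iff_integrable.1 (memLp_cutoff R 1)).mul_prod
        (memLp_one_iff_integrable.1 (memLp_cutoff R 1))
    exact h1.mul_bdd (c := M) hg.aestronglyMeasurable (ae_of_all _ hM)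
  have hex : ∀ n : ℕ, ∃ c : ℂ × ℂ → ℂ, eLpNorm (c - G) 1 volume ≤ ((n : ℝ≥0∞) + 1)⁻¹ ∧
      Continuous c := by
    intro n
    obtain ⟨c, -, h2, h3, -⟩ := hGint.exists_hasCompactSupport_eLpNorm_sub_le ENNReal.one_ne_top
      (ε := ((n : ℝ≥0∞) + 1)⁻¹) (by simp)
    exact ⟨c, by rwa [eLpNorm_sub_comm], h3⟩
  choose c hc1 hc2 using hex
  have hlim : Tendsto (fun n => eLpNorm (c n - G) 1 volume) atTop (𝓝 0) := by
    refine tendsto_of_tendsto_of_tendsto_of_le_of_le tendsto_const_nhds ?_ (fun _ => zero_le)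
      hc1
    have := (tendsto_add_atTop_iff_nat 1).2 ENNReal.tendsto_inv_nat_nhds_zero
    simpa using this
  have hmeas := tendstoInMeasure_of_tendsto_eLpNorm one_ne_zero
    (fun n => (hc2 n).aestronglyMeasurable) hGm.aestronglyMeasurable hlim
  obtain ⟨ns, -, hns⟩ := hmeas.exists_seq_tendsto_ae
  refine Approximable.of_dominated hp
    (F := fun n x y => cutoff R x * cutoff R y * clamp M (c (ns n) (x, y)))
    (B := fun x y => ENNReal.ofReal M * (‖cutoff R x‖ₑ * ‖cutoff R y‖ₑ))
    hGm.aestronglyMeasurable (fun n => ?_) (fun n => ?_)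
    (aemeasurable_cutoff_bound R _) (kernelE_cutoff_ne_top hp R ENNReal.ofReal_ne_top)
    (fun n => ae_of_all _ fun z => enorm_cutoff_mul_le R (norm_clamp_le hM0 _) _ _)
    (ae_of_all _ fun z => enorm_cutoff_mul_le R (hM _) _ _) ?_
  · exact ((measurable_cutoff_prod R).mul
      ((continuous_clamp M).comp (hc2 _)).measurable).aestronglyMeasurable
  · exact approximable_continuous hp ((continuous_clamp M).comp (hc2 _))
      (fun z => norm_clamp_le hM0 _) R
  · filter_upwards [hns] with z hz
    have h1 := ((continuous_clamp M).tendsto _).comp hz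
    rw [clamp_of_norm_le hM0 (hGM z)] at h1
    have h2 := (tendsto_const_nhds (x := cutoff R z.1 * cutoff R z.2)).mul h1
    -- The cutoffs appear twice, in the approximants and in their limit `G`; they are idempotent.
    have h3 : cutoff R z.1 * cutoff R z.2 * G z = cutoff R z.1 * cutoff R z.2 * g (z.1, z.2) := by
      simp only [hG]
      calc _ = (cutoff R z.1 * cutoff R z.1) * (cutoff R z.2 * cutoff R z.2) * g z := by ring
        _ = _ := by rw [hcut2, hcut2]
    rw [h3] at h2
    exact h2

theorem approximable_of_measurable (hp : 1 < p) {a : ℂ × ℂ → ℂ} (ha : Measurable a)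
    (hA : kernelE p (fun x y => ‖a (x, y)‖ₑ) ≠ ∞) : Approximable p fun x y => a (x, y) := by
  -- Truncation in height and, through the cutoffs, in space; at each point the sequence is
  -- eventually constant. The level n + 1 is positive even for n = 0, as `approximable_bounded`
  -- requires.
  set g : ℕ → ℂ × ℂ → ℂ := fun n => {z | ‖a z‖ ≤ n + 1}.indicator a with hg
  have hgm : ∀ n, Measurable (g n) := fun n =>
    ha.indicator (measurableSet_le ha.norm measurable_const)
  have hgle : ∀ n z, ‖g n z‖ₑ ≤ ‖a z‖ₑ := fun n z => by
    by_cases h : z ∈ {z | ‖a z‖ ≤ n + 1} <;> simp [hg, h]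
  refine Approximable.of_dominated hp
    (F := fun n x y => cutoff n x * cutoff n y * g n (x, y))
    (B := fun x y => ‖a (x, y)‖ₑ) ha.aestronglyMeasurable (fun n => ?_) (fun n => ?_)
    ha.enorm.aemeasurable hA (fun n => ae_of_all _ fun z => ?_) (ae_of_all _ fun z => le_rfl)
    (ae_of_all _ fun z => ?_)
  · exact ((measurable_cutoff_prod n).mul (hgm n)).aestronglyMeasurable
  · refine approximable_bounded hp (hgm n) (M := n + 1) (by positivity) (fun z => ?_) n
    by_cases h : z ∈ {z | ‖a z‖ ≤ n + 1}
    · rw [hg]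
      simp only [Set.indicator_of_mem h]
      exact h
    · simp only [hg, Set.indicator_of_notMem h, norm_zero]
      positivity
  · rw [enorm_mul, enorm_mul]
    calc _ ≤ 1 * 1 * ‖a z‖ₑ := by
          gcongr
          exacts [enorm_cutoff_le_one _ _, enorm_cutoff_le_one _ _, hgle n z]
      _ = _ := by simp
  · refine tendsto_const_nhds.congr' ?_
    obtain ⟨N, hN⟩ := exists_nat_ge (max (max ‖z.1‖ ‖z.2‖) ‖a z‖)
    filter_upwards [eventually_ge_atTop N] with n hn
    have hn' : (N : ℝ) ≤ n := by exact_mod_cast hn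
    have h1 : z.1 ∈ Metric.closedBall (0 : ℂ) n := by
      rw [mem_closedBall_zero_iff]
      exact ((le_max_left _ _).trans (le_max_left _ _)).trans (hN.trans hn')
    have h2 : z.2 ∈ Metric.closedBall (0 : ℂ) n := by
      rw [mem_closedBall_zero_iff]
      exact ((le_max_right _ _).trans (le_max_left _ _)).trans (hN.trans hn')
    have h3 : z ∈ {z | ‖a z‖ ≤ n + 1} := by
      have := (le_max_right (max ‖z.1‖ ‖z.2‖) ‖a z‖).trans (hN.trans hn')
      simp only [Set.mem_ofPred_eq]
      linarith
    simp only [cutoff, hg, Set.indicator_of_mem h1, Set.indicator_of_mem h2, one_mul]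
    exact (Set.indicator_of_mem h3 a).symm

theorem approximable_of_kernelNorm_ne_top (hp : 1 < p) {a : ℂ → ℂ → ℂ}
    (ha : AEStronglyMeasurable (Function.uncurry a) (volume : Measure (ℂ × ℂ)))
    (hA : kernelNorm p a ≠ ∞) : Approximable p a := by
  rw [kernelNorm_eq_kernelE] at hA
  have hae : ∀ᵐ z : ℂ × ℂ, a z.1 z.2 = ha.mk _ (z.1, z.2) := ha.ae_eq_mk
  have h1 : kernelE p (fun x y => ‖ha.mk _ (x, y)‖ₑ) ≠ ∞ := by
    refine ne_top_of_le_ne_top hA (kernelE_mono_ae hp ?_)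
    filter_upwards [hae] with z hz
    rw [hz]
  intro ε hε
  obtain ⟨c, hc, hc'⟩ := approximable_of_measurable hp ha.stronglyMeasurable_mk.measurable h1 ε hε
  refine ⟨c, hc, (kernelE_mono_ae hp ?_).trans_lt hc'⟩
  filter_upwards [hae] with z hz
  rw [hz]

variable [Fact (1 ≤ ENNReal.ofReal p)]

/-- The operator sends u to the sum of the f_i with coefficients ∫ g_i u, finite by Hölder, so its
range lies in the span of the f_i. -/
theorem IsSeparated.finiteDimensional_range (hp : 1 < p) {c : ℂ → ℂ → ℂ} (hc : IsSeparated p c)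
    {F : LpC p →L[ℂ] LpC p} (hF : IsIntegralKernel p F c) :
    FiniteDimensional ℂ (LinearMap.range F.toLinearMap) := by
  obtain ⟨s, f, g, hf, hg, h⟩ := hc
  have hpq := Real.HolderConjugate.conjExponent hp
  set v : ℂ → LpC p := fun i => (hf i).toLp (f i)
  set W : Submodule ℂ (LpC p) := Submodule.span ℂ (Set.image v s) with hW
  have : FiniteDimensional ℂ W := FiniteDimensional.span_of_finite ℂ (s.finite_toSet.image v)
  refine Submodule.finiteDimensional_of_le (S₂ := W) ?_
  rintro _ ⟨u, rfl⟩
  have hInt : ∀ i, Integrable fun y => g i y * u y := fun i => by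
    have : ENNReal.HolderConjugate (ENNReal.ofReal p.conjExponent) (ENNReal.ofReal p) :=
      hpq.symm.ennrealOfReal
    exact (hg i).integrable_mul (Lp.memLp u)
  have hFu : F u = ∑ i ∈ s, (∫ y, g i y * u y) • v i := by
    rw [Lp.ext_iff]
    have h2 : ∀ᵐ x, ∀ i ∈ s, ((∫ y, g i y * u y) • v i : LpC p) x
        = (∫ y, g i y * u y) * f i x := by
      rw [Filter.eventually_all_finset]
      intro i _
      filter_upwards [Lp.coeFn_smul (∫ y, g i y * u y) (v i), (hf i).coeFn_toLp]
        with x h3 h4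
      rw [h3, Pi.smul_apply, h4, smul_eq_mul]
    filter_upwards [hF.2 u, h2, Lp.coeFn_finsetSum s
      fun i => ((∫ y, g i y * u y) • v i : LpC p)] with x h3 h4 h5
    rw [h3, h5, Finset.sum_apply, Finset.sum_congr rfl h4]
    simp_rw [h, Finset.sum_mul]
    rw [integral_finsetSum]
    · refine Finset.sum_congr rfl fun i _ => ?_
      rw [← integral_mul_const]
      congr 1
      ext y
      ring
    · intro i _
      have := (hInt i).const_mul (f i x)
      simpa [mul_assoc] using this
  change F u ∈ W
  rw [hFu]
  refine Submodule.sum_mem _ fun i hi => Submodule.smul_mem _ _ (Submodule.subset_span ?_)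
  exact ⟨i, hi, rfl⟩

theorem exists_finiteRankEp_epNorm_sub_lt (hp : 1 < p) {A : LpC p →L[ℂ] LpC p} (hA : MemEp p A)
    {ε : ℝ≥0∞} (hε : 0 < ε) : ∃ F ∈ finiteRankEp p, epNorm p (F - A) < ε := by
  obtain ⟨a, ha, ha'⟩ := hA
  obtain ⟨c, hc, hc'⟩ := approximable_of_kernelNorm_ne_top hp ha.1 ha'.ne (min ε 1) (by simp [hε])
  have hneg : kernelNorm p (fun x y => (-1) * a x y) < ∞ := by
    rw [kernelNorm_const_mul hp]
    exact ENNReal.mul_lt_top enorm_lt_top ha'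
  have hd : kernelNorm p (fun x y => c x y + (-1) * a x y) < min ε 1 := by
    rw [kernelNorm_eq_kernelE]
    have h0 : ∀ x y, ‖c x y + (-1) * a x y‖ₑ = ‖a x y - c x y‖ₑ := fun x y => by
      rw [← enorm_neg]
      congr 1
      ring
    simpa only [h0] using hc'
  have hcfin : kernelNorm p c < ∞ := by
    have h1 := kernelNorm_add_le hp (a := fun x y => c x y + (-1) * a x y)
      (hc.aestronglyMeasurable.add (ha.smul (-1)).1) ha.1
    have h2 : (fun x y => (c x y + (-1) * a x y) + a x y) = c := by
      ext x y; ring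
    have h3 : kernelNorm p (fun x y => (c x y + (-1) * a x y) + a x y) < ∞ :=
      h1.trans_lt (ENNReal.add_lt_top.2 ⟨hd.trans_le le_top, ha'⟩)
    rwa [h2] at h3
  obtain ⟨F, hF⟩ := exists_isIntegralKernel hp hc.aestronglyMeasurable hcfin.ne
  refine ⟨F, ⟨⟨c, hF, hcfin⟩, hc.finiteDimensional_range hp hF⟩, ?_⟩
  have h4 := hF.add hp (ha.smul (-1)) hcfin.ne hneg.ne
  rw [neg_one_smul, ← sub_eq_add_neg] at h4
  exact (epNorm_le h4).trans_lt (hd.trans_le (min_le_left _ _))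

end Density

/-! ### Extension of the determinant to `E_p` -/

section RenormDet

variable {p : ℝ} [Fact (1 ≤ ENNReal.ofReal p)]

theorem epNorm_neg_le (hp : 1 < p) (A : LpC p →L[ℂ] LpC p) : epNorm p (-A) ≤ epNorm p A := by
  by_cases hA : MemEp p A
  · have := epNorm_smul_le hp (-1) hA
    simpa using this
  · rw [memEp_iff, not_lt, top_le_iff] at hA
    rw [hA]
    exact le_top

theorem epNorm_sub_comm_le (hp : 1 < p) (A B : LpC p →L[ℂ] LpC p) :
    epNorm p (A - B) ≤ epNorm p (B - A) := by
  rw [← neg_sub B A]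
  exact epNorm_neg_le hp _

theorem epNhds_hasBasis (A : LpC p →L[ℂ] LpC p) :
    (epNhds p A).HasBasis (fun ε : ℝ≥0∞ => 0 < ε) fun ε => {B | epNorm p (B - A) < ε} :=
  ENNReal.nhds_zero_basis.comap _

/-- The finite-rank operators close to `A`. -/
abbrev finiteRankNhds (A : LpC p →L[ℂ] LpC p) : Filter (LpC p →L[ℂ] LpC p) :=
  epNhds p A ⊓ 𝓟 (finiteRankEp p)

theorem finiteRankNhds_hasBasis (A : LpC p →L[ℂ] LpC p) :
    (finiteRankNhds A).HasBasis (fun ε : ℝ≥0∞ => 0 < ε)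
      fun ε => {B | epNorm p (B - A) < ε} ∩ finiteRankEp p :=
  (epNhds_hasBasis A).inf_principal _

theorem finiteRankNhds_neBot (hp : 1 < p) {A : LpC p →L[ℂ] LpC p} (hA : MemEp p A) :
    (finiteRankNhds A).NeBot := by
  rw [(finiteRankNhds_hasBasis A).neBot_iff]
  intro ε hε
  obtain ⟨F, hF, hF'⟩ := exists_finiteRankEp_epNorm_sub_lt hp hA hε
  exact ⟨F, hF', hF⟩

theorem eventually_finiteRankNhds (hp : 1 < p) {A : LpC p →L[ℂ] LpC p} {r δ : ℝ} (hr : 0 ≤ r)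
    (hA : epNorm p A < ENNReal.ofReal r) (hδ : 0 < δ) :
    ∀ᶠ F in finiteRankNhds A, F ∈ finiteRankEp p ∧ epNorm p (F - A) < ENNReal.ofReal δ ∧
      epNorm p F < ENNReal.ofReal (r + 1) := by
  have hmin : (0 : ℝ≥0∞) < min (ENNReal.ofReal δ) 1 := by simp [hδ]
  filter_upwards [(finiteRankNhds_hasBasis A).mem_of_mem hmin] with F hF
  refine ⟨hF.2, hF.1.trans_le (min_le_left _ _), ?_⟩
  calc epNorm p F = epNorm p ((F - A) + A) := by rw [sub_add_cancel]
    _ ≤ epNorm p (F - A) + epNorm p A := epNorm_add_le hp _ _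
    _ < 1 + ENNReal.ofReal r := ENNReal.add_lt_add (hF.1.trans_le (min_le_right _ _)) hA
    _ = ENNReal.ofReal (r + 1) := by
        rw [ENNReal.ofReal_add hr zero_le_one, ENNReal.ofReal_one, add_comm]

theorem exists_epNorm_lt_ofReal {A : LpC p →L[ℂ] LpC p} (hA : MemEp p A) :
    ∃ r : ℝ, 0 ≤ r ∧ epNorm p A < ENNReal.ofReal r := by
  have h := (memEp_iff.1 hA).ne
  refine ⟨(epNorm p A).toReal + 1, by positivity, ?_⟩
  rw [ENNReal.ofReal_add ENNReal.toReal_nonneg zero_le_one, ENNReal.ofReal_toReal h]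
  exact ENNReal.lt_add_right h (by simp)

/-- Density makes the filter nontrivial, and the Lipschitz bound makes its image Cauchy in ℂ. So the
limit in the definition of `renormDet` exists and is not a default value. -/
theorem tendsto_finiteRankDet (hp : 2 < p) {A : LpC p →L[ℂ] LpC p} (hA : MemEp p A) :
    Tendsto (finiteRankDet p) (finiteRankNhds A) (𝓝 (renormDet p A)) := by
  have hp1 : 1 < p := by linarith
  have hne := finiteRankNhds_neBot hp1 hA
  obtain ⟨r, hr, hAr⟩ := exists_epNorm_lt_ofReal hA
  obtain ⟨C, hC0, hC⟩ := exists_lipschitz_finiteRankDet (p := p) hp (r + 1)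
  refine tendsto_nhds_limUnder (cauchy_map_iff_exists_tendsto.1 ?_)
  refine Metric.cauchy_iff.2 ⟨hne.map _, fun ε hε => ?_⟩
  -- Two operators within δ of `A` differ by less than 2δ, and C · 2δ < ε even when C = 0.
  set δ := ε / (4 * (C + 1)) with hδ
  have hδ0 : 0 < δ := by positivity
  refine ⟨_, image_mem_map (eventually_finiteRankNhds hp1 hr hAr hδ0), ?_⟩
  rintro _ ⟨F, ⟨hF1, hF2, hF3⟩, rfl⟩ _ ⟨G, ⟨hG1, hG2, hG3⟩, rfl⟩
  have hFG : epNorm p (F - G) < ENNReal.ofReal (2 * δ) := by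
    calc epNorm p (F - G) = epNorm p ((F - A) + (A - G)) := by rw [sub_add_sub_cancel]
      _ ≤ epNorm p (F - A) + epNorm p (G - A) :=
        (epNorm_add_le hp1 _ _).trans (by gcongr; exact epNorm_sub_comm_le hp1 _ _)
      _ < ENNReal.ofReal δ + ENNReal.ofReal δ := ENNReal.add_lt_add hF2 hG2
      _ = ENNReal.ofReal (2 * δ) := by rw [← ENNReal.ofReal_add hδ0.le hδ0.le, two_mul]
  have := hC F hF1 G hG1 hF3 hG3 (2 * δ) (by positivity) hFG
  rw [dist_eq_norm]
  calc _ ≤ C * (2 * δ) := this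
    _ < 4 * (C + 1) * δ := by nlinarith
    _ = ε := by rw [hδ]; field_simp

/-- `F` is itself a finite-rank operator at distance 0 from `F`, so the limit may be taken along the
constant value. -/
theorem renormDet_eq_finiteRankDet (hp : 2 < p) {F : LpC p →L[ℂ] LpC p}
    (hF : F ∈ finiteRankEp p) : renormDet p F = finiteRankDet p F := by
  have h1 : pure F ≤ finiteRankNhds F := by
    rw [(finiteRankNhds_hasBasis F).ge_iff]
    intro ε hε
    refine mem_pure.2 ⟨?_, hF⟩
    rw [Set.mem_ofPred_eq, sub_self, epNorm_zero (by linarith)]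
    exact hε
  exact tendsto_nhds_unique ((tendsto_finiteRankDet hp hF.1).mono_left h1) (tendsto_pure_nhds _ _)

theorem exists_norm_renormDet_le (hp : 2 < p) (r : ℝ) :
    ∃ C : ℝ, ∀ A : LpC p →L[ℂ] LpC p, epNorm p A < ENNReal.ofReal r →
      ‖renormDet p A‖ ≤ C := by
  obtain ⟨C, -, hC⟩ := exists_norm_finiteRankDet_le (p := p) hp (r + 1)
  refine ⟨C, fun A hAr => ?_⟩
  have hr : 0 ≤ r := by
    by_contra hr
    rw [ENNReal.ofReal_of_nonpos (not_le.1 hr).le] at hAr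
    exact not_lt_bot hAr
  have hA : MemEp p A := memEp_iff.2 (hAr.trans_le le_top)
  have hne := finiteRankNhds_neBot (show 1 < p by linarith) hA
  refine le_of_tendsto (tendsto_finiteRankDet hp hA).norm ?_
  filter_upwards [eventually_finiteRankNhds (by linarith) hr hAr one_pos] with F hF
  exact hC F hF.1 hF.2.2

/-- The determinant is Lipschitz on bounded sets of `E_p`. -/
theorem exists_lipschitz_renormDet (hp : 2 < p) (r : ℝ) :
    ∃ C : ℝ, 0 ≤ C ∧ ∀ A B : LpC p →L[ℂ] LpC p, epNorm p A < ENNReal.ofReal r →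
      epNorm p B < ENNReal.ofReal r → ∀ δ : ℝ, 0 < δ → epNorm p (A - B) < ENNReal.ofReal δ →
      ‖renormDet p A - renormDet p B‖ ≤ C * δ := by
  have hp1 : 1 < p := by linarith
  obtain ⟨C, hC0, hC⟩ := exists_lipschitz_finiteRankDet (p := p) hp (r + 1)
  refine ⟨3 * C, by positivity, fun A B hAr hBr δ hδ hAB => ?_⟩
  have hr : 0 ≤ r := by
    by_contra hr
    rw [ENNReal.ofReal_of_nonpos (not_le.1 hr).le] at hAr
    exact not_lt_bot hAr
  have hA : MemEp p A := memEp_iff.2 (hAr.trans_le le_top)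
  have hB : MemEp p B := memEp_iff.2 (hBr.trans_le le_top)
  have hneA := finiteRankNhds_neBot hp1 hA
  have hneB := finiteRankNhds_neBot hp1 hB
  have hlim : Tendsto (fun z : (LpC p →L[ℂ] LpC p) × (LpC p →L[ℂ] LpC p) =>
      ‖finiteRankDet p z.1 - finiteRankDet p z.2‖) (finiteRankNhds A ×ˢ finiteRankNhds B)
      (𝓝 ‖renormDet p A - renormDet p B‖) :=
    (((tendsto_finiteRankDet hp hA).comp tendsto_fst).sub
      ((tendsto_finiteRankDet hp hB).comp tendsto_snd)).norm
  refine le_of_tendsto hlim ?_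
  filter_upwards [(eventually_finiteRankNhds hp1 hr hAr hδ).prod_mk
    (eventually_finiteRankNhds hp1 hr hBr hδ)] with z hz
  obtain ⟨⟨hF1, hF2, hF3⟩, hG1, hG2, hG3⟩ := hz
  -- The path from one approximant to the other through A and B has three pieces, each shorter than
  -- δ.
  have hFG : epNorm p (z.1 - z.2) < ENNReal.ofReal (3 * δ) := by
    calc epNorm p (z.1 - z.2) = epNorm p ((z.1 - A) + ((A - B) + (B - z.2))) := by
          congr 1; abel
      _ ≤ epNorm p (z.1 - A) + (epNorm p (A - B) + epNorm p (z.2 - B)) := by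
          refine (epNorm_add_le hp1 _ _).trans ?_
          gcongr
          refine (epNorm_add_le hp1 _ _).trans ?_
          gcongr
          exact epNorm_sub_comm_le hp1 _ _
      _ < ENNReal.ofReal δ + (ENNReal.ofReal δ + ENNReal.ofReal δ) :=
          ENNReal.add_lt_add hF2 (ENNReal.add_lt_add hAB hG2)
      _ = ENNReal.ofReal (3 * δ) := by
          rw [← ENNReal.ofReal_add hδ.le hδ.le, ← ENNReal.ofReal_add hδ.le (by positivity)]
          congr 1
          ring
  refine (hC _ hF1 _ hG1 hF3 hG3 (3 * δ) (by positivity) hFG).trans_eq ?_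
  ring

theorem tendsto_renormDet (hp : 2 < p) {A : LpC p →L[ℂ] LpC p} (hA : MemEp p A) :
    Tendsto (renormDet p) (epNhds p A) (𝓝 (renormDet p A)) := by
  have hp1 : 1 < p := by linarith
  obtain ⟨r, hr, hAr⟩ := exists_epNorm_lt_ofReal hA
  obtain ⟨C, hC0, hC⟩ := exists_lipschitz_renormDet (p := p) hp (r + 1)
  rw [(epNhds_hasBasis A).tendsto_iff Metric.nhds_basis_ball]
  intro ε hε
  set δ := ε / (C + 1) with hδ
  have hδ0 : 0 < δ := by positivity
  refine ⟨min (ENNReal.ofReal δ) 1, by simp [hδ0], fun B hB => ?_⟩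
  have hB1 : epNorm p (B - A) < ENNReal.ofReal δ := lt_of_lt_of_le hB (min_le_left _ _)
  have hB2 : epNorm p (B - A) < 1 := lt_of_lt_of_le hB (min_le_right _ _)
  have hr1 : ENNReal.ofReal (r + 1) = 1 + ENNReal.ofReal r := by
    rw [ENNReal.ofReal_add hr zero_le_one, ENNReal.ofReal_one, add_comm]
  have hBr : epNorm p B < ENNReal.ofReal (r + 1) := by
    rw [hr1]
    calc epNorm p B = epNorm p ((B - A) + A) := by rw [sub_add_cancel]
      _ ≤ epNorm p (B - A) + epNorm p A := epNorm_add_le hp1 _ _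
      _ < 1 + ENNReal.ofReal r := ENNReal.add_lt_add hB2 hAr
  have := hC B A hBr (hAr.trans_le (ENNReal.ofReal_le_ofReal (by linarith))) δ hδ0 hB1
  rw [Metric.mem_ball, dist_eq_norm]
  calc _ ≤ C * δ := this
    _ < (C + 1) * δ := by nlinarith
    _ = ε := by rw [hδ]; field_simp

theorem renormDet_zero (hp : 2 < p) : renormDet p (0 : LpC p →L[ℂ] LpC p) = 1 := by
  have h0 : (0 : LpC p →L[ℂ] LpC p) ∈ finiteRankEp p := by
    refine ⟨memEp_iff.2 (by rw [epNorm_zero (by linarith)]; simp), ?_⟩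
    have : LinearMap.range (0 : LpC p →L[ℂ] LpC p).toLinearMap = ⊥ := LinearMap.range_zero
    rw [this]
    infer_instance
  rw [renormDet_eq_finiteRankDet hp h0,
    finiteRankDet_eq_expDet p 0 ⊥ fun f => by simp]
  have : restrictTo (0 : LpC p →L[ℂ] LpC p).toLinearMap ⊥ (fun f => by simp) = 0 := by
    ext
  rw [this, expDet]
  simp

end RenormDet

/-! ### Young, Hölder and interpolation inequalities -/

section Young

/-- Young's inequality for convolutions. -/
theorem lpE_convolution_le {q r s : ℝ} (hq : 1 ≤ q) (hr : 1 ≤ r) (hs : 0 < s)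
    (hqrs : q⁻¹ + r⁻¹ = 1 + s⁻¹) {f g : ℂ → ℝ≥0∞} (hf : AEMeasurable f) (hg : Measurable g) :
    lpE s (fun x => ∫⁻ y, f y * g (x - y)) ≤ lpE q f * lpE r g := by
  have hq0 : 0 < q := by linarith
  have hr0 : 0 < r := by linarith
  have hq1 : q⁻¹ ≤ 1 := inv_le_one_of_one_le₀ hq
  have hr1 : r⁻¹ ≤ 1 := inv_le_one_of_one_le₀ hr
  have hs0 : 0 < s⁻¹ := by positivity
  set X := ∫⁻ y, f y ^ q with hX
  set Y := ∫⁻ y, g y ^ r with hY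
  have hα : 0 ≤ q⁻¹ - s⁻¹ := by linarith
  have hβ : 0 ≤ r⁻¹ - s⁻¹ := by linarith
  have hgm : ∀ x, Measurable fun y => g (x - y) := fun x =>
    hg.comp (measurable_const.sub measurable_id)
  have hprod : AEMeasurable (fun z : ℂ × ℂ => f z.2 ^ q * g (z.1 - z.2) ^ r)
      (volume : Measure (ℂ × ℂ)) := by
    have h1 : AEMeasurable (fun z : ℂ × ℂ => f z.2) (volume : Measure (ℂ × ℂ)) :=
      hf.comp_quasiMeasurePreserving Measure.quasiMeasurePreserving_snd
    exact (h1.pow_const q).mul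
      ((hg.comp (measurable_fst.sub measurable_snd)).pow_const r).aemeasurable
  -- Hölder with three factors: fg = (f^q)^{1/q-1/s} (g^r)^{1/r-1/s} (f^q g^r)^{1/s}, whose outer
  -- exponents add up to 1 by the relation between q, r and s.
  have hpt : ∀ x, ∫⁻ y, f y * g (x - y)
      ≤ X ^ (q⁻¹ - s⁻¹) * Y ^ (r⁻¹ - s⁻¹) * (∫⁻ y, f y ^ q * g (x - y) ^ r) ^ s⁻¹ := by
    intro x
    have h := ENNReal.lintegral_prod_norm_pow_le (μ := (volume : Measure ℂ))
      (Finset.univ : Finset (Fin 3))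
      (f := ![fun y => f y ^ q, fun y => g (x - y) ^ r, fun y => f y ^ q * g (x - y) ^ r])
      (p := ![q⁻¹ - s⁻¹, r⁻¹ - s⁻¹, s⁻¹])
      (by
        intro i _
        fin_cases i
        · exact hf.pow_const q
        · exact ((hgm x).pow_const r).aemeasurable
        · exact (hf.pow_const q).mul ((hgm x).pow_const r).aemeasurable)
      (by rw [Fin.sum_univ_three]; simp; linarith)
      (by
        intro i _
        fin_cases i
        · exact hα
        · exact hβ
        · exact hs0.le)
    rw [Fin.prod_univ_three] at h
    simp only [Fin.prod_univ_three, Matrix.cons_val_zero, Matrix.cons_val_one, Matrix.cons_val] at h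
    rw [lintegral_sub_left_eq_self (fun y => g y ^ r) x] at h
    refine le_trans (le_of_eq (lintegral_congr fun y => ?_)) h
    rw [ENNReal.mul_rpow_of_nonneg _ _ hs0.le]
    have h1 : (f y ^ q) ^ (q⁻¹ - s⁻¹) * (f y ^ q) ^ s⁻¹ = f y := by
      rw [← ENNReal.rpow_add_of_nonneg _ _ hα hs0.le, sub_add_cancel, ← ENNReal.rpow_mul,
        mul_inv_cancel₀ hq0.ne', ENNReal.rpow_one]
    have h2 : (g (x - y) ^ r) ^ (r⁻¹ - s⁻¹) * (g (x - y) ^ r) ^ s⁻¹ = g (x - y) := by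
      rw [← ENNReal.rpow_add_of_nonneg _ _ hβ hs0.le, sub_add_cancel, ← ENNReal.rpow_mul,
        mul_inv_cancel₀ hr0.ne', ENNReal.rpow_one]
    calc f y * g (x - y)
        = ((f y ^ q) ^ (q⁻¹ - s⁻¹) * (f y ^ q) ^ s⁻¹)
          * ((g (x - y) ^ r) ^ (r⁻¹ - s⁻¹) * (g (x - y) ^ r) ^ s⁻¹) := by rw [h1, h2]
      _ = _ := by ring
  have htot : ∫⁻ x, ∫⁻ y, f y ^ q * g (x - y) ^ r = X * Y := by
    rw [lintegral_lintegral_swap hprod]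
    calc ∫⁻ y, ∫⁻ x, f y ^ q * g (x - y) ^ r = ∫⁻ y, f y ^ q * Y := by
          refine lintegral_congr fun y => ?_
          have hgy : Measurable fun x => g (x - y) ^ r :=
            (hg.comp (measurable_id.sub_const y)).pow_const r
          rw [lintegral_const_mul _ hgy,
            lintegral_sub_right_eq_self (fun x => g x ^ r) y]
      _ = X * Y := lintegral_mul_const'' _ (hf.pow_const q)
  have hm : AEMeasurable fun x => ∫⁻ y, f y ^ q * g (x - y) ^ r := hprod.lintegral_prod_right'
  calc lpE s (fun x => ∫⁻ y, f y * g (x - y))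
      ≤ lpE s (fun x => X ^ (q⁻¹ - s⁻¹) * Y ^ (r⁻¹ - s⁻¹)
          * (∫⁻ y, f y ^ q * g (x - y) ^ r) ^ s⁻¹) := lpE_mono hs hpt
    _ = X ^ (q⁻¹ - s⁻¹) * Y ^ (r⁻¹ - s⁻¹) * (X * Y) ^ s⁻¹ := by
        unfold lpE
        simp_rw [ENNReal.mul_rpow_of_nonneg _ _ hs.le]
        simp_rw [← ENNReal.rpow_mul, inv_mul_cancel₀ hs.ne', ENNReal.rpow_one]
        rw [lintegral_const_mul'' _ hm, htot, one_div]
        simp_rw [ENNReal.mul_rpow_of_nonneg _ _ hs0.le]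
        simp_rw [← ENNReal.rpow_mul, mul_assoc, mul_inv_cancel₀ hs.ne', mul_one]
    _ = X ^ (1 / q) * Y ^ (1 / r) := by
        rw [ENNReal.mul_rpow_of_nonneg _ _ hs0.le, mul_mul_mul_comm,
          ← ENNReal.rpow_add_of_nonneg _ _ hα hs0.le, ← ENNReal.rpow_add_of_nonneg _ _ hβ hs0.le,
          sub_add_cancel, sub_add_cancel, one_div, one_div]

theorem lpE_div_rpow {a m : ℝ} (hm : 0 < m) (f : ℂ → ℝ≥0∞) :
    lpE (a / m) (fun x => f x ^ m) ^ m⁻¹ = lpE a f := by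
  unfold lpE
  simp_rw [← ENNReal.rpow_mul, mul_div_cancel₀ a hm.ne']
  congr 1
  field_simp

/-- Young's inequality for `x ↦ ‖f g(x - ·)‖_m`. -/
theorem lpE_lpE_convolution_le {a r m c : ℝ} (hm : 0 < m) (hma : m ≤ a) (hmr : m ≤ r) (hc : 0 < c)
    (h : a⁻¹ + r⁻¹ = m⁻¹ + c⁻¹) {f g : ℂ → ℝ≥0∞} (hf : AEMeasurable f) (hg : Measurable g) :
    lpE c (fun x => lpE m fun y => f y * g (x - y)) ≤ lpE a f * lpE r g := by
  have ha : 0 < a := hm.trans_le hma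
  have hr : 0 < r := hm.trans_le hmr
  -- Young's inequality for f^m and g^m, all exponents being divided by m.
  have h1 := lpE_convolution_le (q := a / m) (r := r / m) (s := c / m)
    ((one_le_div hm).2 hma) ((one_le_div hm).2 hmr) (div_pos hc hm)
    (by
      have : m * (a⁻¹ + r⁻¹) = m * (m⁻¹ + c⁻¹) := by rw [h]
      rw [mul_add, mul_add, mul_inv_cancel₀ hm.ne'] at this
      simpa [inv_div, div_eq_mul_inv] using this)
    (hf.pow_const m) (hg.pow_const m)
  have h2 := ENNReal.rpow_le_rpow h1 (inv_nonneg.2 hm.le)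
  rw [ENNReal.mul_rpow_of_nonneg _ _ (inv_nonneg.2 hm.le), lpE_div_rpow hm, lpE_div_rpow hm] at h2
  refine le_trans (le_of_eq ?_) h2
  rw [← lpE_div_rpow hm]
  simp_rw [lpE_rpow hm, ENNReal.mul_rpow_of_nonneg _ _ hm.le]

theorem lpE_mul_le {q b c : ℝ} (hq : 0 < q) (hb : 0 < b) (hc : 0 < c) (h : q⁻¹ = b⁻¹ + c⁻¹)
    {f g : ℂ → ℝ≥0∞} (hf : AEMeasurable f) (hg : AEMeasurable g) :
    lpE q (fun x => f x * g x) ≤ lpE b f * lpE c g := by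
  refine ENNReal.lintegral_Lp_mul_le_Lq_mul_Lr hq ?_ (by simpa using h) volume hf hg
  have : b⁻¹ < q⁻¹ := by rw [h]; linarith [inv_pos.2 hc]
  exact (inv_lt_inv₀ hb hq).1 this

/-- Interpolation between two exponents. -/
theorem lpE_le_add {t a t' : ℝ} (ht : 0 < t) (hta : t ≤ a) (hat : a ≤ t') {f : ℂ → ℝ≥0∞}
    (hf : AEMeasurable f) : lpE a f ≤ lpE t f + lpE t' f := by
  have ha : 0 < a := ht.trans_le hta
  have ht' : 0 < t' := ha.trans_le hat
  -- The exponents themselves, not their reciprocals, are interpolated, so Hölder applies directly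
  -- to ∫ f^a.
  obtain ⟨l, m, hl, hm, hlm, hcomb⟩ : a ∈ segment ℝ t t' := by
    rw [segment_eq_Icc (hta.trans hat)]
    exact ⟨hta, hat⟩
  simp only [smul_eq_mul] at hcomb
  set N := lpE t f + lpE t' f with hN
  have h1 : ∫⁻ x, f x ^ a ≤ N ^ a := by
    calc ∫⁻ x, f x ^ a = ∫⁻ x, (f x ^ t) ^ l * (f x ^ t') ^ m := by
          refine lintegral_congr fun x => ?_
          rw [← ENNReal.rpow_mul, ← ENNReal.rpow_mul,
            ← ENNReal.rpow_add_of_nonneg _ _ (by positivity) (by positivity)]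
          congr 1
          linarith
      _ ≤ (∫⁻ x, f x ^ t) ^ l * (∫⁻ x, f x ^ t') ^ m :=
          ENNReal.lintegral_mul_norm_pow_le (hf.pow_const t) (hf.pow_const t') hl hm hlm
      _ ≤ (N ^ t) ^ l * (N ^ t') ^ m := by
          rw [← lpE_rpow ht, ← lpE_rpow ht']
          gcongr
          · exact le_self_add
          · exact le_add_self
      _ = N ^ a := by
          rw [← ENNReal.rpow_mul, ← ENNReal.rpow_mul,
            ← ENNReal.rpow_add_of_nonneg _ _ (by positivity) (by positivity)]
          congr 1
          linarith
  calc lpE a f ≤ (N ^ a) ^ (1 / a) := by unfold lpE; gcongr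
    _ = N := by rw [← ENNReal.rpow_mul, mul_one_div_cancel ha.ne', ENNReal.rpow_one]

end Young

/-! ### The iterated Cauchy kernel in the norm of `E_p` -/

section CauchyKernel

/-- The modulus `|z|⁻¹` of the Cauchy kernel. -/
def kap (z : ℂ) : ℝ≥0∞ := ‖z⁻¹‖ₑ

/-- The part of the Cauchy kernel in the unit ball. -/
def kapNear : ℂ → ℝ≥0∞ := (Metric.ball (0 : ℂ) 1).indicator kap

/-- The part of the Cauchy kernel outside of the unit ball. -/
def kapFar : ℂ → ℝ≥0∞ := (Metric.ball (0 : ℂ) 1)ᶜ.indicator kap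

theorem measurable_kap : Measurable kap := measurable_inv.enorm

theorem measurable_kapNear : Measurable kapNear := measurable_kap.indicator measurableSet_ball

theorem measurable_kapFar : Measurable kapFar := measurable_kap.indicator measurableSet_ball.compl

theorem kap_neg (z : ℂ) : kap (-z) = kap z := by simp [kap, inv_neg]

theorem kapNear_neg (z : ℂ) : kapNear (-z) = kapNear z := by
  simp [kapNear, Set.indicator, kap_neg]

theorem kapFar_neg (z : ℂ) : kapFar (-z) = kapFar z := by
  simp [kapFar, Set.indicator, kap_neg]

theorem kap_eq_add (z : ℂ) : kap z = kapNear z + kapFar z :=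
  (Set.indicator_self_add_compl_apply _ _ _).symm

/-- In real dimension 2, |z|^{-r} is integrable at the origin for r < 2. -/
theorem lpE_kapNear_ne_top {r : ℝ} (hr : 0 < r) (hr2 : r < 2) : lpE r kapNear ≠ ∞ := by
  rw [lpE_ne_top_iff hr]
  have h := integrableOn_ball_of_norm_le_rpow (μ := (volume : Measure ℂ)) (E := ℂ) (F := ℝ)
    (by simp) (f := fun x => ‖x‖ ^ (-r)) (C := 1) (α := r) (r := 1) (by simpa using hr2)
    (ae_of_all _ fun x => by rw [one_mul, Real.norm_of_nonneg (by positivity)])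
    (Measurable.aestronglyMeasurable (by fun_prop))
  have h2 := h.2
  rw [HasFiniteIntegral, ← lintegral_indicator measurableSet_ball] at h2
  refine ne_top_of_le_ne_top h2.ne (lintegral_mono fun x => ?_)
  by_cases hx : x ∈ Metric.ball (0 : ℂ) 1
  · rw [kapNear, Set.indicator_of_mem hx, Set.indicator_of_mem hx, kap, ← ofReal_norm,
      ENNReal.ofReal_rpow_of_nonneg (norm_nonneg _) hr.le, ← ofReal_norm]
    refine ENNReal.ofReal_le_ofReal ?_
    rw [norm_inv, Real.inv_rpow (norm_nonneg _), Real.rpow_neg (norm_nonneg _)]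
    exact le_abs_self _
  · rw [kapNear, Set.indicator_of_notMem hx, ENNReal.zero_rpow_of_pos hr]
    exact zero_le

/-- For |x| ≥ 1 one has 1/|x| ≤ 2/(1 + |x|), whose r-th power is integrable on the plane for r > 2.
-/
theorem lpE_kapFar_ne_top {r : ℝ} (hr2 : 2 < r) : lpE r kapFar ≠ ∞ := by
  have hr : 0 < r := by linarith
  rw [lpE_ne_top_iff hr]
  have h := finite_integral_one_add_norm (E := ℂ) (μ := (volume : Measure ℂ)) (r := r)
    (by simpa using hr2)
  have h2 : ∫⁻ x : ℂ, ENNReal.ofReal (2 ^ r) * ENNReal.ofReal ((1 + ‖x‖) ^ (-r)) ≠ ∞ := by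
    rw [lintegral_const_mul' _ _ ENNReal.ofReal_ne_top]
    exact ENNReal.mul_ne_top ENNReal.ofReal_ne_top h.ne
  refine ne_top_of_le_ne_top h2 (lintegral_mono fun x => ?_)
  by_cases hx : x ∈ Metric.ball (0 : ℂ) 1
  · rw [kapFar, Set.indicator_of_notMem (by simpa using hx), ENNReal.zero_rpow_of_pos hr]
    exact zero_le
  · rw [kapFar, Set.indicator_of_mem hx, kap, ← ofReal_norm,
      ENNReal.ofReal_rpow_of_nonneg (norm_nonneg _) hr.le, ← ENNReal.ofReal_mul (by positivity)]
    refine ENNReal.ofReal_le_ofReal ?_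
    have hx1 : 1 ≤ ‖x‖ := by simpa using hx
    rw [norm_inv, Real.rpow_neg (by positivity), ← Real.inv_rpow (by positivity),
      ← Real.mul_rpow (by norm_num) (by positivity)]
    refine Real.rpow_le_rpow (by positivity) ?_ hr.le
    rw [← div_eq_mul_inv, inv_le_comm₀ (by linarith) (by positivity), inv_div,
      div_le_iff₀ (by norm_num)]
    linarith

/-- The kernel `v(w) ∫ u(ζ) k₁(z - ζ) k₂(ζ - w) dζ`. -/
def iterKernel (k₁ k₂ u v : ℂ → ℝ≥0∞) (z w : ℂ) : ℝ≥0∞ :=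
  v w * ∫⁻ ζ, u ζ * k₁ (z - ζ) * k₂ (ζ - w)

theorem aemeasurable_iterKernel {k₁ k₂ u v : ℂ → ℝ≥0∞} (hk₁ : Measurable k₁) (hk₂ : Measurable k₂)
    (hu : AEMeasurable u) (hv : AEMeasurable v) :
    AEMeasurable (Function.uncurry (iterKernel k₁ k₂ u v)) (volume : Measure (ℂ × ℂ)) := by
  have h1 : AEMeasurable (fun z : ℂ × ℂ => v z.2) (volume : Measure (ℂ × ℂ)) :=
    hv.comp_quasiMeasurePreserving Measure.quasiMeasurePreserving_snd
  have h2 : AEMeasurable (fun x : (ℂ × ℂ) × ℂ => u x.2)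
      ((volume : Measure (ℂ × ℂ)).prod (volume : Measure ℂ)) :=
    hu.comp_quasiMeasurePreserving Measure.quasiMeasurePreserving_snd
  have h3 : AEMeasurable (fun x : (ℂ × ℂ) × ℂ => u x.2 * k₁ (x.1.1 - x.2) * k₂ (x.2 - x.1.2))
      ((volume : Measure (ℂ × ℂ)).prod (volume : Measure ℂ)) :=
    (h2.mul (hk₁.comp (by fun_prop)).aemeasurable).mul (hk₂.comp (by fun_prop)).aemeasurable
  exact h1.mul h3.lintegral_prod_right'

theorem aemeasurable_mul_comp_sub {k u : ℂ → ℝ≥0∞} (hk : Measurable k) (hu : AEMeasurable u) :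
    AEMeasurable (Function.uncurry fun x y => u y * k (x - y)) (volume : Measure (ℂ × ℂ)) := by
  have h1 : AEMeasurable (fun z : ℂ × ℂ => u z.2) (volume : Measure (ℂ × ℂ)) :=
    hu.comp_quasiMeasurePreserving Measure.quasiMeasurePreserving_snd
  exact h1.mul (hk.comp (by fun_prop)).aemeasurable

variable {p : ℝ}

/-- The norm of an iterated kernel, for convolution kernels in `L^{r₁}` and `L^{r₂}`, where
`1 / rᵢ = 1 / 2 + εᵢ`. -/
theorem kernelE_iterKernel_le (hp : 2 < p) {ε ε₁ ε₂ : ℝ} (hε₁ : |ε₁| ≤ ε) (hε₂ : |ε₂| ≤ ε)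
    (hεp : 4 * ε ≤ p⁻¹) (hεp' : 4 * ε ≤ 1 / 2 - p⁻¹) {k₁ k₂ u v : ℂ → ℝ≥0∞}
    (hk₁ : Measurable k₁) (hk₂ : Measurable k₂) (hk₂' : ∀ z, k₂ (-z) = k₂ z)
    (hu : AEMeasurable u) (hv : AEMeasurable v) (hvtop : ∀ x, v x ≠ ∞)
    (hk₂top : lpE (1 / 2 + ε₂)⁻¹ k₂ ≠ ∞) (hvp : lpE (1 / 2 - (ε₁ + ε₂) / 2)⁻¹ v ≠ ∞)
    (hk₁top : lpE (1 / 2 + ε₁)⁻¹ k₁ ≠ ∞) :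
    kernelE p (iterKernel k₁ k₂ u v) ≤
      lpE (1 / 2 + ε₁)⁻¹ k₁ * lpE (1 / 2 + ε₂)⁻¹ k₂ *
        (lpE (1 / 2 - (ε₁ + ε₂) / 2)⁻¹ u * lpE (1 / 2 - (ε₁ + ε₂) / 2)⁻¹ v) := by
  have hp0 : 0 < p := by linarith
  have hpi : 0 < p⁻¹ := by positivity
  have hp1 : p⁻¹ < 1 / 2 := by
    rw [one_div]; exact (inv_lt_inv₀ hp0 two_pos).2 hp
  have hq := conjExponent_pos (show 1 < p by linarith)
  have hqi : p.conjExponent⁻¹ = 1 - p⁻¹ := by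
    have := (Real.HolderConjugate.conjExponent (show 1 < p by linarith)).inv_add_inv_eq_one
    linarith
  obtain ⟨h11, h12⟩ := abs_le.1 hε₁
  obtain ⟨h21, h22⟩ := abs_le.1 hε₂
  -- The Greek letters are reciprocals of exponents: α for both potentials, ρ₁ and ρ₂ for the two
  -- convolution kernels, γ and μ for intermediate norms. Scaling forces 2α + ρ₁ + ρ₂ = 2.
  set α : ℝ := 1 / 2 - (ε₁ + ε₂) / 2 with hα
  set ρ₁ : ℝ := 1 / 2 + ε₁ with hρ₁
  set ρ₂ : ℝ := 1 / 2 + ε₂ with hρ₂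
  set γ : ℝ := 1 / 2 - p⁻¹ + (ε₁ + ε₂) / 2 with hγ
  have hα0 : 0 < α := by rw [hα]; linarith
  have hρ₁0 : 0 < ρ₁ := by rw [hρ₁]; linarith
  have hρ₂0 : 0 < ρ₂ := by rw [hρ₂]; linarith
  have hγ0 : 0 < γ := by rw [hγ]; linarith
  refine max_le ?_ ?_
  -- Rows: at fixed z, Hölder in w uses 1/p' = α + γ and Young uses μ + ρ₂ = 1 + γ. In z, Young uses
  -- α + ρ₁ = μ + 1/p.
  · set μ : ℝ := 1 - p⁻¹ + (ε₁ - ε₂) / 2 with hμ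
    have hμ0 : 0 < μ := by rw [hμ]; linarith
    have hin : ∀ z, lpE p.conjExponent (iterKernel k₁ k₂ u v z)
        ≤ lpE α⁻¹ v * lpE ρ₂⁻¹ k₂ * lpE μ⁻¹ fun ζ => u ζ * k₁ (z - ζ) := by
      intro z
      have hm : AEMeasurable fun ζ => u ζ * k₁ (z - ζ) :=
        hu.mul (hk₁.comp (by fun_prop)).aemeasurable
      have hI : AEMeasurable fun w => ∫⁻ ζ, u ζ * k₁ (z - ζ) * k₂ (ζ - w) := by
        have h1 : AEMeasurable (fun x : ℂ × ℂ => u x.2 * k₁ (z - x.2)) (volume : Measure (ℂ × ℂ)) :=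
          hm.comp_quasiMeasurePreserving Measure.quasiMeasurePreserving_snd
        have h2 : AEMeasurable (fun x : ℂ × ℂ => u x.2 * k₁ (z - x.2) * k₂ (x.2 - x.1))
            (volume : Measure (ℂ × ℂ)) := h1.mul (hk₂.comp (by fun_prop)).aemeasurable
        exact h2.lintegral_prod_right'
      calc lpE p.conjExponent (iterKernel k₁ k₂ u v z)
          ≤ lpE α⁻¹ v * lpE γ⁻¹ (fun w => ∫⁻ ζ, u ζ * k₁ (z - ζ) * k₂ (ζ - w)) := by
            refine lpE_mul_le hq (inv_pos.2 hα0) (inv_pos.2 hγ0) ?_ hv hI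
            rw [hqi, inv_inv, inv_inv, hα, hγ]
            ring
        _ ≤ lpE α⁻¹ v * (lpE μ⁻¹ (fun ζ => u ζ * k₁ (z - ζ)) * lpE ρ₂⁻¹ k₂) := by
            gcongr
            have h1 : ∀ w ζ, k₂ (ζ - w) = k₂ (w - ζ) := fun w ζ => by
              rw [← hk₂', neg_sub]
            simp_rw [h1]
            refine lpE_convolution_le ?_ ?_ (inv_pos.2 hγ0) ?_ hm hk₂
            · exact (one_le_inv₀ hμ0).2 (by rw [hμ]; linarith)
            · exact (one_le_inv₀ hρ₂0).2 (by rw [hρ₂]; linarith)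
            · simp only [inv_inv]
              rw [hμ, hρ₂, hγ]
              ring
        _ = _ := by ring
    calc mixedE p p.conjExponent (iterKernel k₁ k₂ u v)
        ≤ lpE p (fun z => lpE α⁻¹ v * lpE ρ₂⁻¹ k₂ * lpE μ⁻¹ fun ζ => u ζ * k₁ (z - ζ)) :=
          lpE_mono hp0 hin
      _ = lpE α⁻¹ v * lpE ρ₂⁻¹ k₂ * lpE p (fun z => lpE μ⁻¹ fun ζ => u ζ * k₁ (z - ζ)) :=
          lpE_const_mul hp0 (ENNReal.mul_ne_top hvp hk₂top) _
      _ ≤ lpE α⁻¹ v * lpE ρ₂⁻¹ k₂ * (lpE α⁻¹ u * lpE ρ₁⁻¹ k₁) := by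
          gcongr
          refine lpE_lpE_convolution_le (inv_pos.2 hμ0) ?_ ?_ hp0 ?_ hu hk₁
          · exact (inv_le_inv₀ hμ0 hα0).2 (by rw [hα, hμ]; linarith)
          · exact (inv_le_inv₀ hμ0 hρ₁0).2 (by rw [hρ₁, hμ]; linarith)
          · simp only [inv_inv]
            rw [hμ, hρ₁, hα]
            ring
      _ = _ := by ring
  -- Columns: at fixed w, Young in z uses μ + ρ₁ = 1 + 1/p. In w, Hölder uses 1/p' = α + γ and Young
  -- uses α + ρ₂ = μ + γ.
  · set μ : ℝ := 1 / 2 + p⁻¹ - ε₁ with hμ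
    have hμ0 : 0 < μ := by rw [hμ]; linarith
    have hin : ∀ w, lpE p (fun z => iterKernel k₁ k₂ u v z w)
        ≤ lpE ρ₁⁻¹ k₁ * (v w * lpE μ⁻¹ fun ζ => u ζ * k₂ (w - ζ)) := by
      intro w
      have hm : AEMeasurable fun ζ => u ζ * k₂ (w - ζ) :=
        hu.mul (hk₂.comp (by fun_prop)).aemeasurable
      unfold iterKernel
      rw [lpE_const_mul hp0 (hvtop w)]
      have h1 : ∀ z ζ, u ζ * k₁ (z - ζ) * k₂ (ζ - w) = u ζ * k₂ (w - ζ) * k₁ (z - ζ) :=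
        fun z ζ => by rw [← hk₂' (ζ - w), neg_sub]; ring
      simp_rw [h1]
      have h2 : lpE p (fun z => ∫⁻ ζ, u ζ * k₂ (w - ζ) * k₁ (z - ζ))
          ≤ lpE μ⁻¹ (fun ζ => u ζ * k₂ (w - ζ)) * lpE ρ₁⁻¹ k₁ := by
        refine lpE_convolution_le ?_ ?_ hp0 ?_ hm hk₁
        · exact (one_le_inv₀ hμ0).2 (by rw [hμ]; linarith)
        · exact (one_le_inv₀ hρ₁0).2 (by rw [hρ₁]; linarith)
        · simp only [inv_inv]
          rw [hμ, hρ₁]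
          ring
      calc _ ≤ v w * (lpE μ⁻¹ (fun ζ => u ζ * k₂ (w - ζ)) * lpE ρ₁⁻¹ k₁) := by gcongr
        _ = _ := by ring
    calc mixedE p.conjExponent p (fun w z => iterKernel k₁ k₂ u v z w)
        ≤ lpE p.conjExponent
          (fun w => lpE ρ₁⁻¹ k₁ * (v w * lpE μ⁻¹ fun ζ => u ζ * k₂ (w - ζ))) :=
          lpE_mono hq hin
      _ = lpE ρ₁⁻¹ k₁ * lpE p.conjExponent
          (fun w => v w * lpE μ⁻¹ fun ζ => u ζ * k₂ (w - ζ)) := lpE_const_mul hq hk₁top _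
      _ ≤ lpE ρ₁⁻¹ k₁ * (lpE α⁻¹ v * lpE γ⁻¹ fun w => lpE μ⁻¹ fun ζ => u ζ * k₂ (w - ζ)) := by
          gcongr
          refine lpE_mul_le hq (inv_pos.2 hα0) (inv_pos.2 hγ0) ?_ hv
            (aemeasurable_lpE _ (aemeasurable_mul_comp_sub hk₂ hu))
          rw [hqi, inv_inv, inv_inv, hα, hγ]
          ring
      _ ≤ lpE ρ₁⁻¹ k₁ * (lpE α⁻¹ v * (lpE α⁻¹ u * lpE ρ₂⁻¹ k₂)) := by
          gcongr
          refine lpE_lpE_convolution_le (inv_pos.2 hμ0) ?_ ?_ (inv_pos.2 hγ0) ?_ hu hk₂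
          · exact (inv_le_inv₀ hμ0 hα0).2 (by rw [hα, hμ]; linarith)
          · exact (inv_le_inv₀ hμ0 hρ₂0).2 (by rw [hρ₂, hμ]; linarith)
          · simp only [inv_inv]
            rw [hμ, hρ₂, hα, hγ]
            ring
      _ = _ := by ring

theorem iterKernel_kap_eq {u v : ℂ → ℝ≥0∞} (hu : AEMeasurable u) (z w : ℂ) :
    iterKernel kap kap u v z w =
      (iterKernel kapNear kapNear u v z w + iterKernel kapNear kapFar u v z w) +
      (iterKernel kapFar kapNear u v z w + iterKernel kapFar kapFar u v z w) := by
  unfold iterKernel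
  have hm : ∀ k₁ k₂ : ℂ → ℝ≥0∞, Measurable k₁ → Measurable k₂ →
      AEMeasurable fun ζ => u ζ * k₁ (z - ζ) * k₂ (ζ - w) := fun k₁ k₂ h₁ h₂ =>
    (hu.mul (h₁.comp (by fun_prop)).aemeasurable).mul (h₂.comp (by fun_prop)).aemeasurable
  rw [← mul_add, ← mul_add, ← mul_add,
    ← lintegral_add_left' (hm _ _ measurable_kapNear measurable_kapNear),
    ← lintegral_add_left' (hm _ _ measurable_kapFar measurable_kapNear),
    ← lintegral_add_left' ((hm _ _ measurable_kapNear measurable_kapNear).fun_add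
      (hm _ _ measurable_kapNear measurable_kapFar))]
  congr 1
  refine lintegral_congr fun ζ => ?_
  simp only [kap_eq_add]
  ring

/-- The sum of the norms in `L^t` and `L^{t'}`. -/
def potE (t : ℝ) (u : ℂ → ℝ≥0∞) : ℝ≥0∞ := lpE t u + lpE t.conjExponent u

/-- The product of two Cauchy kernels with potentials has a kernel of finite norm. -/
theorem exists_kernelE_iterKernel_kap_le (hp : 2 < p) {t : ℝ} (ht : 1 < t) (ht2 : t < 2) :
    ∃ C : ℝ≥0∞, C ≠ ∞ ∧ ∀ u v : ℂ → ℝ≥0∞, AEMeasurable u → AEMeasurable v → (∀ x, v x ≠ ∞) →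
      potE t v ≠ ∞ → kernelE p (iterKernel kap kap u v) ≤ C * (potE t u * potE t v) := by
  have hp0 : 0 < p := by linarith
  have hp1 : 1 < p := by linarith
  have hpi : 0 < p⁻¹ := by positivity
  have hpi2 : p⁻¹ < 1 / 2 := by
    rw [one_div]; exact (inv_lt_inv₀ hp0 two_pos).2 hp
  have ht0 : 0 < t := by linarith
  have hti : 1 / 2 < t⁻¹ := by
    rw [one_div]; exact (inv_lt_inv₀ two_pos ht0).2 ht2
  have ht'0 := conjExponent_pos ht
  have ht'i : t.conjExponent⁻¹ = 1 - t⁻¹ := by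
    have := (Real.HolderConjugate.conjExponent ht).inv_add_inv_eq_one
    linarith
  -- The first two conditions keep all exponents in the range of Young and Hölder; the last puts α
  -- between 1/t' and 1/t, so that the potentials are controlled by interpolation.
  obtain ⟨ε, hε0, hε1, hε2, hε3⟩ : ∃ ε : ℝ, 0 < ε ∧ 4 * ε ≤ p⁻¹ ∧ 4 * ε ≤ 1 / 2 - p⁻¹ ∧
      ε ≤ t⁻¹ - 1 / 2 := by
    refine ⟨min (min (p⁻¹ / 4) ((1 / 2 - p⁻¹) / 4)) (t⁻¹ - 1 / 2), ?_, ?_, ?_, ?_⟩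
    · exact lt_min (lt_min (by linarith) (by linarith)) (by linarith)
    · linarith [min_le_left (min (p⁻¹ / 4) ((1 / 2 - p⁻¹) / 4)) (t⁻¹ - 1 / 2),
        min_le_left (p⁻¹ / 4) ((1 / 2 - p⁻¹) / 4)]
    · linarith [min_le_left (min (p⁻¹ / 4) ((1 / 2 - p⁻¹) / 4)) (t⁻¹ - 1 / 2),
        min_le_right (p⁻¹ / 4) ((1 / 2 - p⁻¹) / 4)]
    · exact min_le_right _ _
  have hnear : lpE (1 / 2 + ε)⁻¹ kapNear ≠ ∞ := by
    refine lpE_kapNear_ne_top (by positivity) ?_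
    rw [inv_lt_comm₀ (by positivity) two_pos]
    linarith
  have hfar : lpE (1 / 2 + -ε)⁻¹ kapFar ≠ ∞ := by
    refine lpE_kapFar_ne_top ?_
    rw [lt_inv_comm₀ two_pos (by linarith)]
    linarith
  have hpot : ∀ (ε₁ ε₂ : ℝ), |ε₁| ≤ ε → |ε₂| ≤ ε → ∀ u : ℂ → ℝ≥0∞, AEMeasurable u →
      lpE (1 / 2 - (ε₁ + ε₂) / 2)⁻¹ u ≤ potE t u := by
    intro ε₁ ε₂ h₁ h₂ u hu
    obtain ⟨h11, h12⟩ := abs_le.1 h₁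
    obtain ⟨h21, h22⟩ := abs_le.1 h₂
    have hα0 : 0 < 1 / 2 - (ε₁ + ε₂) / 2 := by linarith
    refine lpE_le_add ht0 ?_ ?_ hu
    · rw [le_inv_comm₀ ht0 hα0]; linarith
    · rw [inv_le_comm₀ hα0 ht'0, ht'i]; linarith
  have habs : |ε| ≤ ε := (abs_of_pos hε0).le
  have habs' : |-ε| ≤ ε := by rw [abs_neg]; exact habs
  have main : ∀ (ε₁ ε₂ : ℝ) (k₁ k₂ : ℂ → ℝ≥0∞), |ε₁| ≤ ε → |ε₂| ≤ ε → Measurable k₁ →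
      Measurable k₂ → (∀ z, k₂ (-z) = k₂ z) → lpE (1 / 2 + ε₁)⁻¹ k₁ ≠ ∞ →
      lpE (1 / 2 + ε₂)⁻¹ k₂ ≠ ∞ → ∀ u v : ℂ → ℝ≥0∞, AEMeasurable u → AEMeasurable v →
      (∀ x, v x ≠ ∞) → potE t v ≠ ∞ → kernelE p (iterKernel k₁ k₂ u v) ≤
        lpE (1 / 2 + ε₁)⁻¹ k₁ * lpE (1 / 2 + ε₂)⁻¹ k₂ * (potE t u * potE t v) := by
    intro ε₁ ε₂ k₁ k₂ h₁ h₂ hk₁ hk₂ hk₂' hk₁t hk₂t u v hu hv hvt hvp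
    refine (kernelE_iterKernel_le hp h₁ h₂ hε1 hε2 hk₁ hk₂ hk₂' hu hv hvt hk₂t
      (ne_top_of_le_ne_top hvp (hpot _ _ h₁ h₂ v hv)) hk₁t).trans ?_
    gcongr
    · exact hpot _ _ h₁ h₂ u hu
    · exact hpot _ _ h₁ h₂ v hv
  set n := lpE (1 / 2 + ε)⁻¹ kapNear
  set f := lpE (1 / 2 + -ε)⁻¹ kapFar
  refine ⟨(n * n + n * f) + (f * n + f * f), ?_, fun u v hu hv hvt hvp => ?_⟩
  · exact ENNReal.add_ne_top.2 ⟨ENNReal.add_ne_top.2 ⟨ENNReal.mul_ne_top hnear hnear,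
      ENNReal.mul_ne_top hnear hfar⟩, ENNReal.add_ne_top.2 ⟨ENNReal.mul_ne_top hfar hnear,
      ENNReal.mul_ne_top hfar hfar⟩⟩
  · have hm : ∀ k₁ k₂ : ℂ → ℝ≥0∞, Measurable k₁ → Measurable k₂ →
        AEMeasurable (Function.uncurry (iterKernel k₁ k₂ u v)) := fun k₁ k₂ h₁ h₂ =>
      aemeasurable_iterKernel h₁ h₂ hu hv
    have hmN := measurable_kapNear
    have hmF := measurable_kapFar
    have h1 : iterKernel kap kap u v = fun z w =>
        (iterKernel kapNear kapNear u v z w + iterKernel kapNear kapFar u v z w) +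
        (iterKernel kapFar kapNear u v z w + iterKernel kapFar kapFar u v z w) := by
      ext z w
      exact iterKernel_kap_eq hu z w
    rw [h1]
    refine (kernelE_add_le hp1
      (b := fun z w => iterKernel kapNear kapNear u v z w + iterKernel kapNear kapFar u v z w)
      (c := fun z w => iterKernel kapFar kapNear u v z w + iterKernel kapFar kapFar u v z w)
      ((hm _ _ hmN hmN).add (hm _ _ hmN hmF)) ((hm _ _ hmF hmN).add (hm _ _ hmF hmF))).trans ?_
    rw [add_mul, add_mul, add_mul]
    refine add_le_add ((kernelE_add_le hp1 (hm _ _ hmN hmN) (hm _ _ hmN hmF)).trans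
      (add_le_add ?_ ?_)) ((kernelE_add_le hp1 (hm _ _ hmF hmN) (hm _ _ hmF hmF)).trans
      (add_le_add ?_ ?_))
    · exact main ε ε _ _ habs habs hmN hmN kapNear_neg hnear hnear u v hu hv hvt hvp
    · exact main ε (-ε) _ _ habs habs' hmN hmF kapFar_neg hnear hfar u v hu hv hvt hvp
    · exact main (-ε) ε _ _ habs' habs hmF hmN kapNear_neg hfar hnear u v hu hv hvt hvp
    · exact main (-ε) (-ε) _ _ habs' habs' hmF hmF kapFar_neg hfar hfar u v hu hv hvt hvp

end CauchyKernel

/-! ### Absolute convergence of the integrals -/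

section Finiteness

theorem ae_lt_top_of_lpE {s : ℝ} (hs : 0 < s) {f : ℂ → ℝ≥0∞} (hf : AEMeasurable f)
    (h : lpE s f ≠ ∞) : ∀ᵐ x, f x < ∞ := by
  filter_upwards [ae_lt_top' (hf.pow_const s) ((lpE_ne_top_iff hs).1 h)] with x hx
  refine lt_top_iff_ne_top.2 fun hx' => ?_
  rw [hx', ENNReal.top_rpow_of_pos hs] at hx
  exact lt_irrefl _ hx

variable {p : ℝ}

/-- A finite mixed norm gives finiteness on almost every section. Returning from sections to the
product requires a measurable set, hence the measurable representative. -/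
theorem ae_lt_top_of_kernelE (hp : 1 < p) {b : ℂ → ℂ → ℝ≥0∞}
    (hb : AEMeasurable (Function.uncurry b) (volume : Measure (ℂ × ℂ)))
    (h : kernelE p b ≠ ∞) : ∀ᵐ z : ℂ × ℂ, b z.1 z.2 < ∞ := by
  have hae : ∀ᵐ z : ℂ × ℂ, b z.1 z.2 = hb.mk _ (z.1, z.2) := hb.ae_eq_mk
  have hmk : kernelE p (fun x y => hb.mk _ (x, y)) ≠ ∞ := by
    refine ne_top_of_le_ne_top h (kernelE_mono_ae hp ?_)
    filter_upwards [hae] with z hz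
    rw [hz]
  have h1 : ∀ᵐ z : ℂ × ℂ, hb.mk _ z < ∞ := by
    refine (Measure.ae_prod_iff_ae_ae (μ := (volume : Measure ℂ)) (ν := (volume : Measure ℂ))
      (measurableSet_lt hb.measurable_mk measurable_const)).2 ?_
    filter_upwards [lpE_lt_top_ae (by linarith)
      (b := fun x y => hb.mk _ (x, y)) hb.measurable_mk.aemeasurable
      (ne_top_of_le_ne_top hmk (le_max_left _ _))] with x hx
    exact ae_lt_top_of_lpE (conjExponent_pos hp)
      (hb.measurable_mk.comp measurable_prodMk_left).aemeasurable hx.ne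
  filter_upwards [hae, h1] with z hz hz'
  rw [hz]
  exact hz'

theorem potE_cutoff_ne_top {t : ℝ} (ht : 1 < t) (n : ℝ) : potE t (fun x => ‖cutoff n x‖ₑ) ≠ ∞ :=
  ENNReal.add_ne_top.2
    ⟨lpE_cutoff_ne_top n (by linarith), lpE_cutoff_ne_top n (conjExponent_pos ht)⟩

theorem aemeasurable_enorm_cutoff (n : ℝ) : AEMeasurable fun x => ‖cutoff n x‖ₑ :=
  (measurable_cutoff n).enorm.aemeasurable

theorem exists_cutoff_eq_one (x : ℂ) : ∃ n : ℕ, cutoff n x = 1 := by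
  obtain ⟨n, hn⟩ := exists_nat_ge ‖x‖
  refine ⟨n, ?_⟩
  rw [cutoff, Set.indicator_of_mem (by simpa using hn)]

variable {t : ℝ}

theorem kernelE_iterKernel_kap_ne_top (hp : 2 < p) (ht : 1 < t) (ht2 : t < 2) {u v : ℂ → ℝ≥0∞}
    (hu : AEMeasurable u) (hv : AEMeasurable v) (hvt : ∀ x, v x ≠ ∞) (hup : potE t u ≠ ∞)
    (hvp : potE t v ≠ ∞) : kernelE p (iterKernel kap kap u v) ≠ ∞ := by
  obtain ⟨C, hC, h⟩ := exists_kernelE_iterKernel_kap_le hp ht ht2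
  exact ne_top_of_le_ne_top (ENNReal.mul_ne_top hC (ENNReal.mul_ne_top hup hvp))
    (h u v hu hv hvt hvp)

/-- The second potential is taken to be the indicator of a large ball, so that it equals 1 where
needed; the exponent 3 is an arbitrary choice above 2. -/
theorem ae_lintegral_kap_kap_lt_top (ht : 1 < t) (ht2 : t < 2) {u : ℂ → ℝ≥0∞}
    (hu : AEMeasurable u) (hup : potE t u ≠ ∞) :
    ∀ᵐ z : ℂ × ℂ, ∫⁻ ζ, u ζ * kap (z.1 - ζ) * kap (ζ - z.2) < ∞ := by
  have h : ∀ n : ℕ, ∀ᵐ z : ℂ × ℂ,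
      iterKernel kap kap u (fun x => ‖cutoff n x‖ₑ) z.1 z.2 < ∞ := fun n =>
    ae_lt_top_of_kernelE (p := 3) (by norm_num)
      (aemeasurable_iterKernel measurable_kap measurable_kap hu (aemeasurable_enorm_cutoff n))
      (kernelE_iterKernel_kap_ne_top (by norm_num) ht ht2 hu (aemeasurable_enorm_cutoff n)
        (fun _ => enorm_ne_top) hup (potE_cutoff_ne_top ht n))
  filter_upwards [ae_all_iff.2 h] with z hz
  obtain ⟨n, hn⟩ := exists_cutoff_eq_one z.2
  have := hz n
  simpa [iterKernel, hn] using this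

theorem lintegral_iterKernel_mul {u v h : ℂ → ℝ≥0∞} (hu : AEMeasurable u) (hv : AEMeasurable v)
    (hh : AEMeasurable h) (z : ℂ) :
    ∫⁻ w, iterKernel kap kap u v z w * h w
      = ∫⁻ ζ, u ζ * kap (z - ζ) * ∫⁻ w, kap (ζ - w) * (v w * h w) := by
  have hk := measurable_kap
  have h1 : ∀ w, AEMeasurable fun ζ => u ζ * kap (z - ζ) * kap (ζ - w) := fun w =>
    (hu.mul (hk.comp (by fun_prop)).aemeasurable).mul (hk.comp (by fun_prop)).aemeasurable
  have hvh : AEMeasurable (fun x : ℂ × ℂ => v x.1 * h x.1) (volume : Measure (ℂ × ℂ)) :=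
    (hv.mul hh).comp_quasiMeasurePreserving Measure.quasiMeasurePreserving_fst
  have hu2 : AEMeasurable (fun x : ℂ × ℂ => u x.2) (volume : Measure (ℂ × ℂ)) :=
    hu.comp_quasiMeasurePreserving Measure.quasiMeasurePreserving_snd
  have h2 : AEMeasurable (fun x : ℂ × ℂ => u x.2 * kap (z - x.2) * kap (x.2 - x.1)
      * (v x.1 * h x.1)) (volume : Measure (ℂ × ℂ)) :=
    ((hu2.mul (hk.comp (by fun_prop)).aemeasurable).mul
      (hk.comp (by fun_prop)).aemeasurable).mul hvh
  calc ∫⁻ w, iterKernel kap kap u v z w * h w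
      = ∫⁻ w, ∫⁻ ζ, u ζ * kap (z - ζ) * kap (ζ - w) * (v w * h w) := by
        refine lintegral_congr fun w => ?_
        rw [lintegral_mul_const'' _ (h1 w), iterKernel]
        ring
    _ = ∫⁻ ζ, ∫⁻ w, u ζ * kap (z - ζ) * kap (ζ - w) * (v w * h w) :=
        lintegral_lintegral_swap h2
    _ = _ := by
        refine lintegral_congr fun ζ => ?_
        simp_rw [mul_assoc (u ζ * kap (z - ζ))]
        have h3 : AEMeasurable fun w => kap (ζ - w) * (v w * h w) :=
          (hk.comp (by fun_prop)).aemeasurable.mul (hv.mul hh)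
        rw [lintegral_const_mul'' _ h3]

theorem ae_lintegral_outer_lt_top (hp : 2 < p) (ht : 1 < t) (ht2 : t < 2) {u v h : ℂ → ℝ≥0∞}
    (hu : AEMeasurable u) (hv : AEMeasurable v) (hvt : ∀ x, v x ≠ ∞) (hup : potE t u ≠ ∞)
    (hvp : potE t v ≠ ∞) (hh : AEMeasurable h) (hhp : lpE p h ≠ ∞) :
    ∀ᵐ z, ∫⁻ ζ, u ζ * kap (z - ζ) * ∫⁻ w, kap (ζ - w) * (v w * h w) < ∞ := by
  filter_upwards [lintegral_kernel_mul_lt_top (by linarith)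
    (aemeasurable_iterKernel measurable_kap measurable_kap hu hv)
    (kernelE_iterKernel_kap_ne_top hp ht ht2 hu hv hvt hup hvp) hh hhp] with z hz
  rwa [lintegral_iterKernel_mul hu hv hh] at hz

theorem aemeasurable_lintegral_kap_mul {f : ℂ → ℝ≥0∞} (hf : AEMeasurable f) :
    AEMeasurable fun ζ => ∫⁻ w, kap (ζ - w) * f w := by
  have h1 : AEMeasurable (fun x : ℂ × ℂ => f x.2) (volume : Measure (ℂ × ℂ)) :=
    hf.comp_quasiMeasurePreserving Measure.quasiMeasurePreserving_snd
  have h2 : AEMeasurable (fun x : ℂ × ℂ => kap (x.1 - x.2) * f x.2) (volume : Measure (ℂ × ℂ)) :=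
    (measurable_kap.comp (by fun_prop)).aemeasurable.mul h1
  exact h2.lintegral_prod_right'

/-- The outer potential is replaced by the indicator of a ball. Finiteness of the double integral at
a single z makes its integrand finite almost everywhere, hence the inner integral finite almost
everywhere on that ball. -/
theorem ae_lintegral_inner_lt_top (hp : 2 < p) (ht : 1 < t) (ht2 : t < 2) {v h : ℂ → ℝ≥0∞}
    (hv : AEMeasurable v) (hvt : ∀ x, v x ≠ ∞)
    (hvp : potE t v ≠ ∞) (hh : AEMeasurable h) (hhp : lpE p h ≠ ∞) :
    ∀ᵐ ζ, ∫⁻ w, kap (ζ - w) * (v w * h w) < ∞ := by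
  have hcut : ∀ n : ℕ, ∀ᵐ ζ, cutoff n ζ = 1 → ∫⁻ w, kap (ζ - w) * (v w * h w) < ∞ := by
    intro n
    obtain ⟨z, hz⟩ := (ae_lintegral_outer_lt_top hp ht ht2 (aemeasurable_enorm_cutoff n) hv hvt
      (potE_cutoff_ne_top ht n) hvp hh hhp).exists
    have hm : AEMeasurable fun ζ => ‖cutoff n ζ‖ₑ * kap (z - ζ)
        * ∫⁻ w, kap (ζ - w) * (v w * h w) :=
      ((aemeasurable_enorm_cutoff n).mul (measurable_kap.comp (by fun_prop)).aemeasurable).mul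
        (aemeasurable_lintegral_kap_mul (hv.mul hh))
    -- Since `0⁻¹ = 0`, the factor `kap (z - ζ)` vanishes at ζ = z and would hide an infinite inner
    -- integral there.
    have hne : ∀ᵐ ζ : ℂ, ζ ≠ z := by
      rw [ae_iff]
      simp
    filter_upwards [ae_lt_top' hm hz.ne, hne] with ζ h1 h2 h3
    rw [h3, enorm_one, one_mul] at h1
    refine lt_top_iff_ne_top.2 fun h4 => ?_
    rw [h4, ENNReal.mul_top] at h1
    · exact lt_irrefl _ h1
    · have : z - ζ ≠ 0 := sub_ne_zero.2 h2.symm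
      simpa [kap] using this
  filter_upwards [ae_all_iff.2 hcut] with ζ hζ
  obtain ⟨n, hn⟩ := exists_cutoff_eq_one ζ
  exact hζ n hn

end Finiteness

/-! ### The kernel of the scattering operator -/

section ScatteringKernel

theorem norm_ek (k z : ℂ) : ‖ek k z‖ = 1 := by
  have h : Complex.I * (k * z + conj k * conj z) = ((2 * (k * z).re : ℝ) : ℂ) * Complex.I := by
    rw [← map_mul, Complex.add_conj, mul_comm]
  rw [ek, h, Complex.norm_exp_ofReal_mul_I]

theorem enorm_ek (k z : ℂ) : ‖ek k z‖ₑ = 1 := by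
  rw [← ofReal_norm, norm_ek, ENNReal.ofReal_one]

theorem continuous_ek : Continuous fun x : ℂ × ℂ => ek x.1 x.2 := by
  unfold ek
  fun_prop

theorem enorm_conj_sub_inv (ζ w : ℂ) : ‖(conj ζ - conj w)⁻¹‖ₑ = kap (ζ - w) := by
  rw [kap, ← map_sub, ← map_inv₀, ← ofReal_norm, RCLike.norm_conj, ofReal_norm]

theorem enorm_conj (z : ℂ) : ‖conj z‖ₑ = ‖z‖ₑ := by
  rw [← ofReal_norm, RCLike.norm_conj, ofReal_norm]

/-- The integrand of the kernel of the scattering operator. -/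
def scatIntegrand (k : ℂ) (u : ℂ → ℂ) (z w ζ : ℂ) : ℂ :=
  (z - ζ)⁻¹ * (u ζ * ek (-k) ζ) * (conj ζ - conj w)⁻¹

/-- The constant in the kernel of the scattering operator. -/
def scatConst : ℂ := 1 / 4 * ((1 / (Real.pi : ℂ)) * (1 / (Real.pi : ℂ)))

/-- The kernel of `h ↦ (1/4) cauchy (u e_{-k} cauchyBar (e_k v̄ h))`. -/
def scatKernel (k : ℂ) (u v : ℂ → ℂ) (z w : ℂ) : ℂ :=
  scatConst * (ek k w * conj (v w)) * ∫ ζ, scatIntegrand k u z w ζ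

theorem enorm_scatIntegrand (k : ℂ) (u : ℂ → ℂ) (z w ζ : ℂ) :
    ‖scatIntegrand k u z w ζ‖ₑ = ‖u ζ‖ₑ * kap (z - ζ) * kap (ζ - w) := by
  rw [scatIntegrand, enorm_mul, enorm_mul, enorm_mul, enorm_ek, enorm_conj_sub_inv, mul_one,
    mul_comm (‖u ζ‖ₑ)]
  rfl

theorem aestronglyMeasurable_scatIntegrand_prod (k : ℂ) {u : ℂ → ℂ}
    (hu : AEStronglyMeasurable u volume) :
    AEStronglyMeasurable (fun x : (ℂ × ℂ) × ℂ => scatIntegrand k u x.1.1 x.1.2 x.2)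
      ((volume : Measure (ℂ × ℂ)).prod (volume : Measure ℂ)) := by
  have h1 : AEStronglyMeasurable (fun x : (ℂ × ℂ) × ℂ => u x.2)
      ((volume : Measure (ℂ × ℂ)).prod (volume : Measure ℂ)) := hu.comp_snd
  have h2 : Measurable fun x : (ℂ × ℂ) × ℂ => (x.1.1 - x.2)⁻¹ := by fun_prop
  have h3 : Measurable fun x : (ℂ × ℂ) × ℂ => (conj x.2 - conj x.1.2)⁻¹ := by
    refine Measurable.inv (Continuous.measurable ?_)
    fun_prop
  have h4 : Measurable fun x : (ℂ × ℂ) × ℂ => ek (-k) x.2 :=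
    (continuous_ek.comp (by fun_prop : Continuous fun x : (ℂ × ℂ) × ℂ => (-k, x.2))).measurable
  exact (h2.aestronglyMeasurable.mul (h1.mul h4.aestronglyMeasurable)).mul h3.aestronglyMeasurable

theorem aestronglyMeasurable_scatIntegrand (k : ℂ) {u : ℂ → ℂ}
    (hu : AEStronglyMeasurable u volume) (z w : ℂ) :
    AEStronglyMeasurable (scatIntegrand k u z w) volume := by
  have h2 : Measurable fun ζ : ℂ => (z - ζ)⁻¹ := by fun_prop
  have h3 : Measurable fun ζ : ℂ => (conj ζ - conj w)⁻¹ := by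
    refine Measurable.inv (Continuous.measurable ?_)
    fun_prop
  have h4 : Measurable fun ζ : ℂ => ek (-k) ζ :=
    (continuous_ek.comp (by fun_prop : Continuous fun ζ : ℂ => (-k, ζ))).measurable
  exact (h2.aestronglyMeasurable.mul (hu.mul h4.aestronglyMeasurable)).mul h3.aestronglyMeasurable

theorem aestronglyMeasurable_ek_conj (k : ℂ) {v : ℂ → ℂ} (hv : AEStronglyMeasurable v volume) :
    AEStronglyMeasurable (fun w => ek k w * conj (v w)) volume :=
  (continuous_ek.comp (by fun_prop : Continuous fun w : ℂ => (k, w))).aestronglyMeasurable.mul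
    (Complex.continuous_conj.comp_aestronglyMeasurable hv)

theorem aestronglyMeasurable_scatKernel (k : ℂ) {u v : ℂ → ℂ}
    (hu : AEStronglyMeasurable u volume) (hv : AEStronglyMeasurable v volume) :
    AEStronglyMeasurable (Function.uncurry (scatKernel k u v)) (volume : Measure (ℂ × ℂ)) := by
  have h1 : AEStronglyMeasurable (fun x : ℂ × ℂ => ek k x.2 * conj (v x.2))
      (volume : Measure (ℂ × ℂ)) := (aestronglyMeasurable_ek_conj k hv).comp_snd
  exact (h1.const_mul scatConst).mul
    (aestronglyMeasurable_scatIntegrand_prod k hu).integral_prod_right'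

/-- The exponentials are unimodular, so the majorant is independent of k. All uniformity in k, and
both dominated limits in k, rest on this. -/
theorem enorm_scatKernel_le (k : ℂ) (u v : ℂ → ℂ) (z w : ℂ) :
    ‖scatKernel k u v z w‖ₑ
      ≤ ‖scatConst‖ₑ * iterKernel kap kap (fun x => ‖u x‖ₑ) (fun x => ‖v x‖ₑ) z w := by
  rw [scatKernel, enorm_mul, enorm_mul, enorm_mul, enorm_ek, one_mul, enorm_conj, mul_assoc]
  unfold iterKernel
  gcongr
  refine (enorm_integral_le_lintegral_enorm _).trans_eq ?_
  simp_rw [enorm_scatIntegrand]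

variable {t : ℝ}

theorem MemPot.aestronglyMeasurable {u : ℂ → ℂ} (hu : MemPot t u) :
    AEStronglyMeasurable u volume := hu.1.1

theorem MemPot.sub {u v : ℂ → ℂ} (hu : MemPot t u) (hv : MemPot t v) : MemPot t (u - v) :=
  ⟨hu.1.sub hv.1, hu.2.sub hv.2⟩

theorem MemPot.potE_eq (ht : 1 < t) {u : ℂ → ℂ} (hu : MemPot t u) :
    potE t (fun x => ‖u x‖ₑ) = ENNReal.ofReal (potNorm t u) := by
  rw [potNorm, ENNReal.ofReal_add ENNReal.toReal_nonneg ENNReal.toReal_nonneg,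
    ENNReal.ofReal_toReal hu.1.2.ne, ENNReal.ofReal_toReal hu.2.2.ne,
    eLpNorm_ofReal (by linarith), eLpNorm_ofReal (conjExponent_pos ht), potE]

theorem MemPot.potE_ne_top (ht : 1 < t) {u : ℂ → ℂ} (hu : MemPot t u) :
    potE t (fun x => ‖u x‖ₑ) ≠ ∞ := by
  rw [hu.potE_eq ht]
  exact ENNReal.ofReal_ne_top

theorem potNorm_nonneg (t : ℝ) (u : ℂ → ℂ) : 0 ≤ potNorm t u := by
  unfold potNorm
  positivity

theorem ae_integrable_scatIntegrand (ht : 1 < t) (ht2 : t < 2) {u : ℂ → ℂ} (hu : MemPot t u) :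
    ∀ᵐ z : ℂ × ℂ, ∀ k, Integrable (scatIntegrand k u z.1 z.2) := by
  filter_upwards [ae_lintegral_kap_kap_lt_top ht ht2 hu.aestronglyMeasurable.enorm
    (hu.potE_ne_top ht)] with z hz k
  refine ⟨aestronglyMeasurable_scatIntegrand k hu.aestronglyMeasurable _ _, ?_⟩
  rw [HasFiniteIntegral]
  simpa only [enorm_scatIntegrand] using hz

variable {p : ℝ}

theorem exists_kernelNorm_scatKernel_le (hp : 2 < p) (ht : 1 < t) (ht2 : t < 2) :
    ∃ C : ℝ, 0 ≤ C ∧ ∀ (k : ℂ) (u v : ℂ → ℂ), MemPot t u → MemPot t v →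
      kernelNorm p (scatKernel k u v) ≤ ENNReal.ofReal (C * (potNorm t u * potNorm t v)) := by
  obtain ⟨C, hC, h⟩ := exists_kernelE_iterKernel_kap_le hp ht ht2
  refine ⟨(‖scatConst‖ₑ * C).toReal, ENNReal.toReal_nonneg, fun k u v hu hv => ?_⟩
  rw [kernelNorm_eq_kernelE, ENNReal.ofReal_mul ENNReal.toReal_nonneg,
    ENNReal.ofReal_mul (potNorm_nonneg t u),
    ENNReal.ofReal_toReal (ENNReal.mul_ne_top enorm_ne_top hC),
    ← hu.potE_eq ht, ← hv.potE_eq ht, mul_assoc]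
  refine (kernelE_mono_ae (by linarith) (c := fun z w => ‖scatConst‖ₑ *
    iterKernel kap kap (fun x => ‖u x‖ₑ) (fun x => ‖v x‖ₑ) z w) (ae_of_all _ fun z =>
    enorm_scatKernel_le k u v z.1 z.2)).trans ?_
  rw [kernelE_const_mul (by linarith) enorm_ne_top]
  gcongr
  exact h _ _ hu.aestronglyMeasurable.enorm hv.aestronglyMeasurable.enorm (fun _ => enorm_ne_top)
    (hv.potE_ne_top ht)

theorem kernelNorm_scatKernel_ne_top (hp : 2 < p) (ht : 1 < t) (ht2 : t < 2) (k : ℂ)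
    {u v : ℂ → ℂ} (hu : MemPot t u) (hv : MemPot t v) : kernelNorm p (scatKernel k u v) ≠ ∞ := by
  obtain ⟨C, -, h⟩ := exists_kernelNorm_scatKernel_le (p := p) hp ht ht2
  exact ne_top_of_le_ne_top ENNReal.ofReal_ne_top (h k u v hu hv)

/-- The usual splitting of a difference of bilinear expressions; it holds where both integrals
converge absolutely. -/
theorem ae_scatKernel_sub (ht : 1 < t) (ht2 : t < 2) (k : ℂ) {u v : ℂ → ℂ} (hu : MemPot t u)
    (hv : MemPot t v) : ∀ᵐ z : ℂ × ℂ, scatKernel k u u z.1 z.2 - scatKernel k v v z.1 z.2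
      = scatKernel k (u - v) u z.1 z.2 + scatKernel k v (u - v) z.1 z.2 := by
  filter_upwards [ae_integrable_scatIntegrand ht ht2 hu, ae_integrable_scatIntegrand ht ht2 hv]
    with z h1 h2
  have h3 : ∫ ζ, scatIntegrand k (u - v) z.1 z.2 ζ
      = (∫ ζ, scatIntegrand k u z.1 z.2 ζ) - ∫ ζ, scatIntegrand k v z.1 z.2 ζ := by
    rw [← integral_sub (h1 k) (h2 k)]
    refine integral_congr_ae (ae_of_all _ fun ζ => ?_)
    simp only [scatIntegrand, Pi.sub_apply]
    ring
  simp only [scatKernel, h3, Pi.sub_apply, map_sub]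
  ring

theorem aestronglyMeasurable_innerArg {k : ℂ} {u h : ℂ → ℂ} (hu : AEStronglyMeasurable u volume)
    (hh : AEStronglyMeasurable h volume) : AEStronglyMeasurable (innerArg k u h) volume :=
  (aestronglyMeasurable_ek_conj k hu).mul hh

theorem enorm_innerArg (k : ℂ) (u h : ℂ → ℂ) (w : ℂ) :
    ‖innerArg k u h w‖ₑ = ‖u w‖ₑ * ‖h w‖ₑ := by
  rw [innerArg, enorm_mul, enorm_mul, enorm_ek, one_mul, enorm_conj]

theorem aestronglyMeasurable_cauchyBar {f : ℂ → ℂ} (hf : AEStronglyMeasurable f volume) :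
    AEStronglyMeasurable (cauchyBar f) volume := by
  have h1 : AEStronglyMeasurable (fun x : ℂ × ℂ => f x.2) (volume : Measure (ℂ × ℂ)) := hf.comp_snd
  have h3 : Measurable fun x : ℂ × ℂ => (conj x.1 - conj x.2)⁻¹ := by
    refine Measurable.inv (Continuous.measurable ?_)
    fun_prop
  exact ((h3.aestronglyMeasurable.mul h1).integral_prod_right' (μ := volume)
    (ν := volume)).const_mul (1 / (Real.pi : ℂ))

theorem aestronglyMeasurable_outerArg {k : ℂ} {u h : ℂ → ℂ} (hu : AEStronglyMeasurable u volume)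
    (hh : AEStronglyMeasurable h volume) : AEStronglyMeasurable (outerArg k u h) volume := by
  have h4 : Measurable fun ζ : ℂ => ek (-k) ζ :=
    (continuous_ek.comp (by fun_prop : Continuous fun ζ : ℂ => (-k, ζ))).measurable
  exact (hu.mul h4.aestronglyMeasurable).mul
    (aestronglyMeasurable_cauchyBar (aestronglyMeasurable_innerArg hu hh))

theorem enorm_cauchyBar_innerArg_le (k : ℂ) (u h : ℂ → ℂ) (ζ : ℂ) :
    ‖cauchyBar (innerArg k u h) ζ‖ₑ
      ≤ ‖1 / (Real.pi : ℂ)‖ₑ * ∫⁻ w, kap (ζ - w) * (‖u w‖ₑ * ‖h w‖ₑ) := by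
  rw [cauchyBar, enorm_mul]
  gcongr
  refine (enorm_integral_le_lintegral_enorm _).trans_eq ?_
  simp_rw [enorm_mul, enorm_conj_sub_inv, enorm_innerArg]

theorem ae_integrable_inner (hp : 2 < p) (ht : 1 < t) (ht2 : t < 2) (k : ℂ) {u : ℂ → ℂ}
    (hu : MemPot t u) (h : LpC p) :
    ∀ᵐ ζ : ℂ, Integrable fun w => (conj ζ - conj w)⁻¹ * innerArg k u h w := by
  have hum := hu.aestronglyMeasurable
  have hh := Lp.aestronglyMeasurable h
  filter_upwards [ae_lintegral_inner_lt_top hp ht ht2 hum.enorm (fun _ => enorm_ne_top)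
    (hu.potE_ne_top ht) hh.enorm (lpE_coeFn_ne_top (by linarith) h)] with ζ hζ
  refine ⟨?_, ?_⟩
  · have h3 : Measurable fun w : ℂ => (conj ζ - conj w)⁻¹ := by
      refine Measurable.inv (Continuous.measurable ?_)
      fun_prop
    exact h3.aestronglyMeasurable.mul (aestronglyMeasurable_innerArg hum hh)
  · rw [HasFiniteIntegral]
    simpa only [enorm_mul, enorm_conj_sub_inv, enorm_innerArg] using hζ

theorem ae_lintegral_scattering_lt_top (hp : 2 < p) (ht : 1 < t) (ht2 : t < 2) {u : ℂ → ℂ}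
    (hu : MemPot t u) (h : LpC p) :
    ∀ᵐ z : ℂ, ∫⁻ ζ, ‖u ζ‖ₑ * kap (z - ζ) * ∫⁻ w, kap (ζ - w) * (‖u w‖ₑ * ‖h w‖ₑ) < ∞ :=
  ae_lintegral_outer_lt_top hp ht ht2 hu.aestronglyMeasurable.enorm
    hu.aestronglyMeasurable.enorm (fun _ => enorm_ne_top) (hu.potE_ne_top ht) (hu.potE_ne_top ht)
    (Lp.aestronglyMeasurable h).enorm (lpE_coeFn_ne_top (by linarith) h)

theorem ae_integrable_outer (hp : 2 < p) (ht : 1 < t) (ht2 : t < 2) (k : ℂ) {u : ℂ → ℂ}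
    (hu : MemPot t u) (h : LpC p) :
    ∀ᵐ z : ℂ, Integrable fun ζ => (z - ζ)⁻¹ * outerArg k u h ζ := by
  have hum := hu.aestronglyMeasurable
  have hh := Lp.aestronglyMeasurable h
  filter_upwards [ae_lintegral_scattering_lt_top hp ht ht2 hu h] with z hz
  refine ⟨?_, ?_⟩
  · have h3 : Measurable fun ζ : ℂ => (z - ζ)⁻¹ := by fun_prop
    exact h3.aestronglyMeasurable.mul (aestronglyMeasurable_outerArg hum hh)
  · rw [HasFiniteIntegral]
    calc ∫⁻ ζ, ‖(z - ζ)⁻¹ * outerArg k u h ζ‖ₑ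
        ≤ ∫⁻ ζ, ‖1 / (Real.pi : ℂ)‖ₑ *
          (‖u ζ‖ₑ * kap (z - ζ) * ∫⁻ w, kap (ζ - w) * (‖u w‖ₑ * ‖h w‖ₑ)) := by
          refine lintegral_mono fun ζ => ?_
          rw [outerArg, enorm_mul, enorm_mul, enorm_mul, enorm_ek, mul_one]
          calc ‖(z - ζ)⁻¹‖ₑ * (‖u ζ‖ₑ * ‖cauchyBar (innerArg k u h) ζ‖ₑ)
              ≤ ‖(z - ζ)⁻¹‖ₑ * (‖u ζ‖ₑ * (‖1 / (Real.pi : ℂ)‖ₑ *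
                ∫⁻ w, kap (ζ - w) * (‖u w‖ₑ * ‖h w‖ₑ))) := by
                gcongr
                exact enorm_cauchyBar_innerArg_le k u h ζ
            _ = _ := by rw [kap]; ring
      _ < ∞ := by
          rw [lintegral_const_mul' _ _ enorm_ne_top]
          exact ENNReal.mul_lt_top enorm_lt_top hz

/-- Fubini in (w, ζ), justified at almost every z by the finiteness of the double integral of
absolute values. -/
theorem ae_integral_scatKernel_mul (hp : 2 < p) (ht : 1 < t) (ht2 : t < 2) (k : ℂ) {u : ℂ → ℂ}
    (hu : MemPot t u) (h : LpC p) :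
    ∀ᵐ z : ℂ, ∫ w, scatKernel k u u z w * h w = (1 / 4) * cauchy (outerArg k u h) z := by
  have hum := hu.aestronglyMeasurable
  have hh := Lp.aestronglyMeasurable h
  filter_upwards [ae_lintegral_scattering_lt_top hp ht ht2 hu h] with z hz
  set G : ℂ → ℂ → ℂ := fun w ζ => scatIntegrand k u z w ζ * innerArg k u h w with hG
  have hGm : AEStronglyMeasurable (Function.uncurry G) (volume : Measure (ℂ × ℂ)) := by
    have h1 : AEStronglyMeasurable (fun x : ℂ × ℂ => u x.2) (volume : Measure (ℂ × ℂ)) :=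
      hum.comp_snd
    have h2 : Measurable fun x : ℂ × ℂ => (z - x.2)⁻¹ := by fun_prop
    have h3 : Measurable fun x : ℂ × ℂ => (conj x.2 - conj x.1)⁻¹ := by
      refine Measurable.inv (Continuous.measurable ?_)
      fun_prop
    have h4 : Measurable fun x : ℂ × ℂ => ek (-k) x.2 :=
      (continuous_ek.comp (by fun_prop : Continuous fun x : ℂ × ℂ => (-k, x.2))).measurable
    have h5 : AEStronglyMeasurable (fun x : ℂ × ℂ => innerArg k u h x.1)
        (volume : Measure (ℂ × ℂ)) := (aestronglyMeasurable_innerArg hum hh).comp_fst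
    exact ((h2.aestronglyMeasurable.mul (h1.mul h4.aestronglyMeasurable)).mul
      h3.aestronglyMeasurable).mul h5
  have hGi : Integrable (Function.uncurry G) ((volume : Measure ℂ).prod (volume : Measure ℂ)) := by
    refine ⟨hGm, ?_⟩
    rw [HasFiniteIntegral, lintegral_prod _ hGm.enorm]
    rw [← lintegral_iterKernel_mul hum.enorm hum.enorm hh.enorm] at hz
    refine lt_of_le_of_lt (lintegral_mono fun w => ?_) hz
    simp only [Function.uncurry_apply_pair, hG, enorm_mul, enorm_scatIntegrand, enorm_innerArg]
    have h1 : AEMeasurable fun ζ => ‖u ζ‖ₑ * kap (z - ζ) * kap (ζ - w) :=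
      (hum.enorm.mul (measurable_kap.comp (by fun_prop)).aemeasurable).mul
        (measurable_kap.comp (by fun_prop)).aemeasurable
    rw [lintegral_mul_const'' _ h1, iterKernel]
    exact le_of_eq (by ring)
  calc ∫ w, scatKernel k u u z w * h w = ∫ w, scatConst * ∫ ζ, G w ζ := by
        refine integral_congr_ae (ae_of_all _ fun w => ?_)
        simp only [hG, integral_mul_const, scatKernel, innerArg]
        ring
    _ = scatConst * ∫ ζ, ∫ w, G w ζ := by
        rw [integral_const_mul, integral_integral_swap hGi]
    -- The factor π undoes the 1/π contained in `cauchyBar`, which `scatConst` already counts.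
    _ = scatConst * ∫ ζ, Real.pi * ((z - ζ)⁻¹ * outerArg k u h ζ) := by
        congr 1
        refine integral_congr_ae (ae_of_all _ fun ζ => ?_)
        simp only [hG, scatIntegrand, outerArg, cauchyBar, mul_assoc]
        simp_rw [integral_const_mul]
        have : (Real.pi : ℂ) ≠ 0 := by exact_mod_cast Real.pi_ne_zero
        field_simp
    _ = (1 / 4) * cauchy (outerArg k u h) z := by
        have : (Real.pi : ℂ) ≠ 0 := by exact_mod_cast Real.pi_ne_zero
        rw [integral_const_mul, cauchy, scatConst]
        field_simp

variable [Fact (1 ≤ ENNReal.ofReal p)]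

/-- Both the existence of `scatteringOp` and its explicit kernel follow, whichever witness the
choice returns. -/
theorem isScatteringOp_iff (hp : 2 < p) (ht : 1 < t) (ht2 : t < 2) (k : ℂ) {u : ℂ → ℂ}
    (hu : MemPot t u) (T : LpC p →L[ℂ] LpC p) :
    IsScatteringOp p k u T ↔ IsIntegralKernel p T (scatKernel k u u) := by
  have hum := hu.aestronglyMeasurable
  constructor
  · intro hT
    refine ⟨aestronglyMeasurable_scatKernel k hum hum, fun h => ?_⟩
    filter_upwards [(hT h).2.2, ae_integral_scatKernel_mul hp ht ht2 k hu h] with z h1 h2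
    rw [h1, h2]
  · intro hT h
    refine ⟨ae_integrable_inner hp ht ht2 k hu h, ae_integrable_outer hp ht ht2 k hu h, ?_⟩
    filter_upwards [hT.2 h, ae_integral_scatKernel_mul hp ht ht2 k hu h] with z h1 h2
    rw [h1, h2]

theorem isScatteringOp_scatteringOp (hp : 2 < p) (ht : 1 < t) (ht2 : t < 2) (k : ℂ) {u : ℂ → ℂ}
    (hu : MemPot t u) : IsScatteringOp p k u (scatteringOp p k u) := by
  have hum := hu.aestronglyMeasurable
  have hex : ∃ T, IsScatteringOp p k u T := by
    obtain ⟨T, hT⟩ := exists_isIntegralKernel (p := p) (by linarith)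
      (aestronglyMeasurable_scatKernel k hum hum) (kernelNorm_scatKernel_ne_top hp ht ht2 k hu hu)
    exact ⟨T, (isScatteringOp_iff hp ht ht2 k hu T).2 hT⟩
  rw [scatteringOp, dif_pos hex]
  exact hex.choose_spec

theorem isIntegralKernel_scatteringOp (hp : 2 < p) (ht : 1 < t) (ht2 : t < 2) (k : ℂ) {u : ℂ → ℂ}
    (hu : MemPot t u) : IsIntegralKernel p (scatteringOp p k u) (scatKernel k u u) :=
  (isScatteringOp_iff hp ht ht2 k hu _).1 (isScatteringOp_scatteringOp hp ht ht2 k hu)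

end ScatteringKernel

/-! ### The determinant as a function of k and u -/

section ScatteringDet

/-- The phase is -2 Re(kζ). It is written here as a Fourier character of frequency conj k / π, the
form required by the Riemann–Lebesgue lemma. -/
theorem ek_neg_eq_exp (k ζ : ℂ) :
    ek (-k) ζ =
      Complex.exp ((2 * Real.pi * (-(inner ℝ ζ (conj k / Real.pi))) : ℝ) * Complex.I) := by
  rw [ek]
  congr 1
  have h1 : (-k) * ζ + conj (-k) * conj ζ = ((2 * (-(k * ζ).re) : ℝ) : ℂ) := by
    rw [← map_mul, Complex.add_conj]
    simp
  have h2 : inner ℝ ζ (conj k / Real.pi) = (k * ζ).re / Real.pi := by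
    rw [Complex.inner, div_mul_eq_mul_div, Complex.div_ofReal_re, ← map_mul, Complex.conj_re]
  rw [h1, h2, mul_comm]
  congr 2
  field_simp

theorem norm_scatIntegrand (k k' : ℂ) (u : ℂ → ℂ) (z w ζ : ℂ) :
    ‖scatIntegrand k u z w ζ‖ = ‖scatIntegrand k' u z w ζ‖ := by
  simp only [scatIntegrand, norm_mul, norm_ek]

theorem tendsto_scatKernel {u : ℂ → ℂ} (v : ℂ → ℂ) {z w : ℂ}
    (h : ∀ k, Integrable (scatIntegrand k u z w)) (k₀ : ℂ) :
    Tendsto (fun k => scatKernel k u v z w) (𝓝 k₀) (𝓝 (scatKernel k₀ u v z w)) := by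
  unfold scatKernel
  refine Tendsto.mul (Tendsto.mul tendsto_const_nhds (Tendsto.mul ?_ tendsto_const_nhds)) ?_
  · exact (continuous_ek.comp (by fun_prop : Continuous fun k : ℂ => (k, w))).tendsto k₀
  · refine tendsto_integral_filter_of_dominated_convergence
      (fun ζ => ‖scatIntegrand 0 u z w ζ‖) (Eventually.of_forall fun k => (h k).1)
      (Eventually.of_forall fun k => ae_of_all _ fun ζ => (norm_scatIntegrand k 0 u z w ζ).le)
      (h 0).norm (ae_of_all _ fun ζ => ?_)
    unfold scatIntegrand
    refine Tendsto.mul (Tendsto.mul tendsto_const_nhds (Tendsto.mul tendsto_const_nhds ?_))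
      tendsto_const_nhds
    exact (continuous_ek.comp (by fun_prop : Continuous fun k : ℂ => (-k, ζ))).tendsto k₀

/-- The kernel vanishes at high frequency, by the Riemann–Lebesgue lemma. -/
theorem tendsto_scatKernel_cocompact (u v : ℂ → ℂ) (z w : ℂ) :
    Tendsto (fun k => scatKernel k u v z w) (cocompact ℂ) (𝓝 0) := by
  -- Integrability is not needed: otherwise every integral in question is 0 by convention.
  have hRL := tendsto_integral_exp_inner_smul_cocompact (V := ℂ) (E := ℂ)
    fun ζ => (z - ζ)⁻¹ * u ζ * (conj ζ - conj w)⁻¹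
  have hlin : Tendsto (fun k : ℂ => conj k / Real.pi) (cocompact ℂ) (cocompact ℂ) := by
    rw [← Metric.cobounded_eq_cocompact, ← comap_norm_atTop, tendsto_comap_iff]
    have h1 : (norm ∘ fun k : ℂ => conj k / (Real.pi : ℂ)) = fun k => ‖k‖ / Real.pi := by
      ext k
      simp [abs_of_pos Real.pi_pos]
    rw [h1]
    exact tendsto_comap.atTop_div_const Real.pi_pos
  have hInt : Tendsto (fun k => ∫ ζ, scatIntegrand k u z w ζ) (cocompact ℂ) (𝓝 0) := by
    refine (hRL.comp hlin).congr fun k => integral_congr_ae (ae_of_all _ fun ζ => ?_)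
    simp only [scatIntegrand, ek_neg_eq_exp, Circle.smul_def, Real.fourierChar_apply, smul_eq_mul]
    ring
  -- The factor `ek k w` oscillates with k but has modulus 1; norms remove it.
  rw [tendsto_zero_iff_norm_tendsto_zero] at hInt ⊢
  have h2 : ∀ k, ‖scatKernel k u v z w‖
      = ‖scatConst‖ * ‖v w‖ * ‖∫ ζ, scatIntegrand k u z w ζ‖ := fun k => by
    rw [scatKernel, norm_mul, norm_mul, norm_mul, norm_ek, one_mul, RCLike.norm_conj]
  simp_rw [h2]
  simpa using hInt.const_mul (‖scatConst‖ * ‖v w‖)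

variable {p t : ℝ}

/-- Dominated convergence in the kernel norm. It is used with `K` the kernel at k₀ for continuity in
k, and with `K` zero at infinity. -/
theorem kernelE_scatKernel_tendsto_zero (hp : 2 < p) (ht : 1 < t) (ht2 : t < 2) {u : ℂ → ℂ}
    (hu : MemPot t u) {l : Filter ℂ} [l.IsCountablyGenerated] {K : ℂ → ℂ → ℂ}
    (hK : AEStronglyMeasurable (Function.uncurry K) (volume : Measure (ℂ × ℂ)))
    (hKle : ∀ z w, ‖K z w‖ₑ
      ≤ ‖scatConst‖ₑ * iterKernel kap kap (fun x => ‖u x‖ₑ) (fun x => ‖u x‖ₑ) z w)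
    (hlim : ∀ᵐ z : ℂ × ℂ, Tendsto (fun k => scatKernel k u u z.1 z.2) l (𝓝 (K z.1 z.2))) :
    Tendsto (fun k => kernelE p fun z w => ‖scatKernel k u u z w - K z w‖ₑ) l (𝓝 0) := by
  have hum := hu.aestronglyMeasurable
  refine kernelE_tendsto_zero (by linarith) (B := fun z w => (2 * ‖scatConst‖ₑ) *
    iterKernel kap kap (fun x => ‖u x‖ₑ) (fun x => ‖u x‖ₑ) z w)
    (fun k => ((aestronglyMeasurable_scatKernel k hum hum).sub hK).enorm)
    ((aemeasurable_iterKernel measurable_kap measurable_kap hum.enorm hum.enorm).const_mul _)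
    ?_ (fun k => ae_of_all _ fun z => ?_) ?_
  · have h2 : 2 * ‖scatConst‖ₑ ≠ ∞ := ENNReal.mul_ne_top ENNReal.ofNat_ne_top enorm_ne_top
    rw [kernelE_const_mul (by linarith) h2]
    exact ENNReal.mul_ne_top h2 (kernelE_iterKernel_kap_ne_top hp ht ht2 hum.enorm hum.enorm
      (fun _ => enorm_ne_top) (hu.potE_ne_top ht) (hu.potE_ne_top ht))
  · rw [two_mul, add_mul]
    exact enorm_sub_le.trans (add_le_add (enorm_scatKernel_le k u u _ _) (hKle _ _))
  · filter_upwards [hlim] with z hz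
    have := (hz.sub_const (K z.1 z.2)).enorm
    rwa [sub_self, enorm_zero] at this

variable [Fact (1 ≤ ENNReal.ofReal p)]

theorem epNorm_neg_scatteringOp_sub_le (hp : 2 < p) (ht : 1 < t) (ht2 : t < 2) (k k' : ℂ)
    {u u' : ℂ → ℂ} (hu : MemPot t u) (hu' : MemPot t u') :
    epNorm p (-scatteringOp p k u - -scatteringOp p k' u')
      ≤ kernelE p fun z w => ‖scatKernel k u u z w - scatKernel k' u' u' z w‖ₑ := by
  have hp1 : 1 < p := by linarith
  have h1 := isIntegralKernel_scatteringOp hp ht ht2 k hu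
  have h2 := isIntegralKernel_scatteringOp hp ht ht2 k' hu'
  have h3 := h1.add hp1 (h2.smul (-1)) (kernelNorm_scatKernel_ne_top hp ht ht2 k hu hu) (by
    rw [kernelNorm_const_mul hp1]
    exact ENNReal.mul_ne_top enorm_ne_top (kernelNorm_scatKernel_ne_top hp ht ht2 k' hu' hu'))
  rw [neg_sub_neg, ← neg_sub]
  refine (epNorm_neg_le hp1 _).trans ?_
  have h4 : scatteringOp p k u - scatteringOp p k' u'
      = scatteringOp p k u + (-1 : ℂ) • scatteringOp p k' u' := by
    rw [neg_one_smul, sub_eq_add_neg]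
  rw [h4]
  refine (epNorm_le h3).trans_eq ?_
  rw [kernelNorm_eq_kernelE]
  simp only [neg_one_mul, ← sub_eq_add_neg]

theorem epNorm_neg_scatteringOp_le (hp : 2 < p) (ht : 1 < t) (ht2 : t < 2) (k : ℂ)
    {u : ℂ → ℂ} (hu : MemPot t u) :
    epNorm p (-scatteringOp p k u) ≤ kernelNorm p (scatKernel k u u) :=
  (epNorm_neg_le (by linarith) _).trans
    (epNorm_le (isIntegralKernel_scatteringOp hp ht ht2 k hu))

/-- The operators `S_{k,u}` are bounded, uniformly in `k` and for `u` in a bounded set. -/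
theorem exists_epNorm_scatteringOp_lt (hp : 2 < p) (ht : 1 < t) (ht2 : t < 2) (R : ℝ) :
    ∃ r : ℝ, ∀ (k : ℂ) (u : ℂ → ℂ), MemPot t u → potNorm t u ≤ R →
      epNorm p (-scatteringOp p k u) < ENNReal.ofReal r := by
  obtain ⟨C, hC0, hC⟩ := exists_kernelNorm_scatKernel_le (p := p) hp ht ht2
  -- The added 1 makes the inequality strict.
  refine ⟨C * (R * R) + 1, fun k u hu huR => ?_⟩
  have h0 := potNorm_nonneg t u
  refine ((epNorm_neg_scatteringOp_le hp ht ht2 k hu).trans (hC k u u hu hu)).trans_lt ?_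
  have h1 : C * (potNorm t u * potNorm t u) ≤ C * (R * R) := by
    have hR0 : 0 ≤ R := h0.trans huR
    gcongr
  exact (ENNReal.ofReal_lt_ofReal_iff (by nlinarith [mul_nonneg hC0 (mul_self_nonneg R)])).2
    (by linarith)

theorem exists_norm_scatteringDet_le (hp : 2 < p) (ht : 1 < t) (ht2 : t < 2) (R : ℝ) :
    ∃ C : ℝ, ∀ (k : ℂ) (u : ℂ → ℂ), MemPot t u → potNorm t u ≤ R →
      ‖scatteringDet p k u‖ ≤ C := by
  obtain ⟨r, hr⟩ := exists_epNorm_scatteringOp_lt (p := p) hp ht ht2 R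
  obtain ⟨C, hC⟩ := exists_norm_renormDet_le (p := p) hp r
  exact ⟨C, fun k u hu huR => hC _ (hr k u hu huR)⟩

/-- Each of the two terms of the bilinear splitting is bounded by C R ‖u - u'‖ in `E_p`, and the
determinant is Lipschitz on the ball containing all the operators. -/
theorem exists_lipschitz_scatteringDet (hp : 2 < p) (ht : 1 < t) (ht2 : t < 2) (R : ℝ) :
    ∃ C : ℝ, 0 ≤ C ∧ ∀ u u' : ℂ → ℂ, MemPot t u → MemPot t u' →
      potNorm t u ≤ R → potNorm t u' ≤ R →
      ∀ k : ℂ, ‖scatteringDet p k u - scatteringDet p k u'‖ ≤ C * potNorm t (u - u') := by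
  have hp1 : 1 < p := by linarith
  obtain ⟨r, hr⟩ := exists_epNorm_scatteringOp_lt (p := p) hp ht ht2 R
  obtain ⟨L, hL0, hL⟩ := exists_lipschitz_renormDet (p := p) hp r
  obtain ⟨C, hC0, hC⟩ := exists_kernelNorm_scatKernel_le (p := p) hp ht ht2
  refine ⟨L * (C * (2 * |R|)), by positivity, fun u u' hu hu' huR hu'R k => ?_⟩
  have hd := hu.sub hu'
  set N := potNorm t (u - u') with hN
  have hN0 : 0 ≤ N := potNorm_nonneg t _
  have hu0 := potNorm_nonneg t u
  have hu'0 := potNorm_nonneg t u'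
  have hR0 : 0 ≤ R := hu0.trans huR
  have hum := hu.aestronglyMeasurable
  have hu'm := hu'.aestronglyMeasurable
  have hdm := hd.aestronglyMeasurable
  have hep : epNorm p (-scatteringOp p k u - -scatteringOp p k u')
      ≤ ENNReal.ofReal (C * (2 * |R|) * N) := by
    refine (epNorm_neg_scatteringOp_sub_le hp ht ht2 k k hu hu').trans ?_
    calc kernelE p (fun z w => ‖scatKernel k u u z w - scatKernel k u' u' z w‖ₑ)
        ≤ kernelE p (fun z w => ‖scatKernel k (u - u') u z w + scatKernel k u' (u - u') z w‖ₑ) := by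
          refine kernelE_mono_ae hp1 ?_
          filter_upwards [ae_scatKernel_sub ht ht2 k hu hu'] with z hz
          rw [hz]
      _ = kernelNorm p (fun z w => scatKernel k (u - u') u z w + scatKernel k u' (u - u') z w) :=
          (kernelNorm_eq_kernelE p _).symm
      _ ≤ _ := kernelNorm_add_le hp1 (aestronglyMeasurable_scatKernel k hdm hum)
          (aestronglyMeasurable_scatKernel k hu'm hdm)
      _ ≤ ENNReal.ofReal (C * (N * potNorm t u)) + ENNReal.ofReal (C * (potNorm t u' * N)) :=
          add_le_add (hC k _ _ hd hu) (hC k _ _ hu' hd)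
      _ = ENNReal.ofReal (C * (N * potNorm t u) + C * (potNorm t u' * N)) :=
          (ENNReal.ofReal_add (by positivity) (by positivity)).symm
      _ ≤ ENNReal.ofReal (C * (2 * |R|) * N) := by
          refine ENNReal.ofReal_le_ofReal ?_
          rw [abs_of_nonneg hR0]
          calc C * (N * potNorm t u) + C * (potNorm t u' * N)
              ≤ C * (N * R) + C * (R * N) := by gcongr
            _ = _ := by ring
  -- The Lipschitz bound for the determinant requires a strict inequality with a positive δ, even
  -- when u = u'. The slack η / (L + 1) costs at most η in the end.
  refine le_of_forall_pos_le_add fun η hη => ?_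
  set δ := C * (2 * |R|) * N + η / (L + 1) with hδ
  have hη' : 0 < η / (L + 1) := by positivity
  have hδ0 : 0 < δ := by positivity
  have h1 := hL _ _ (hr k u hu huR) (hr k u' hu' hu'R) δ hδ0
    (hep.trans_lt ((ENNReal.ofReal_lt_ofReal_iff hδ0).2 (by rw [hδ]; linarith)))
  refine h1.trans ?_
  have h2 : L * (η / (L + 1)) ≤ η := by
    rw [mul_div_assoc', div_le_iff₀ (by positivity)]
    nlinarith
  calc L * δ = L * (C * (2 * |R|)) * N + L * (η / (L + 1)) := by rw [hδ]; ring
    _ ≤ _ := by linarith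

theorem tendsto_scatteringDet_nhds (hp : 2 < p) (ht : 1 < t) (ht2 : t < 2) {u : ℂ → ℂ}
    (hu : MemPot t u) (k₀ : ℂ) :
    Tendsto (fun k => scatteringDet p k u) (𝓝 k₀) (𝓝 (scatteringDet p k₀ u)) := by
  have hum := hu.aestronglyMeasurable
  have hmem : MemEp p (-scatteringOp p k₀ u) := memEp_iff.2
    ((epNorm_neg_scatteringOp_le hp ht ht2 k₀ hu).trans_lt
      (kernelNorm_scatKernel_ne_top hp ht ht2 k₀ hu hu).lt_top)
  have hlim := kernelE_scatKernel_tendsto_zero hp ht ht2 hu (l := 𝓝 k₀) (K := scatKernel k₀ u u)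
    (aestronglyMeasurable_scatKernel k₀ hum hum) (enorm_scatKernel_le k₀ u u) (by
      filter_upwards [ae_integrable_scatIntegrand ht ht2 hu] with z hz
      exact tendsto_scatKernel u hz k₀)
  refine (tendsto_renormDet hp hmem).comp ?_
  rw [epNhds, tendsto_comap_iff]
  exact tendsto_of_tendsto_of_tendsto_of_le_of_le tendsto_const_nhds hlim (fun _ => zero_le)
    fun k => epNorm_neg_scatteringOp_sub_le hp ht ht2 k k₀ hu hu

theorem tendsto_scatteringDet_cocompact (hp : 2 < p) (ht : 1 < t) (ht2 : t < 2) {u : ℂ → ℂ}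
    (hu : MemPot t u) : Tendsto (fun k => scatteringDet p k u) (cocompact ℂ) (𝓝 1) := by
  have h0 : MemEp p (0 : LpC p →L[ℂ] LpC p) := memEp_iff.2 (by
    rw [epNorm_zero (by linarith)]
    simp)
  have : (cocompact ℂ).IsCountablyGenerated := by
    rw [← Metric.cobounded_eq_cocompact, ← comap_norm_atTop]
    infer_instance
  have hlim := kernelE_scatKernel_tendsto_zero hp ht ht2 hu (l := cocompact ℂ)
    (K := fun _ _ => 0) aestronglyMeasurable_const (fun z w => by simp)
    (ae_of_all _ fun z => tendsto_scatKernel_cocompact u u z.1 z.2)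
  rw [← renormDet_zero (p := p) hp]
  refine (tendsto_renormDet hp h0).comp ?_
  rw [epNhds, tendsto_comap_iff]
  refine tendsto_of_tendsto_of_tendsto_of_le_of_le tendsto_const_nhds hlim (fun _ => zero_le)
    fun k => ?_
  simp only [Function.comp_apply, sub_zero]
  refine (epNorm_neg_scatteringOp_le hp ht ht2 k hu).trans_eq ?_
  rw [kernelNorm_eq_kernelE]

/-- Joint continuity follows from continuity in k at the fixed potential u₀ and the Lipschitz bound
in u, which is uniform in k. -/
theorem exists_scatteringDet_sub_lt (hp : 2 < p) (ht : 1 < t) (ht2 : t < 2) (k₀ : ℂ)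
    {u₀ : ℂ → ℂ} (hu₀ : MemPot t u₀) {ε : ℝ} (hε : 0 < ε) : ∃ δ : ℝ, 0 < δ ∧
      ∀ (k : ℂ) (u : ℂ → ℂ), MemPot t u → ‖k - k₀‖ < δ → potNorm t (u - u₀) < δ →
        ‖scatteringDet p k u - scatteringDet p k₀ u₀‖ < ε := by
  obtain ⟨C, hC0, hC⟩ := exists_lipschitz_scatteringDet (p := p) hp ht ht2 (potNorm t u₀ + 1)
  obtain ⟨η, hη, hk⟩ := Metric.tendsto_nhds_nhds.1
    (tendsto_scatteringDet_nhds (p := p) hp ht ht2 hu₀ k₀) (ε / 2) (half_pos hε)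
  -- The bound 1 keeps u in the ball of radius `potNorm t u₀ + 1`, where C is valid; the last term
  -- makes the Lipschitz contribution at most ε/2.
  refine ⟨min (min η 1) (ε / (2 * (C + 1))), by positivity, fun k u hu hkδ huδ => ?_⟩
  have h1 : ‖k - k₀‖ < η := hkδ.trans_le ((min_le_left _ _).trans (min_le_left _ _))
  have h2 : potNorm t (u - u₀) < 1 := huδ.trans_le ((min_le_left _ _).trans (min_le_right _ _))
  have h3 : potNorm t (u - u₀) < ε / (2 * (C + 1)) := huδ.trans_le (min_le_right _ _)
  have h4 : potNorm t u ≤ potNorm t u₀ + 1 := by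
    have hd := hu.sub hu₀
    have h5 : ∀ s : ℝ, 1 ≤ s → MemLp (u - u₀) (ENNReal.ofReal s) volume →
        MemLp u₀ (ENNReal.ofReal s) volume →
        (eLpNorm u (ENNReal.ofReal s) volume).toReal ≤
          (eLpNorm (u - u₀) (ENNReal.ofReal s) volume).toReal
            + (eLpNorm u₀ (ENNReal.ofReal s) volume).toReal := by
      intro s hs h6 h7
      rw [← ENNReal.toReal_add h6.2.ne h7.2.ne]
      refine ENNReal.toReal_mono (ENNReal.add_ne_top.2 ⟨h6.2.ne, h7.2.ne⟩) ?_
      have h8 := eLpNorm_add_le h6.1 h7.1 (p := ENNReal.ofReal s)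
        (by rw [← ENNReal.ofReal_one]; exact ENNReal.ofReal_le_ofReal hs)
      rwa [sub_add_cancel] at h8
    have h6 := h5 t ht.le hd.1 hu₀.1
    have h7 := h5 t.conjExponent (one_lt_conjExponent ht).le hd.2 hu₀.2
    unfold potNorm at h2 ⊢
    linarith
  have h5 := hC u u₀ hu hu₀ h4 (by linarith) k
  have h6 : ‖scatteringDet p k u₀ - scatteringDet p k₀ u₀‖ < ε / 2 := by
    have := hk (x := k) (by rwa [dist_eq_norm])
    rwa [dist_eq_norm] at this
  have h7 : C * potNorm t (u - u₀) ≤ ε / 2 := by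
    have h8 := potNorm_nonneg t (u - u₀)
    rw [lt_div_iff₀ (by positivity)] at h3
    nlinarith
  calc _ = ‖(scatteringDet p k u - scatteringDet p k u₀)
        + (scatteringDet p k u₀ - scatteringDet p k₀ u₀)‖ := by rw [sub_add_sub_cancel]
    _ ≤ _ := norm_add_le _ _
    _ < ε := by linarith

end ScatteringDet

end DSII

end

/-! ### Assembly of the proposition -/

open DSII in
theorem propositionB1 (p t : ℝ) [Fact (1 ≤ ENNReal.ofReal p)]
    (ht₁ : 1 < t) (ht₂ : t < 4 / 3) (hp : 2 < p)
    (hpt₁ : 1 / 2 + 1 / p < 1 / t) (hpt₂ : 1 < 1 / p + 1 / t) :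
    -- `S_{k,u}` is a bounded operator on `L^p` given by its formula, and belongs to `E_p`
    (∀ (k : ℂ) (u : ℂ → ℂ), MemPot t u →
      IsScatteringOp p k u (scatteringOp p k u) ∧ MemEp p (scatteringOp p k u)) ∧
    -- the determinant is well defined: the finite-rank operators are dense in `E_p`, and
    -- `Det (I + ·)` is a continuous function on `E_p` with the prescribed values on them
    ((∀ A : LpC p →L[ℂ] LpC p, MemEp p A → ∀ ε : ℝ≥0∞, 0 < ε →
        ∃ F ∈ finiteRankEp p, epNorm p (F - A) < ε) ∧
      (∀ F ∈ finiteRankEp p, renormDet p F = finiteRankDet p F) ∧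
      (∀ A : LpC p →L[ℂ] LpC p, MemEp p A →
        Tendsto (renormDet p) (epNhds p A) (𝓝 (renormDet p A)))) ∧
    -- `D` is bounded, uniformly in `k` and in `u` on bounded sets
    (∀ R : ℝ, ∃ C : ℝ, ∀ (k : ℂ) (u : ℂ → ℂ), MemPot t u → potNorm t u ≤ R →
      ‖scatteringDet p k u‖ ≤ C) ∧
    -- `D` is jointly continuous in `(k, u)`
    (∀ (k₀ : ℂ) (u₀ : ℂ → ℂ), MemPot t u₀ → ∀ ε : ℝ, 0 < ε → ∃ δ : ℝ, 0 < δ ∧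
      ∀ (k : ℂ) (u : ℂ → ℂ), MemPot t u → ‖k - k₀‖ < δ → potNorm t (u - u₀) < δ →
        ‖scatteringDet p k u - scatteringDet p k₀ u₀‖ < ε) ∧
    -- `D(k,u) → 1` as `|k| → ∞`
    (∀ u : ℂ → ℂ, MemPot t u →
      Tendsto (fun k => scatteringDet p k u) (cocompact ℂ) (𝓝 1)) ∧
    -- `D` is Lipschitz in `u` on bounded sets, uniformly in `k`
    (∀ R : ℝ, ∃ C : ℝ, ∀ u u' : ℂ → ℂ, MemPot t u → MemPot t u' →
      potNorm t u ≤ R → potNorm t u' ≤ R →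
      ∀ k : ℂ, ‖scatteringDet p k u - scatteringDet p k u'‖ ≤ C * potNorm t (u - u')) := by
  have ht : t < 2 := by linarith
  refine ⟨fun k u hu => ⟨isScatteringOp_scatteringOp hp ht₁ ht k hu, scatKernel k u u,
      isIntegralKernel_scatteringOp hp ht₁ ht k hu,
      (kernelNorm_scatKernel_ne_top hp ht₁ ht k hu hu).lt_top⟩,
    ⟨fun A hA ε hε => exists_finiteRankEp_epNorm_sub_lt (by linarith) hA hε,
      fun F hF => renormDet_eq_finiteRankDet hp hF, fun A hA => tendsto_renormDet hp hA⟩,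
    exists_norm_scatteringDet_le hp ht₁ ht,
    fun k₀ u₀ hu₀ ε hε => exists_scatteringDet_sub_lt hp ht₁ ht k₀ hu₀ hε,
    fun u hu => tendsto_scatteringDet_cocompact hp ht₁ ht hu, fun R => ?_⟩
  obtain ⟨C, -, hC⟩ := exists_lipschitz_scatteringDet (p := p) hp ht₁ ht R
  exact ⟨C, hC⟩
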